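/- Let $p$ be a prime and let $(R_0,\mathfrak m_0)$ be a Noetherian local ring of characteristic $p$ that is F-finite, i.e. whose Frobenius endomorphism is finite. Let $R=\bigoplus_{n\ge 0}R_n$ be a positively graded algebra of finite type over its degree-zero part $R_0$, let $R_{>0}$ be the ideal generated by the homogeneous elements of positive degree, and let $\mathfrak m=\mathfrak m_0R+R_{>0}$. Let $M$ be a finitely generated $\mathbb Z$-graded $R$-module. Notation. For a module $N$ over a ring $A$ of characteristic $p$, $F^e_*N$ is $N$ with $A$ acting through the $e$-th iterate of Frobenius; $\mu_A$ denotes the minimal number of generators and $\lambda_A$ the length. For a prime $P$ of $A$ with residue field $\kappa(P)$ put $\alpha(P)=\log_p[F_*\kappa(P):\kappa(P)]$, $\gamma(A)=\max\{\alpha(P) : P\in\operatorname{Spec}A\}$ (and $\gamma(0)=0$), and $\gamma(M)=\gamma(R/\operatorname{ann}M)$. For a resolution $\cdots\to R^{b_1(e)}\xrightarrow{\varphi_1(e)}R^{b_0(e)}\xrightarrow{\varphi_0(e)}F^e_*M\to0$ by finitely generated free modules, put $\Omega_i(e)=\operatorname{im}\varphi_i(e)$; the resolution is called minimal if $\mu_R(\Omega_i(e))=b_i(e)$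 for all $i\ge 0$. Define $$\beta_i^F(M,\gamma)=\lim_{e\to\infty}\frac{\mu_R(\Omega_i(e))}{p^{e\gamma}}\quad\text{(for minimal free resolutions)},\qquad \chi_i^F(M,\gamma)=\lim_{e\to\infty}\frac{\mu_R(\Omega_i(e))+\sum_{j=1}^i(-1)^jb_{i-j}(e)}{p^{e\gamma}}\quad\text{(for arbitrary free resolutions)}.$$ For a finitely generated module $N$ over an F-finite local ring $A$ with maximal ideal $\mathfrak n$ and residue field $k$, define $$\beta_i^F(N,\gamma)=\lim_{e\to\infty}\frac{\lambda_A(\operatorname{Tor}_i^A(k,F^e_*N))}{p^{e\gamma}},\qquad \chi_i^F(N,\gamma)=\lim_{e\to\infty}\frac{\sum_{j=0}^i(-1)^{i-j}\lambda_A(\operatorname{Tor}_j^A(k,F^e_*N))}{p^{e\gamma}}.$$ Then for every integer $\gamma\ge\gamma(M)$ with $\gamma\ge\min\{1,\dim R\}$ and every $i\ge 0$, minimal free resolutions of all $F^e_*M$ exist, all four limits (with $A=R_{\mathfrak m}$ and $N=M_{\mathfrak m}$) exist, the first two do not depend on the chosen resolutions, and $$\beta_i^F(M,\gamma)=\beta_i^F(M_{\mathfrak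 m},\gamma),\qquad \chi_i^F(M,\gamma)=\chi_i^F(M_{\mathfrak m},\gamma).$$ In particular, the global Hilbert–Kunz multiplicity $e_{HK}(M)=\lim_{e\to\infty}\mu_R(F^e_*M)/p^{e\gamma(R)}$ exists and equals the Hilbert–Kunz multiplicity $e_{HK}(M_{\mathfrak m})=\lim_{e\to\infty}\lambda_{R_{\mathfrak m}}\bigl(M_{\mathfrak m}/\mathfrak m^{[p^e]}M_{\mathfrak m}\bigr)/p^{e\dim R_{\mathfrak m}}$ of the $R_{\mathfrak m}$-module $M_{\mathfrak m}$, where $\mathfrak m^{[p^e]}$ is the ideal generated by the $p^e$-th powers of the elements of $\mathfrak m$. -/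

import Mathlib

open Filter Topology IsLocalRing

universe u v

namespace GradedFrobenius

noncomputable section

section Frobenius

/-- `F^e_* M`: the abelian group `M`, on which `R` acts through the `e`-th iterate of the Frobenius
endomorphism of `R`. -/
def FrobeniusPushforward (_p _e : ℕ) (M : Type v) : Type v := M

instance (p e : ℕ) (M : Type v) [AddCommGroup M] : AddCommGroup (FrobeniusPushforward p e M) :=
  inferInstanceAs (AddCommGroup M)

/-- `r • x = r ^ (p ^ e) • x`. -/
instance (p e : ℕ) (R : Type u) [CommRing R] [ExpChar R p] (M : Type v) [AddCommGroup M]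
    [Module R M] : Module R (FrobeniusPushforward p e M) :=
  Module.compHom M (iterateFrobenius R p e)

/-- `R` is F-finite: the Frobenius endomorphism is a finite ring homomorphism. -/
def IsFFinite (p : ℕ) (R : Type u) [CommRing R] [ExpChar R p] : Prop :=
  (frobenius R p).Finite

/-- `[F_* K : K] = [K : K ^ p]` for a field `K` of characteristic `p`; the set of `p`-th powers is
then itself a subfield, so that the closure adds nothing. -/
def frobeniusDegree (p : ℕ) (K : Type u) [Field K] : ℕ :=
  Module.finrank (Subfield.closure (Set.range fun x : K => x ^ p)) K

/-- `α(P) = log_p [F_* κ(P) : κ(P)]`; over an F-finite ring the degree is a power of `p`. -/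
def alpha (p : ℕ) {R : Type u} [CommRing R] (P : PrimeSpectrum R) : ℕ :=
  Nat.log p (frobeniusDegree p P.asIdeal.ResidueField)

/-- `γ(R) = max {α(P) | P ∈ Spec R}`. -/
def gammaRing (p : ℕ) (R : Type u) [CommRing R] : ℕ :=
  ⨆ P : PrimeSpectrum R, alpha p P

/-- `γ(M) = γ(R / ann M)`. -/
def gammaModule (p : ℕ) (R : Type u) [CommRing R] (M : Type v) [AddCommGroup M] [Module R M] : ℕ :=
  gammaRing p (R ⧸ Module.annihilator R M)

end Frobenius

section Global

/-- The minimal number of generators of a finitely generated module. -/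
def mu (R : Type u) [CommRing R] (N : Type v) [AddCommGroup N] [Module R N] : ℕ :=
  (⊤ : Submodule R N).spanFinrank

/-- A resolution `⋯ → R^{b 1} → R^{b 0} → N → 0` by finitely generated free modules. -/
structure FreeResolution (R : Type u) [CommRing R] (N : Type v) [AddCommGroup N]
    [Module R N] where
  /-- the ranks -/
  b : ℕ → ℕ
  /-- the augmentation `φ_0` -/
  aug : (Fin (b 0) → R) →ₗ[R] N
  /-- the differentials, `d i = φ_{i+1}` -/
  d : ∀ i, (Fin (b (i + 1)) → R) →ₗ[R] (Fin (b i) → R)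
  aug_surjective : Function.Surjective aug
  exact_zero : Function.Exact (d 0) aug
  exact_succ : ∀ i, Function.Exact (d (i + 1)) (d i)

namespace FreeResolution

variable {R : Type u} [CommRing R] {N : Type v} [AddCommGroup N] [Module R N]

/-- `μ_R(Ω_i)`, where `Ω_i = im φ_i`. -/
def muSyzygy (G : FreeResolution R N) : ℕ → ℕ
  | 0 => mu R (LinearMap.range G.aug)
  | i + 1 => mu R (LinearMap.range (G.d i))

/-- The resolution is minimal if `μ_R(Ω_i) = b_i` for all `i`. -/
def IsMinimal (G : FreeResolution R N) : Prop :=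
  ∀ i, G.muSyzygy i = G.b i

/-- `μ_R(Ω_i) + ∑_{j=1}^{i} (-1)^j b_{i-j}`. -/
def euler (G : FreeResolution R N) (i : ℕ) : ℤ :=
  (G.muSyzygy i : ℤ) + ∑ j ∈ Finset.Icc 1 i, (-1) ^ j * (G.b (i - j) : ℤ)

end FreeResolution

variable (p : ℕ) (R : Type u) [CommRing R] [ExpChar R p] (M : Type v) [AddCommGroup M] [Module R M]

/-- The global Frobenius Betti number `β_i^F(M, γ) = lim_e μ_R(Ω_i(e)) / p^{eγ}` exists, does not
depend on the chosen minimal free resolutions of the modules `F^e_* M`, and equals `c`. -/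
def HasGlobalBetti (γ i : ℕ) (c : ℝ) : Prop :=
  (∀ e, ∃ G : FreeResolution R (FrobeniusPushforward p e M), G.IsMinimal) ∧
  ∀ G : ∀ e, FreeResolution R (FrobeniusPushforward p e M), (∀ e, (G e).IsMinimal) →
    Tendsto (fun e : ℕ => ((G e).muSyzygy i : ℝ) / (p : ℝ) ^ (e * γ)) atTop (𝓝 c)

/-- The global Frobenius Euler characteristic
`χ_i^F(M, γ) = lim_e (μ_R(Ω_i(e)) + ∑_{j=1}^{i} (-1)^j b_{i-j}(e)) / p^{eγ}`
exists, does not depend on the chosen free resolutions of the modules `F^e_* M`, and equals `c`. -/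
def HasGlobalChi (γ i : ℕ) (c : ℝ) : Prop :=
  (∀ e, Nonempty (FreeResolution R (FrobeniusPushforward p e M))) ∧
  ∀ G : ∀ e, FreeResolution R (FrobeniusPushforward p e M),
    Tendsto (fun e : ℕ => ((G e).euler i : ℝ) / (p : ℝ) ^ (e * γ)) atTop (𝓝 c)

/-- The global Hilbert–Kunz multiplicity `lim_e μ_R(F^e_* M) / p^{e γ(R)}` exists and equals `c`. -/
def HasGlobalHilbertKunz (c : ℝ) : Prop :=
  Tendsto (fun e : ℕ => (mu R (FrobeniusPushforward p e M) : ℝ) / (p : ℝ) ^ (e * gammaRing p R))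
    atTop (𝓝 c)

end Global

section Local

variable (p : ℕ) (A : Type u) [CommRing A] [IsLocalRing A] [ExpChar A p]
  (N : Type u) [AddCommGroup N] [Module A N]

/-- `λ_A(Tor_i^A(k, F^e_* N))`, where `k` is the residue field of the local ring `A`. -/
def localBetti (i e : ℕ) : ℕ :=
  (Module.length A (((CategoryTheory.Tor (ModuleCat.{u} A) i).obj
    (ModuleCat.of A (ResidueField A))).obj
      (ModuleCat.of A (FrobeniusPushforward p e N)))).toNat

/-- The alternating sum `∑_{j=0}^{i} (-1)^{i-j} λ_A(Tor_j^A(k, F^e_* N))`. -/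
def localChi (i e : ℕ) : ℤ :=
  ∑ j ∈ Finset.range (i + 1), (-1) ^ (i - j) * (localBetti p A N j e : ℤ)

/-- The Frobenius Betti number `β_i^F(N, γ)` over the local ring `A` exists and equals `c`. -/
def HasLocalBetti (γ i : ℕ) (c : ℝ) : Prop :=
  Tendsto (fun e : ℕ => (localBetti p A N i e : ℝ) / (p : ℝ) ^ (e * γ)) atTop (𝓝 c)

/-- The Frobenius Euler characteristic `χ_i^F(N, γ)` over the local ring `A` exists and
equals `c`. -/
def HasLocalChi (γ i : ℕ) (c : ℝ) : Prop :=
  Tendsto (fun e : ℕ => (localChi p A N i e : ℝ) / (p : ℝ) ^ (e * γ)) atTop (𝓝 c)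

/-- The Hilbert–Kunz multiplicity `lim_e λ_A(N / 𝔪^{[p^e]} N) / p^{e dim A}` of `N` over the local
ring `(A, 𝔪)` exists and equals `c`; here `𝔪^{[p^e]}` is the ideal generated by the `p^e`-th powers
of the elements of `𝔪`. -/
def HasLocalHilbertKunz (c : ℝ) : Prop :=
  Tendsto (fun e : ℕ =>
    ((Module.length A (N ⧸ (((maximalIdeal A).map (iterateFrobenius A p e)) •
      (⊤ : Submodule A N)))).toNat : ℝ) /
        (p : ℝ) ^ (e * ((ringKrullDim A).unbotD 0).toNat)) atTop (𝓝 c)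

end Local

section Graded

variable {R : Type u} [CommRing R]

instance charP_localization_atPrime (p : ℕ) [Fact p.Prime] [CharP R p] (P : Ideal R) [P.IsPrime] :
    CharP (Localization.AtPrime P) p :=
  (CharP.charP_iff_prime_eq_zero Fact.out).2 <| by
    rw [← map_natCast (algebraMap R (Localization.AtPrime P)), CharP.cast_eq_zero, map_zero]

variable (𝒜 : ℕ → AddSubgroup R) [GradedRing 𝒜]

instance charP_gradeZero (p : ℕ) [CharP R p] : CharP (𝒜 0) p where
  cast_eq_zero_iff n := by
    rw [← CharP.cast_eq_zero_iff R p n, ← map_natCast (algebraMap (𝒜 0) R)]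
    exact (map_eq_zero_iff _ Subtype.val_injective).symm

/-- The ideal `𝔪 = 𝔪₀ R + R_{>0}`, where `𝔪₀` is the maximal ideal of the local ring `R₀ = 𝒜 0` and
`R_{>0}` is the ideal generated by the homogeneous elements of positive degree. -/
def irrelevantMaximal [IsLocalRing (𝒜 0)] : Ideal R :=
  (maximalIdeal (𝒜 0)).map (algebraMap (𝒜 0) R) ⊔ Ideal.span {x | ∃ n, 0 < n ∧ x ∈ 𝒜 n}

theorem irrelevantMaximal_eq_comap [IsLocalRing (𝒜 0)] :
    irrelevantMaximal 𝒜 = (maximalIdeal (𝒜 0)).comap (GradedRing.projZeroRingHom' 𝒜) := by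
  apply le_antisymm
  · refine sup_le (Ideal.map_le_iff_le_comap.2 fun a ha => ?_) (Ideal.span_le.2 ?_)
    · have : GradedRing.projZeroRingHom' 𝒜 (algebraMap (𝒜 0) R a) = a :=
        GradedRing.projZeroRingHom'_apply_coe 𝒜 a
      simpa [Ideal.mem_comap, this] using ha
    · rintro x ⟨n, hn, hx⟩
      have : GradedRing.projZeroRingHom' 𝒜 x = 0 := by
        apply Subtype.ext
        simpa [GradedRing.projZeroRingHom_apply] using
          DirectSum.decompose_of_mem_ne 𝒜 hx hn.ne'
      simp [this]
  · intro x hx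
    classical
    rw [← DirectSum.sum_support_decompose 𝒜 x]
    refine Ideal.sum_mem _ fun n _ => ?_
    rcases Nat.eq_zero_or_pos n with rfl | hn
    · exact Ideal.mem_sup_left (Ideal.mem_map_of_mem (algebraMap (𝒜 0) R) hx)
    · exact Ideal.mem_sup_right (Ideal.subset_span ⟨n, hn, SetLike.coe_mem _⟩)

instance irrelevantMaximal_isPrime [IsLocalRing (𝒜 0)] : (irrelevantMaximal 𝒜).IsPrime := by
  rw [irrelevantMaximal_eq_comap]
  exact Ideal.comap_isPrime _ _

end Graded

end

end GradedFrobenius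

/-! For a field κ over R, let χ_i(κ, N) be the alternating sum of dim Tor_j(κ, N) over j ≤ i,
obtained from syzygies (`chi`). For every resolution by finite free modules, χ_i(κ, N) equals dim κ
⊗ Ω_i plus the alternating sum of the ranks (`FreeResolution.chi_eq`). The global Euler
characteristic therefore differs from χ_i(κ, N) only by μ(Ω_i) − dim κ ⊗ Ω_i. It suffices to show
that χ_i(κ, F^e_* M) / p^{eγ} converges, and that for κ = κ(𝔪) and N = F^e_* M the difference is
bounded independently of e and of the resolution.

Convergence. Kunz's formula says that α drops by exactly one along each covering of primes
(`alpha_of_covBy`). Hence F_*(R/P) contains a free R/P-module of rank p^{α(P)} whose cokernel lives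
on primes with smaller α (`exists_generic_free_pushforward`). Since χ_i is controlled along short
exact sequences, modules with α < g on their support have χ_i(F^e_* N) = O(p^{(g-1)e})
(`abs_frobChi_le`), and χ_i(F^{e+1}_* R/P) = p^{α(P)} χ_i(F^e_* R/P) up to such an error. The
normalized sequence is then Cauchy. A general module is reduced to this case by applying a power of
F_*, which makes nilpotents act as zero, and by splitting along the minimal primes of its
annihilator (`frobChiConverges`).

Boundedness. By the Forster–Swan theorem, μ(Ω) is at most the maximum over all primes P of dim κ(P)
⊗ Ω + h(P), for any strictly decreasing h; here h = α serves, or h = 0 in dimension zero. The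
grading controls the fibres: F^e_* M is graded over R with the degrees of R multiplied by p^e, so it
has a free resolution with homogeneous maps that is minimal at 𝔪. Comparing fibres along it gives
χ_i(κ(P), F^e_* M) ≤ χ_i(κ(𝔪), F^e_* M) for every P (`IsGrading.chi_le`).

Localization at 𝔪 does not change χ_i(κ(𝔪), –), and Betti numbers are sums of two consecutive Euler
characteristics both globally and locally. For Hilbert–Kunz multiplicities one adds the identity dim
k ⊗ F^e_* N = [k : k^p]^e λ(N/𝔪^{[p^e]} N) over the local ring and the equality γ(R) = α(𝔪) + dim
R_𝔪 (`gammaRing_eq`). -/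

namespace GradedFrobenius

open TensorProduct

/-! ### Fibre dimensions. -/

section FiberRank

variable (R : Type u) [CommRing R] (κ : Type u) [Field κ] [Algebra R κ]

/-- The dimension of the fibre `κ ⊗ N` of a module at an `R`-field `κ`. -/
noncomputable def fiberRank (N : Type u) [AddCommGroup N] [Module R N] : ℕ :=
  Module.finrank κ (κ ⊗[R] N)

variable {R} {N N' N'' : Type u} [AddCommGroup N] [Module R N] [AddCommGroup N'] [Module R N']
  [AddCommGroup N''] [Module R N'']

theorem fiberRank_congr (e : N ≃ₗ[R] N') : fiberRank R κ N = fiberRank R κ N' :=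
  (e.baseChange R κ N N').finrank_eq

theorem fiberRank_prod [Module.Finite R N] [Module.Finite R N'] :
    fiberRank R κ (N × N') = fiberRank R κ N + fiberRank R κ N' := by
  rw [fiberRank, (TensorProduct.prodRight R κ κ N N').finrank_eq, Module.finrank_prod]
  rfl

theorem fiberRank_free (F : Type u) [AddCommGroup F] [Module R F] [Module.Free R F] :
    fiberRank R κ F = Module.finrank R F := by
  have := (algebraMap R κ).domain_nontrivial
  exact Module.finrank_baseChange

theorem fiberRank_le_of_surjective [Module.Finite R N] (g : N →ₗ[R] N')
    (hg : Function.Surjective g) : fiberRank R κ N' ≤ fiberRank R κ N := by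
  refine LinearMap.finrank_le_finrank_of_surjective (f := g.baseChange κ) ?_
  exact LinearMap.lTensor_surjective κ hg

theorem fiberRank_le_add_of_exact [Module.Finite R N'] [Module.Finite R N] [Module.Finite R N'']
    (f : N' →ₗ[R] N) (g : N →ₗ[R] N'') (hg : Function.Surjective g) (h : Function.Exact f g) :
    fiberRank R κ N ≤ fiberRank R κ N' + fiberRank R κ N'' := by
  have hex : Function.Exact (f.baseChange κ) (g.baseChange κ) := lTensor_exact κ h hg
  have h1 := (g.baseChange κ).finrank_range_add_finrank_ker
  rw [hex.linearMap_ker_eq] at h1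
  have h2 := (f.baseChange κ).finrank_range_le
  have h3 := (g.baseChange κ).range.finrank_le
  unfold fiberRank
  omega

end FiberRank

/-! ### Truncated Euler characteristics via syzygies. -/

section Chi

variable (R : Type u) [CommRing R] (κ : Type u) [Field κ] [Algebra R κ]

open Classical in
/-- The alternating sum `∑_{j ≤ i} (-1)^{i-j} dim Tor_j(κ, N)`, defined through syzygies. -/
noncomputable def chi : ℕ → ∀ (N : Type u) [AddCommGroup N] [Module R N], ℤ
  | 0, N, _, _ => fiberRank R κ N
  | i + 1, N, _, _ =>
    if _h : Module.Finite R N then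
      chi i (LinearMap.ker (Module.Finite.exists_fin' R N).choose_spec.choose) +
        (-1) ^ (i + 1) * ((Module.Finite.exists_fin' R N).choose : ℤ)
    else 0

variable {R}

/-- The product of two submodules is the direct product of the modules. -/
def prodSubmoduleEquiv {N N' : Type*} [AddCommGroup N] [Module R N] [AddCommGroup N']
    [Module R N'] (A : Submodule R N) (B : Submodule R N') : A.prod B ≃ₗ[R] A × B where
  toFun x := (⟨x.1.1, x.2.1⟩, ⟨x.1.2, x.2.2⟩)
  map_add' _ _ := rfl
  map_smul' _ _ := rfl
  invFun x := ⟨(x.1.1, x.2.1), x.1.2, x.2.2⟩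

/-- The rotation `0 → Ω'' → N' ⊕ F'' → N → 0` of a short exact sequence. -/
theorem exists_rotation {N N' N'' : Type u} [AddCommGroup N] [Module R N] [AddCommGroup N']
    [Module R N'] [AddCommGroup N''] [Module R N''] [Module.Finite R N'']
    (f : N' →ₗ[R] N) (g : N →ₗ[R] N'') (hf : Function.Injective f)
    (hg : Function.Surjective g) (h : Function.Exact f g) :
    ∃ (n : ℕ) (c : (Fin n → R) →ₗ[R] N'') (a : LinearMap.ker c →ₗ[R] N' × (Fin n → R))
      (b : N' × (Fin n → R) →ₗ[R] N),
      Function.Surjective c ∧ Function.Injective a ∧ Function.Surjective b ∧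
        Function.Exact a b := by
  obtain ⟨n, c, hc⟩ := Module.Finite.exists_fin' R N''
  obtain ⟨t, ht⟩ := Module.projective_lifting_property g c hg
  have ht' : ∀ x, g (t x) = c x := fun x => LinearMap.congr_fun ht x
  have hgf : ∀ x, g (f x) = 0 := h.apply_apply_eq_zero
  let e := LinearEquiv.ofInjective f hf
  have hmem : ∀ y : LinearMap.ker c, t y ∈ LinearMap.range f := fun y =>
    (h _).1 (by rw [ht']; exact y.2)
  let s : LinearMap.ker c →ₗ[R] N' :=
    e.symm.toLinearMap ∘ₗ LinearMap.codRestrict (LinearMap.range f)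
      (t ∘ₗ (LinearMap.ker c).subtype) hmem
  have hs : ∀ y, f (s y) = t y := fun y =>
    congrArg Subtype.val (e.apply_symm_apply ⟨t y, hmem y⟩)
  -- The lift t of the cover c carries ker c into the image of f; s is the resulting map to N'. The
  -- sign makes the composite f(−s y) + t y vanish.
  refine ⟨n, c, LinearMap.prod (-s) (LinearMap.ker c).subtype, f.coprod t, hc, ?_, ?_, ?_⟩
  · intro x y hxy
    exact Subtype.ext (congrArg Prod.snd hxy)
  · intro x
    obtain ⟨y, hy⟩ := hc (g x)
    obtain ⟨z, hz⟩ := (h (x - t y)).1 (by rw [map_sub, ht', hy, sub_self])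
    exact ⟨(z, y), by simp [hz]⟩
  · rintro ⟨x, y⟩
    constructor
    · intro hxy
      have hxy' : f x + t y = 0 := by simpa using hxy
      have hy : c y = 0 := by simpa [hgf, ht'] using congrArg g hxy'
      refine ⟨⟨y, hy⟩, Prod.ext (hf ?_) rfl⟩
      have := hs ⟨y, hy⟩
      change f (-s ⟨y, hy⟩) = f x
      rw [map_neg, this, eq_neg_of_add_eq_zero_left hxy']
    · rintro ⟨z, hz⟩
      rw [← hz]
      simp [hs]

/-- Schanuel's lemma. -/
theorem schanuel {N F F' : Type*} [AddCommGroup N] [Module R N] [AddCommGroup F] [Module R F]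
    [AddCommGroup F'] [Module R F'] [Module.Projective R F] [Module.Projective R F']
    (f : F →ₗ[R] N) (f' : F' →ₗ[R] N) (hf : Function.Surjective f)
    (hf' : Function.Surjective f') :
    Nonempty ((LinearMap.ker f × F') ≃ₗ[R] (LinearMap.ker f' × F)) := by
  obtain ⟨s, hs⟩ := Module.projective_lifting_property f f' hf
  obtain ⟨t, ht⟩ := Module.projective_lifting_property f' f hf'
  have hs' : ∀ x, f (s x) = f' x := fun x => LinearMap.congr_fun hs x
  have ht' : ∀ x, f' (t x) = f x := fun x => LinearMap.congr_fun ht x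
  -- both sides are identified with the fibre product of `F` and `F'` over `N`
  refine ⟨LinearEquiv.ofLinearMap
    (LinearMap.prod (LinearMap.codRestrict _
      (LinearMap.snd R _ _ - t ∘ₗ ((LinearMap.ker f).subtype.coprod s)) ?_)
      ((LinearMap.ker f).subtype.coprod s))
    (LinearMap.prod (LinearMap.codRestrict _
      (LinearMap.snd R _ _ - s ∘ₗ ((LinearMap.ker f').subtype.coprod t)) ?_)
      ((LinearMap.ker f').subtype.coprod t)) ?_ ?_⟩
  · rintro ⟨⟨x, hx⟩, y⟩
    rw [LinearMap.mem_ker] at hx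
    simp [hs', ht', hx]
  · rintro ⟨⟨x, hx⟩, y⟩
    rw [LinearMap.mem_ker] at hx
    simp [hs', ht', hx]
  · ext x <;> simp
  · ext x <;> simp

theorem chi_zero (N : Type u) [AddCommGroup N] [Module R N] :
    chi R κ 0 N = fiberRank R κ N := rfl

variable [IsNoetherianRing R]

/-- The four statements have to be proved together. Independence of the free cover at level i + 1
follows from Schanuel's lemma once isomorphism invariance, additivity and the value on free modules
are known at level i. These three pass to level i + 1 by choosing convenient covers. -/
theorem chi_properties (i : ℕ) :
    (∀ (N N' : Type u) [AddCommGroup N] [Module R N] [AddCommGroup N'] [Module R N']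
      [Module.Finite R N], (N ≃ₗ[R] N') → chi R κ i N = chi R κ i N') ∧
    (∀ (N N' : Type u) [AddCommGroup N] [Module R N] [AddCommGroup N'] [Module R N']
      [Module.Finite R N] [Module.Finite R N'],
      chi R κ i (N × N') = chi R κ i N + chi R κ i N') ∧
    (∀ (F : Type u) [AddCommGroup F] [Module R F] [Module.Finite R F] [Module.Free R F],
      chi R κ i F = (-1) ^ i * (Module.finrank R F : ℤ)) ∧
    (∀ (N F : Type u) [AddCommGroup N] [Module R N] [AddCommGroup F] [Module R F]
      [Module.Finite R F] [Module.Free R F] (f : F →ₗ[R] N), Function.Surjective f →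
      chi R κ (i + 1) N = chi R κ i (LinearMap.ker f) + (-1) ^ (i + 1) * (Module.finrank R F : ℤ))
    := by
  have : Nontrivial R := (algebraMap R κ).domain_nontrivial
  -- independence of the cover follows from the first three properties
  have key : ∀ i : ℕ,
    (∀ (N N' : Type u) [AddCommGroup N] [Module R N] [AddCommGroup N'] [Module R N']
      [Module.Finite R N], (N ≃ₗ[R] N') → chi R κ i N = chi R κ i N') →
    (∀ (N N' : Type u) [AddCommGroup N] [Module R N] [AddCommGroup N'] [Module R N']
      [Module.Finite R N] [Module.Finite R N'],
      chi R κ i (N × N') = chi R κ i N + chi R κ i N') →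
    (∀ (F : Type u) [AddCommGroup F] [Module R F] [Module.Finite R F] [Module.Free R F],
      chi R κ i F = (-1) ^ i * (Module.finrank R F : ℤ)) →
    (∀ (N F : Type u) [AddCommGroup N] [Module R N] [AddCommGroup F] [Module R F]
      [Module.Finite R F] [Module.Free R F] (f : F →ₗ[R] N), Function.Surjective f →
      chi R κ (i + 1) N =
        chi R κ i (LinearMap.ker f) + (-1) ^ (i + 1) * (Module.finrank R F : ℤ)) := by
    intro i h1 h2 h3 N F _ _ _ _ _ _ f hf
    have hN : Module.Finite R N := Module.Finite.of_surjective f hf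
    rw [chi, dif_pos hN]
    have hg := (Module.Finite.exists_fin' R N).choose_spec.choose_spec
    generalize (Module.Finite.exists_fin' R N).choose_spec.choose = g at hg ⊢
    generalize (Module.Finite.exists_fin' R N).choose = n at g hg ⊢
    obtain ⟨e⟩ := schanuel g f hg hf
    have := h1 _ _ e
    rw [h2, h2, h3 F, h3 (Fin n → R), Module.finrank_fin_fun] at this
    rw [pow_succ]
    linarith
  induction i with
  | zero =>
    have h1 : (∀ (N N' : Type u) [AddCommGroup N] [Module R N] [AddCommGroup N'] [Module R N']
      [Module.Finite R N], (N ≃ₗ[R] N') → chi R κ 0 N = chi R κ 0 N') := by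
      intro N N' _ _ _ _ _ e
      rw [chi, chi, fiberRank_congr κ e]
    have h2 : (∀ (N N' : Type u) [AddCommGroup N] [Module R N] [AddCommGroup N'] [Module R N']
      [Module.Finite R N] [Module.Finite R N'],
      chi R κ 0 (N × N') = chi R κ 0 N + chi R κ 0 N') := by
      intro N N' _ _ _ _ _ _
      simp only [chi, fiberRank_prod, Nat.cast_add]
    have h3 : (∀ (F : Type u) [AddCommGroup F] [Module R F] [Module.Finite R F] [Module.Free R F],
      chi R κ 0 F = (-1) ^ 0 * (Module.finrank R F : ℤ)) := by
      intro F _ _ _ _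
      simp only [chi, fiberRank_free, pow_zero, one_mul]
    exact ⟨h1, h2, h3, key 0 h1 h2 h3⟩
  | succ i ih =>
    obtain ⟨h1, h2, h3, h4⟩ := ih
    have h1' : (∀ (N N' : Type u) [AddCommGroup N] [Module R N] [AddCommGroup N'] [Module R N']
      [Module.Finite R N], (N ≃ₗ[R] N') → chi R κ (i + 1) N = chi R κ (i + 1) N') := by
      intro N N' _ _ _ _ _ e
      obtain ⟨n, f, hf⟩ := Module.Finite.exists_fin' R N
      rw [h4 N _ f hf, h4 N' _ (e.toLinearMap ∘ₗ f) (e.surjective.comp hf), LinearEquiv.ker_comp]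
    have h2' : (∀ (N N' : Type u) [AddCommGroup N] [Module R N] [AddCommGroup N'] [Module R N']
      [Module.Finite R N] [Module.Finite R N'],
      chi R κ (i + 1) (N × N') = chi R κ (i + 1) N + chi R κ (i + 1) N') := by
      intro N N' _ _ _ _ _ _
      obtain ⟨n, f, hf⟩ := Module.Finite.exists_fin' R N
      obtain ⟨n', f', hf'⟩ := Module.Finite.exists_fin' R N'
      rw [h4 N _ f hf, h4 N' _ f' hf', h4 (N × N') _ (f.prodMap f') (hf.prodMap hf'),
        Module.finrank_prod, LinearMap.ker_prodMap,
        h1 _ _ (prodSubmoduleEquiv (LinearMap.ker f) (LinearMap.ker f')), h2]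
      push_cast
      ring
    have h3' : (∀ (F : Type u) [AddCommGroup F] [Module R F] [Module.Finite R F]
      [Module.Free R F], chi R κ (i + 1) F = (-1) ^ (i + 1) * (Module.finrank R F : ℤ)) := by
      intro F _ _ _ _
      have : Subsingleton (LinearMap.ker (LinearMap.id : F →ₗ[R] F)) := by
        rw [LinearMap.ker_id]; infer_instance
      rw [h4 F F LinearMap.id Function.surjective_id, h3, Module.finrank_zero_of_subsingleton]
      simp
    exact ⟨h1', h2', h3', key _ h1' h2' h3'⟩

variable {N N' N'' F : Type u} [AddCommGroup N] [Module R N] [AddCommGroup N'] [Module R N']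
  [AddCommGroup N''] [Module R N''] [AddCommGroup F] [Module R F]

theorem chi_congr [Module.Finite R N] (i : ℕ) (e : N ≃ₗ[R] N') : chi R κ i N = chi R κ i N' :=
  (chi_properties κ i).1 N N' e

theorem chi_prod [Module.Finite R N] [Module.Finite R N'] (i : ℕ) :
    chi R κ i (N × N') = chi R κ i N + chi R κ i N' :=
  (chi_properties κ i).2.1 N N'

theorem chi_free [Module.Finite R F] [Module.Free R F] (i : ℕ) :
    chi R κ i F = (-1) ^ i * (Module.finrank R F : ℤ) :=
  (chi_properties κ i).2.2.1 F

theorem chi_succ [Module.Finite R F] [Module.Free R F] (i : ℕ) (f : F →ₗ[R] N)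
    (hf : Function.Surjective f) :
    chi R κ (i + 1) N =
      chi R κ i (LinearMap.ker f) + (-1) ^ (i + 1) * (Module.finrank R F : ℤ) :=
  (chi_properties κ i).2.2.2 N F f hf

theorem chi_of_subsingleton [Subsingleton N] (i : ℕ) : chi R κ i N = 0 := by
  have : Nontrivial R := (algebraMap R κ).domain_nontrivial
  rw [chi_free, Module.finrank_zero_of_subsingleton]
  simp

theorem chi_pi_const [Module.Finite R N] (i n : ℕ) :
    chi R κ i (Fin n → N) = n * chi R κ i N := by
  induction n with
  | zero => simp [chi_of_subsingleton]
  | succ n ih =>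
    rw [chi_congr κ i (Fin.consLinearEquiv R (fun _ : Fin (n + 1) => N)).symm, chi_prod, ih]
    push_cast
    ring

/-- Cutting the long exact Tor sequence at degree i leaves one nonnegative defect. The induction
uses the horseshoe lemma: covers of the outer terms give a cover of the middle one, the kernels
again form a short exact sequence, and the ranks add up. -/
theorem chi_le_add_of_exact [Module.Finite R N'] [Module.Finite R N] [Module.Finite R N'']
    (i : ℕ) (f : N' →ₗ[R] N) (g : N →ₗ[R] N'') (hf : Function.Injective f)
    (hg : Function.Surjective g) (h : Function.Exact f g) :
    chi R κ i N ≤ chi R κ i N' + chi R κ i N'' := by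
  have : Nontrivial R := (algebraMap R κ).domain_nontrivial
  induction i generalizing N N' N'' with
  | zero =>
    simp only [chi_zero]
    exact_mod_cast fiberRank_le_add_of_exact κ f g hg h
  | succ i ih =>
    obtain ⟨n', c', hc'⟩ := Module.Finite.exists_fin' R N'
    obtain ⟨n'', c'', hc''⟩ := Module.Finite.exists_fin' R N''
    obtain ⟨t, ht⟩ := Module.projective_lifting_property g c'' hg
    have ht' : ∀ x, g (t x) = c'' x := fun x => LinearMap.congr_fun ht x
    have hgf : ∀ x, g (f x) = 0 := h.apply_apply_eq_zero
    have hc : Function.Surjective ((f ∘ₗ c').coprod t) := by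
      intro x
      obtain ⟨y, hy⟩ := hc'' (g x)
      obtain ⟨z, hz⟩ := (h (x - t y)).1 (by rw [map_sub, ht', hy, sub_self])
      obtain ⟨w, rfl⟩ := hc' z
      exact ⟨(w, y), by simp [hz]⟩
    rw [chi_succ κ i c' hc', chi_succ κ i c'' hc'', chi_succ κ i _ hc, Module.finrank_prod]
    have := ih (N' := LinearMap.ker c') (N := LinearMap.ker ((f ∘ₗ c').coprod t))
      (N'' := LinearMap.ker c'')
      ((LinearMap.inl R _ _).restrict (fun x hx => by
        rw [LinearMap.mem_ker] at hx ⊢; simp [hx]))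
      ((LinearMap.snd R _ _).restrict (fun x hx => by
        rw [LinearMap.mem_ker] at hx ⊢
        have := congrArg g hx
        simpa [hgf, ht'] using this))
      (by
        intro x y hxy
        have := congrArg (fun z => z.1.1) hxy
        exact Subtype.ext (by simpa using this))
      (by
        rintro ⟨y, hy⟩
        rw [LinearMap.mem_ker] at hy
        obtain ⟨z, hz⟩ := (h (t y)).1 (by rw [ht', hy])
        obtain ⟨w, rfl⟩ := hc' z
        exact ⟨⟨(-w, y), by simp [hz]⟩, by ext; simp⟩)
      (by
        rintro ⟨⟨x, y⟩, hxy⟩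
        rw [LinearMap.mem_ker] at hxy
        constructor
        · intro h0
          have hy : y = 0 := congrArg Subtype.val h0
          subst hy
          have : f (c' x) = f 0 := by simpa using hxy
          exact ⟨⟨x, hf this⟩, by ext <;> simp⟩
        · rintro ⟨z, hz⟩
          have := congrArg (fun z => z.1.2) hz
          apply Subtype.ext
          simpa using this.symm)
    push_cast
    linarith

/-- This is subadditivity for the rotated sequence 0 → Ω'' → N' ⊕ F'' → N → 0. The rank of F''
cancels against the shift from χ_i(Ω'') to χ_{i+1}(N''). A second rotation gives
`chi_right_le_of_exact`. -/
theorem chi_left_le_of_exact [Module.Finite R N'] [Module.Finite R N] [Module.Finite R N'']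
    (i : ℕ) (f : N' →ₗ[R] N) (g : N →ₗ[R] N'') (hf : Function.Injective f)
    (hg : Function.Surjective g) (h : Function.Exact f g) :
    chi R κ i N' ≤ chi R κ i N + chi R κ (i + 1) N'' := by
  obtain ⟨n, c, a, b, hc, ha, hb, hab⟩ := exists_rotation f g hf hg h
  have := chi_le_add_of_exact κ i a b ha hb hab
  rw [chi_prod, chi_free κ (F := Fin n → R)] at this
  rw [chi_succ κ i c hc, pow_succ]
  linarith

theorem chi_right_le_of_exact [Module.Finite R N'] [Module.Finite R N] [Module.Finite R N'']
    (i : ℕ) (f : N' →ₗ[R] N) (g : N →ₗ[R] N'') (hf : Function.Injective f)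
    (hg : Function.Surjective g) (h : Function.Exact f g) :
    chi R κ (i + 1) N'' ≤ chi R κ (i + 1) N + chi R κ i N' := by
  obtain ⟨n, c, a, b, hc, ha, hb, hab⟩ := exists_rotation f g hf hg h
  have := chi_left_le_of_exact κ i a b ha hb hab
  rw [chi_prod, chi_free κ (F := Fin n → R)] at this
  rw [chi_succ κ i c hc, pow_succ]
  linarith

/-- The sum is the dimension of Tor_{i+1}(κ, N). Its nonnegativity turns upper bounds for χ_i into
lower bounds for χ_{i+1}. -/
theorem chi_succ_add_chi_nonneg [Module.Finite R N] (i : ℕ) :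
    0 ≤ chi R κ (i + 1) N + chi R κ i N := by
  obtain ⟨n, c, hc⟩ := Module.Finite.exists_fin' R N
  have := chi_le_add_of_exact κ i (LinearMap.ker c).subtype c (Submodule.subtype_injective _) hc
    (LinearMap.exact_subtype_ker_map c)
  rw [chi_free] at this
  rw [chi_succ κ i c hc, pow_succ]
  linarith

end Chi

end GradedFrobenius

namespace GradedFrobenius

open TensorProduct

/-! ### Minimal numbers of generators. -/

section Mu

variable {R : Type u} [CommRing R] {N : Type v} [AddCommGroup N] [Module R N]

theorem mu_le_of_span {n : ℕ} (x : Fin n → N) (hx : Submodule.span R (Set.range x) = ⊤) :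
    mu R N ≤ n := by
  rw [mu, ← hx]
  refine (Submodule.spanFinrank_span_le_ncard_of_finite (Set.finite_range x)).trans ?_
  rw [← Set.image_univ]
  exact (Set.ncard_image_le Set.finite_univ).trans (by simp)

theorem mu_le_of_surjective {n : ℕ} (f : (Fin n → R) →ₗ[R] N) (hf : Function.Surjective f) :
    mu R N ≤ n := by
  refine mu_le_of_span (fun i => f (Pi.single i 1)) ?_
  have h := congrArg (Submodule.map f) (Pi.basisFun R (Fin n)).span_eq
  rw [Submodule.map_span, ← Set.range_comp, Submodule.map_top, LinearMap.range_eq_top.2 hf] at h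
  rw [← h]
  congr 2
  ext i
  simp

variable (R N) in
theorem exists_surjective_of_mu [Module.Finite R N] :
    ∃ f : (Fin (mu R N) → R) →ₗ[R] N, Function.Surjective f := by
  obtain ⟨s, hs, hs'⟩ := Submodule.FG.exists_span_finset_card_eq_spanFinrank
    (Module.Finite.fg_top (R := R) (M := N))
  let e : Fin (mu R N) ≃ s := (finCongr (by exact hs.symm)).trans s.equivFin.symm
  refine ⟨Fintype.linearCombination R (fun i => (e i : N)), ?_⟩
  rw [← LinearMap.range_eq_top, Fintype.range_linearCombination, ← hs']
  congr 1
  ext x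
  constructor
  · rintro ⟨i, rfl⟩
    exact (e i).2
  · intro hx
    exact ⟨e.symm ⟨x, hx⟩, by simp⟩

theorem mu_congr {N' : Type*} [AddCommGroup N'] [Module R N'] [Module.Finite R N]
    (e : N ≃ₗ[R] N') : mu R N = mu R N' := by
  have : Module.Finite R N' := Module.Finite.equiv e
  apply le_antisymm
  · obtain ⟨f, hf⟩ := exists_surjective_of_mu R N'
    exact mu_le_of_surjective (e.symm.toLinearMap ∘ₗ f) (e.symm.surjective.comp hf)
  · obtain ⟨f, hf⟩ := exists_surjective_of_mu R N
    exact mu_le_of_surjective (e.toLinearMap ∘ₗ f) (e.surjective.comp hf)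

theorem fiberRank_le_mu (κ : Type u) [Field κ] [Algebra R κ] (N : Type u) [AddCommGroup N]
    [Module R N] [Module.Finite R N] : fiberRank R κ N ≤ mu R N := by
  have : Nontrivial R := (algebraMap R κ).domain_nontrivial
  obtain ⟨f, hf⟩ := exists_surjective_of_mu R N
  simpa [fiberRank_free] using fiberRank_le_of_surjective κ f hf

end Mu

/-! ### Minimal resolutions, and Euler characteristics read off from a resolution. -/

namespace FreeResolution

variable {R : Type u} [CommRing R]

section Existence

variable [IsNoetherianRing R]

/-- The ranks and kernels of an iterated minimal presentation. -/
noncomputable def syzygySeq {n : ℕ} (K : Submodule R (Fin n → R)) :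
    ℕ → Σ n : ℕ, Submodule R (Fin n → R)
  | 0 => ⟨n, K⟩
  | i + 1 => ⟨mu R (syzygySeq K i).2,
      LinearMap.ker (exists_surjective_of_mu R (syzygySeq K i).2).choose⟩

theorem exists_isMinimal (N : Type v) [AddCommGroup N] [Module R N] [Module.Finite R N] :
    ∃ G : FreeResolution R N, G.IsMinimal := by
  obtain ⟨f, hf⟩ := exists_surjective_of_mu R N
  let s := syzygySeq (LinearMap.ker f)
  let c : ∀ i, (Fin (s (i + 1)).1 → R) →ₗ[R] (s i).2 := fun i =>
    (exists_surjective_of_mu R (s i).2).choose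
  have hc : ∀ i, Function.Surjective (c i) := fun i =>
    (exists_surjective_of_mu R (s i).2).choose_spec
  have hk : ∀ i, (s (i + 1)).2 = LinearMap.ker (c i) := fun i => rfl
  have hr : ∀ i, LinearMap.range ((s i).2.subtype ∘ₗ c i) = (s i).2 := fun i => by
    rw [LinearMap.range_comp, LinearMap.range_eq_top.2 (hc i), Submodule.map_top,
      Submodule.range_subtype]
  let G : FreeResolution R N :=
    { b := fun i => (s i).1
      aug := f
      d := fun i => (s i).2.subtype ∘ₗ c i
      aug_surjective := hf
      exact_zero := by
        refine LinearMap.exact_iff.2 ?_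
        rw [hr]
        rfl
      exact_succ := fun i => by
        rw [LinearMap.exact_iff, hr, hk, LinearMap.ker_comp, Submodule.ker_subtype]
        rfl }
  refine ⟨G, fun i => ?_⟩
  cases i with
  | zero =>
    change mu R (LinearMap.range f) = mu R N
    rw [LinearMap.range_eq_top.2 hf]
    exact mu_congr Submodule.topEquiv
  | succ i =>
    change mu R (LinearMap.range ((s i).2.subtype ∘ₗ c i)) = mu R (s i).2
    rw [hr]

end Existence

section Tail

variable {N : Type v} [AddCommGroup N] [Module R N]

/-- The resolution of the first syzygy module. -/
def tail (G : FreeResolution R N) : FreeResolution R (LinearMap.ker G.aug) where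
  b i := G.b (i + 1)
  aug := (G.d 0).codRestrict _ fun x => G.exact_zero.apply_apply_eq_zero x
  d i := G.d (i + 1)
  aug_surjective := by
    rintro ⟨x, hx⟩
    obtain ⟨y, hy⟩ := (G.exact_zero x).1 hx
    exact ⟨y, Subtype.ext hy⟩
  exact_zero := by
    intro x
    rw [← G.exact_succ 0 x]
    exact Subtype.ext_iff
  exact_succ i := G.exact_succ (i + 1)

end Tail

variable (κ : Type u) [Field κ] [Algebra R κ]

/-- `dim κ ⊗ Ω_i`, where `Ω_i = im φ_i`. -/
noncomputable def fiberSyzygy {N : Type u} [AddCommGroup N] [Module R N]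
    (G : FreeResolution R N) : ℕ → ℕ
  | 0 => fiberRank R κ (LinearMap.range G.aug)
  | i + 1 => fiberRank R κ (LinearMap.range (G.d i))

theorem fiberSyzygy_tail {N : Type u} [AddCommGroup N] [Module R N] (G : FreeResolution R N)
    (i : ℕ) : G.tail.fiberSyzygy κ i = G.fiberSyzygy κ (i + 1) := by
  cases i with
  | succ i => rfl
  | zero =>
    change fiberRank R κ (LinearMap.range G.tail.aug) = fiberRank R κ (LinearMap.range (G.d 0))
    rw [LinearMap.range_eq_top.2 G.tail.aug_surjective, fiberRank_congr κ Submodule.topEquiv]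
    exact fiberRank_congr κ (LinearEquiv.ofEq _ _ G.exact_zero.linearMap_ker_eq)

/-- Iterate `chi_succ` along the resolution, whose tail resolves the first syzygy. Since the
correction by ranks does not involve κ, comparing χ_i at two fields amounts to comparing the fibres
of the same Ω_i. -/
theorem chi_eq [IsNoetherianRing R] {N : Type u} [AddCommGroup N] [Module R N]
    (G : FreeResolution R N) (i : ℕ) :
    chi R κ i N = G.fiberSyzygy κ i + ∑ j ∈ Finset.Icc 1 i, (-1) ^ j * (G.b (i - j) : ℤ) := by
  have : Nontrivial R := (algebraMap R κ).domain_nontrivial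
  induction i generalizing N with
  | zero =>
    simp only [chi_zero, fiberSyzygy, zero_lt_one, Finset.Icc_eq_empty_of_lt, Finset.sum_empty,
      add_zero, Nat.cast_inj]
    rw [LinearMap.range_eq_top.2 G.aug_surjective]
    exact fiberRank_congr κ Submodule.topEquiv.symm
  | succ i ih =>
    rw [chi_succ κ i G.aug G.aug_surjective, ih G.tail, fiberSyzygy_tail, add_assoc,
      Finset.sum_Icc_succ_top (by omega)]
    congr 2
    · refine Finset.sum_congr rfl fun j hj => ?_
      rw [Finset.mem_Icc] at hj
      rw [Nat.sub_add_comm hj.2]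
      rfl
    · simp

theorem sum_ranks_succ {N : Type u} [AddCommGroup N] [Module R N] (G : FreeResolution R N) (i : ℕ) :
    ∑ j ∈ Finset.Icc 1 (i + 1), (-1) ^ j * (G.b (i + 1 - j) : ℤ) =
      - G.b i - ∑ j ∈ Finset.Icc 1 i, (-1) ^ j * (G.b (i - j) : ℤ) := by
  rw [← Finset.add_sum_Ioc_eq_sum_Icc (by omega : 1 ≤ i + 1),
    ← Finset.Icc_add_one_left_eq_Ioc, sub_eq_add_neg, ← Finset.sum_neg_distrib]
  congr 1
  · simp
  · rw [← Finset.map_add_right_Icc, Finset.sum_map]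
    refine Finset.sum_congr rfl fun j _ => ?_
    simp [pow_succ]

theorem chi_succ_add_chi [IsNoetherianRing R] {N : Type u} [AddCommGroup N] [Module R N]
    (G : FreeResolution R N) (i : ℕ) :
    chi R κ (i + 1) N + chi R κ i N = G.fiberSyzygy κ (i + 1) + G.fiberSyzygy κ i - G.b i := by
  rw [G.chi_eq κ, G.chi_eq κ, G.sum_ranks_succ]
  ring

end FreeResolution

/-- Flat base change carries a free cover and its kernel to a free cover and its kernel, and the
fibre at κ is unchanged because A lies between R and κ. -/
theorem chi_baseChange {R : Type u} [CommRing R] [IsNoetherianRing R] (A : Type u) [CommRing A]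
    [IsNoetherianRing A] [Algebra R A] [Module.Flat R A] (κ : Type u) [Field κ] [Algebra R κ]
    [Algebra A κ] [IsScalarTower R A κ] (N : Type u) [AddCommGroup N] [Module R N]
    [Module.Finite R N] (i : ℕ) : chi A κ i (A ⊗[R] N) = chi R κ i N := by
  have : Nontrivial R := (algebraMap R κ).domain_nontrivial
  have : Nontrivial A := (algebraMap A κ).domain_nontrivial
  induction i generalizing N with
  | zero =>
    rw [chi_zero, chi_zero, fiberRank, fiberRank,
      (AlgebraTensorModule.cancelBaseChange R A κ κ N).finrank_eq]
  | succ i ih =>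
    obtain ⟨n, f, hf⟩ := Module.Finite.exists_fin' R N
    rw [chi_succ κ i f hf, chi_succ κ i (f.baseChange A) (LinearMap.lTensor_surjective A hf),
      ← ih, Module.finrank_baseChange]
    exact congrArg (· + _) (chi_congr κ i (LinearMap.tensorKerEquiv A A f)).symm

end GradedFrobenius

namespace GradedFrobenius

open TensorProduct

/-! ### Lengths of Tor over a local ring. -/

section TorLength

open CategoryTheory CategoryTheory.Limits

variable {A : Type u} [CommRing A]

/-- Rank–nullity for homology, in additive form because lengths lie in `ℕ∞`, where terms cannot be
cancelled before they are known to be finite. -/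
theorem length_homology_add (S : ShortComplex (ModuleCat.{u} A)) :
    Module.length A S.homology + Module.length A (LinearMap.range S.f.hom) +
      Module.length A (LinearMap.range S.g.hom) = Module.length A S.X₂ := by
  have h1 : Module.length A S.homology =
      Module.length A (LinearMap.ker S.g.hom ⧸ LinearMap.range S.moduleCatToCycles) :=
    (S.moduleCatHomologyIso.toLinearEquiv).length_eq
  have h2 := Module.length_eq_add_of_exact (R := A) (LinearMap.range S.moduleCatToCycles).subtype
    (LinearMap.range S.moduleCatToCycles).mkQ (Submodule.subtype_injective _)
    (Submodule.mkQ_surjective _) (LinearMap.exact_subtype_mkQ _)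
  have h3 : Module.length A (LinearMap.range S.moduleCatToCycles) =
      Module.length A (LinearMap.range S.f.hom) := by
    refine LinearEquiv.length_eq (LinearEquiv.ofBijective
      ((LinearMap.ker S.g.hom).subtype.restrict (p := LinearMap.range S.moduleCatToCycles)
        (q := LinearMap.range S.f.hom) ?_) ⟨?_, ?_⟩)
    · rintro _ ⟨x, rfl⟩
      exact ⟨x, rfl⟩
    · intro x y hxy
      have h : (x : LinearMap.ker S.g.hom).1 = (y : LinearMap.ker S.g.hom).1 :=
        congrArg (fun z : LinearMap.range S.f.hom => z.1) hxy
      exact Subtype.ext (Subtype.ext h)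
    · rintro ⟨_, x, rfl⟩
      exact ⟨⟨S.moduleCatToCycles x, x, rfl⟩, rfl⟩
  have h4 := Module.length_eq_add_of_exact (R := A) (LinearMap.ker S.g.hom).subtype
    S.g.hom.rangeRestrict (Submodule.subtype_injective _) S.g.hom.surjective_rangeRestrict
    (by
      rw [LinearMap.exact_iff, Submodule.range_subtype, LinearMap.ker_rangeRestrict])
  rw [h4, h2, h1, h3, add_comm (Module.length A (LinearMap.range S.f.hom))]

theorem length_range_add_of_exact {X Y Z : Type*} [AddCommGroup X] [Module A X] [AddCommGroup Y]
    [Module A Y] [AddCommGroup Z] [Module A Z] (f : X →ₗ[A] Y) (g : Y →ₗ[A] Z)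
    (hg : Function.Surjective g) (h : Function.Exact f g) :
    Module.length A (LinearMap.range f) + Module.length A Z = Module.length A Y :=
  (Module.length_eq_add_of_exact (LinearMap.range f).subtype g (Submodule.subtype_injective _) hg
    (by rw [LinearMap.exact_iff, Submodule.range_subtype, h.linearMap_ker_eq])).symm

variable {N : Type u} [AddCommGroup N] [Module A N] (G : FreeResolution A N)

/-- The chain complex of a free resolution. -/
noncomputable def FreeResolution.complex : ChainComplex (ModuleCat.{u} A) ℕ :=
  ChainComplex.of (fun i => ModuleCat.of A (Fin (G.b i) → A)) (fun i => ModuleCat.ofHom (G.d i))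
    (fun i => by
      ext1
      exact LinearMap.ext (G.exact_succ i).apply_apply_eq_zero)

theorem FreeResolution.complex_d (i : ℕ) :
    G.complex.d (i + 1) i = ModuleCat.ofHom (G.d i) := by
  simp [FreeResolution.complex]

/-- A free resolution as a projective resolution in the category of modules. -/
noncomputable def FreeResolution.projectiveResolution :
    ProjectiveResolution (ModuleCat.of A N) where
  complex := G.complex
  projective i := by
    have : Module.Projective A (G.complex.X i) :=
      inferInstanceAs (Module.Projective A (Fin (G.b i) → A))
    exact (G.complex.X i).projective_of_categoryTheory_projective
  π := (ChainComplex.toSingle₀Equiv _ _).symm ⟨ModuleCat.ofHom G.aug, by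
    rw [G.complex_d]
    ext1
    exact LinearMap.ext G.exact_zero.apply_apply_eq_zero⟩
  quasiIso := ⟨fun n => by
    cases n with
    | zero =>
      rw [ChainComplex.quasiIsoAt₀_iff, ShortComplex.quasiIso_iff_of_zeros']
      · constructor
        · rw [ShortComplex.moduleCat_exact_iff_range_eq_ker]
          change LinearMap.range (G.complex.d 1 0).hom = LinearMap.ker G.aug
          rw [G.complex_d]
          exact G.exact_zero.linearMap_ker_eq.symm
        · exact (ModuleCat.epi_iff_surjective _).2 G.aug_surjective
      all_goals rfl
    | succ n =>
      rw [quasiIsoAt_iff_exactAt']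
      · rw [HomologicalComplex.exactAt_iff' _ (n + 1 + 1) (n + 1) n (by simp) (by simp)]
        rw [ShortComplex.moduleCat_exact_iff_range_eq_ker]
        have h := (G.exact_succ n).linearMap_ker_eq
        change LinearMap.range (G.complex.d (n + 2) (n + 1)).hom =
          LinearMap.ker (G.complex.d (n + 1) n).hom
        rw [G.complex_d, G.complex_d]
        exact h.symm
      · apply ChainComplex.exactAt_succ_single_obj⟩

variable (k : Type u) [AddCommGroup k] [Module A k]

/-- The homology of `k ⊗ G` computes `Tor`. -/
noncomputable def FreeResolution.torIso (i : ℕ) :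
    ((Tor (ModuleCat.{u} A) i).obj (ModuleCat.of A k)).obj (ModuleCat.of A N) ≅
      (((MonoidalCategory.tensoringLeft (ModuleCat.{u} A)).obj
        (ModuleCat.of A k)).mapHomologicalComplex _ |>.obj G.complex).homology i :=
  G.projectiveResolution.isoLeftDerivedObj _ i

theorem FreeResolution.length_tor_zero :
    Module.length A (((Tor (ModuleCat.{u} A) 0).obj (ModuleCat.of A k)).obj (ModuleCat.of A N)) +
      Module.length A (LinearMap.range ((G.d 0).lTensor k)) =
        Module.length A (k ⊗[A] (Fin (G.b 0) → A)) := by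
  let K := (((MonoidalCategory.tensoringLeft (ModuleCat.{u} A)).obj
        (ModuleCat.of A k)).mapHomologicalComplex (ComplexShape.down ℕ) |>.obj G.complex)
  have h := length_homology_add (K.sc' 1 0 0)
  have e : K.homology 0 ≅ (K.sc' 1 0 0).homology :=
    ShortComplex.homologyMapIso (K.isoSc' 1 0 0 (by simp) (by simp))
  rw [← ((G.torIso k 0).trans e).toLinearEquiv.length_eq] at h
  have h0 : (K.sc' 1 0 0).g = 0 := K.shape _ _ (by simp)
  have h1 : (K.sc' 1 0 0).f.hom = (G.d 0).lTensor k := by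
    change (((MonoidalCategory.tensoringLeft (ModuleCat.{u} A)).obj
        (ModuleCat.of A k)).map (G.complex.d 1 0)).hom = _
    rw [G.complex_d]
    rfl
  rw [h0, h1] at h
  have h2 :
      Module.length A (LinearMap.range (0 : (K.sc' 1 0 0).X₂ ⟶ (K.sc' 1 0 0).X₃).hom) = 0 := by
    rw [ModuleCat.hom_zero, LinearMap.range_zero, Module.length_bot]
  rw [h2, add_zero] at h
  exact h

theorem FreeResolution.length_tor_succ (i : ℕ) :
    Module.length A (((Tor (ModuleCat.{u} A) (i + 1)).obj (ModuleCat.of A k)).obj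
        (ModuleCat.of A N)) +
      Module.length A (LinearMap.range ((G.d (i + 1)).lTensor k)) +
      Module.length A (LinearMap.range ((G.d i).lTensor k)) =
        Module.length A (k ⊗[A] (Fin (G.b (i + 1)) → A)) := by
  let K := (((MonoidalCategory.tensoringLeft (ModuleCat.{u} A)).obj
        (ModuleCat.of A k)).mapHomologicalComplex (ComplexShape.down ℕ) |>.obj G.complex)
  have h := length_homology_add (K.sc' (i + 2) (i + 1) i)
  have e : K.homology (i + 1) ≅ (K.sc' (i + 2) (i + 1) i).homology :=
    ShortComplex.homologyMapIso (K.isoSc' (i + 2) (i + 1) i (by simp) (by simp))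
  rw [← ((G.torIso k (i + 1)).trans e).toLinearEquiv.length_eq] at h
  have hd : ∀ j, (K.d (j + 1) j).hom = (G.d j).lTensor k := by
    intro j
    change (((MonoidalCategory.tensoringLeft (ModuleCat.{u} A)).obj
        (ModuleCat.of A k)).map (G.complex.d (j + 1) j)).hom = _
    rw [G.complex_d]
    rfl
  have h1 : (K.sc' (i + 2) (i + 1) i).f.hom = (G.d (i + 1)).lTensor k := hd _
  have h2 : (K.sc' (i + 2) (i + 1) i).g.hom = (G.d i).lTensor k := hd _
  rw [h1, h2] at h
  exact h

end TorLength

section LocalTor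

variable {A : Type u} [CommRing A] [IsLocalRing A]

theorem length_residueField_tensor (X : Type u) [AddCommGroup X] [Module A X] [Module.Finite A X] :
    Module.length A (ResidueField A ⊗[A] X) = fiberRank A (ResidueField A) X := by
  rw [Module.length_eq_of_surjective (R := ResidueField A) (S := A)
    IsLocalRing.residue_surjective, Module.length_eq_finrank]
  rfl

variable {N : Type u} [AddCommGroup N] [Module A N] (G : FreeResolution A N)

/-- The module Ω_i is the cokernel of `d i`, so right exactness identifies k ⊗ Ω_i with the cokernel
of k ⊗ `d i`. -/
theorem FreeResolution.length_range_lTensor (i : ℕ) :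
    Module.length A (LinearMap.range ((G.d i).lTensor (ResidueField A))) +
      (G.fiberSyzygy (ResidueField A) i : ℕ∞) = G.b i := by
  have key : ∀ (X : Type u) [AddCommGroup X] [Module A X] (g : (Fin (G.b i) → A) →ₗ[A] X),
      Function.Exact (G.d i) g →
      Module.length A (LinearMap.range ((G.d i).lTensor (ResidueField A))) +
        (fiberRank A (ResidueField A) (LinearMap.range g) : ℕ∞) = G.b i := by
    intro X _ _ g hg
    have hg' : Function.Exact (G.d i) g.rangeRestrict := by
      rw [LinearMap.exact_iff, LinearMap.ker_rangeRestrict, hg.linearMap_ker_eq]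
    have hex : Function.Exact ((G.d i).lTensor (ResidueField A))
        (g.rangeRestrict.lTensor (ResidueField A)) :=
      lTensor_exact (ResidueField A) hg' g.surjective_rangeRestrict
    have h := length_range_add_of_exact _ _
      (LinearMap.lTensor_surjective (ResidueField A) g.surjective_rangeRestrict) hex
    rw [← length_residueField_tensor, h, length_residueField_tensor, fiberRank_free,
      Module.finrank_fin_fun]
  cases i with
  | zero => exact key _ _ G.exact_zero
  | succ i => exact key _ _ (G.exact_succ i)

variable [IsNoetherianRing A] (N)

/-- The length of `Tor_i(k, N)`. -/
theorem length_tor_residueField_zero [Module.Finite A N] :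
    ((Module.length A (((CategoryTheory.Tor (ModuleCat.{u} A) 0).obj
      (ModuleCat.of A (ResidueField A))).obj (ModuleCat.of A N))).toNat : ℤ) =
        chi A (ResidueField A) 0 N := by
  obtain ⟨G, -⟩ := FreeResolution.exists_isMinimal (R := A) N
  have h := G.length_tor_zero (ResidueField A)
  have h0 := G.length_range_lTensor 0
  have hchi := G.chi_eq (ResidueField A) 0
  rw [length_residueField_tensor, fiberRank_free, Module.finrank_fin_fun] at h
  simp only [zero_lt_one, Finset.Icc_eq_empty_of_lt, Finset.sum_empty, add_zero] at hchi
  rw [hchi]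
  generalize Module.length A (LinearMap.range ((G.d 0).lTensor (ResidueField A))) = a at h h0
  generalize Module.length A (((CategoryTheory.Tor (ModuleCat.{u} A) 0).obj
      (ModuleCat.of A (ResidueField A))).obj (ModuleCat.of A N)) = t at h
  lift a to ℕ using by rintro rfl; simp at h
  lift t to ℕ using by rintro rfl; simp at h
  norm_cast at h h0
  simp only [ENat.toNat_natCast]
  omega

theorem length_tor_residueField_succ [Module.Finite A N] (i : ℕ) :
    ((Module.length A (((CategoryTheory.Tor (ModuleCat.{u} A) (i + 1)).obj
      (ModuleCat.of A (ResidueField A))).obj (ModuleCat.of A N))).toNat : ℤ) =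
        chi A (ResidueField A) (i + 1) N + chi A (ResidueField A) i N := by
  obtain ⟨G, -⟩ := FreeResolution.exists_isMinimal (R := A) N
  have h := G.length_tor_succ (ResidueField A) i
  have h0 := G.length_range_lTensor i
  have h1 := G.length_range_lTensor (i + 1)
  rw [G.chi_succ_add_chi (ResidueField A)]
  rw [length_residueField_tensor, fiberRank_free, Module.finrank_fin_fun] at h
  generalize Module.length A (LinearMap.range ((G.d i).lTensor (ResidueField A))) = a at h h0
  generalize Module.length A (LinearMap.range ((G.d (i + 1)).lTensor (ResidueField A))) = b at h h1
  generalize Module.length A (((CategoryTheory.Tor (ModuleCat.{u} A) (i + 1)).obj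
      (ModuleCat.of A (ResidueField A))).obj (ModuleCat.of A N)) = t at h
  lift a to ℕ using by rintro rfl; simp at h
  lift b to ℕ using by rintro rfl; simp at h
  lift t to ℕ using by rintro rfl; simp at h
  norm_cast at h h0 h1
  simp only [ENat.toNat_natCast]
  omega

end LocalTor

end GradedFrobenius

namespace GradedFrobenius

/-! ### The exact functors F^e_*. -/

namespace FrobeniusPushforward

variable {p e : ℕ} {R : Type*} [CommRing R] [ExpChar R p]
variable {N N' : Type*} [AddCommGroup N] [Module R N] [AddCommGroup N'] [Module R N']

/-- The identity `N → F^e_* N`. -/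
def of (p e : ℕ) (N : Type*) [AddCommGroup N] : N ≃+ FrobeniusPushforward p e N :=
  AddEquiv.refl N

theorem smul_of (r : R) (x : N) : r • of p e N x = of p e N (r ^ p ^ e • x) := rfl

theorem of_symm_smul (r : R) (x : FrobeniusPushforward p e N) :
    (of p e N).symm (r • x) = r ^ p ^ e • (of p e N).symm x := rfl

variable (p e) in
/-- The functor `F^e_*` on linear maps. -/
def map (f : N →ₗ[R] N') : FrobeniusPushforward p e N →ₗ[R] FrobeniusPushforward p e N' where
  toFun x := of p e N' (f ((of p e N).symm x))
  map_add' x y := by simp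
  map_smul' r x := by simp [of_symm_smul, smul_of]

theorem map_apply (f : N →ₗ[R] N') (x : N) : map p e f (of p e N x) = of p e N' (f x) := rfl

variable (p e) in
/-- The functor `F^e_*` on linear equivalences. -/
def mapEquiv (f : N ≃ₗ[R] N') :
    FrobeniusPushforward p e N ≃ₗ[R] FrobeniusPushforward p e N' :=
  { map p e f.toLinearMap with
    invFun := map p e f.symm.toLinearMap
    left_inv := f.left_inv
    right_inv := f.right_inv }

theorem map_injective {f : N →ₗ[R] N'} (h : Function.Injective f) :
    Function.Injective (map p e f) := h

theorem map_surjective {f : N →ₗ[R] N'} (h : Function.Surjective f) :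
    Function.Surjective (map p e f) := h

theorem map_exact {N'' : Type*} [AddCommGroup N''] [Module R N''] {f : N →ₗ[R] N'}
    {g : N' →ₗ[R] N''} (h : Function.Exact f g) :
    Function.Exact (map p e f) (map p e g) := h

variable (R) in
/-- `F^e_* F^{e'}_* N = F^{e + e'}_* N`. -/
def compEquiv (p e e' : ℕ) [ExpChar R p] (N : Type*) [AddCommGroup N] [Module R N] :
    FrobeniusPushforward p e (FrobeniusPushforward p e' N) ≃ₗ[R]
      FrobeniusPushforward p (e + e') N :=
  { ((of p e _).symm.trans (of p e' N).symm).trans (of p (e + e') N) with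
    map_smul' := fun r x => by
      change r ^ p ^ e • (of p e _).symm x = of p (e + e') N (r ^ p ^ (e + e') •
        (of p e' N).symm ((of p e _).symm x))
      change (r ^ p ^ e) ^ p ^ e' • (of p e' N).symm ((of p e _).symm x) = _
      rw [← pow_mul, ← pow_add]
      rfl }

variable (R) in
/-- `F^e_* (N^n) = (F^e_* N)^n`. -/
def piEquiv (p e : ℕ) [ExpChar R p] (ι : Type*) (N : Type*) [AddCommGroup N] [Module R N] :
    FrobeniusPushforward p e (ι → N) ≃ₗ[R] (ι → FrobeniusPushforward p e N) :=
  { AddEquiv.refl _ with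
    map_smul' := fun _ _ => rfl }

variable (R) in
/-- `F^e_* (N × N') = F^e_* N × F^e_* N'`. -/
def prodEquiv (p e : ℕ) [ExpChar R p] (N N' : Type*) [AddCommGroup N] [Module R N]
    [AddCommGroup N'] [Module R N'] :
    FrobeniusPushforward p e (N × N') ≃ₗ[R]
      FrobeniusPushforward p e N × FrobeniusPushforward p e N' :=
  { AddEquiv.refl _ with
    map_smul' := fun _ _ => rfl }

instance [Subsingleton N] : Subsingleton (FrobeniusPushforward p e N) :=
  inferInstanceAs (Subsingleton N)

instance isScalarTower {A : Type*} [CommRing A] [ExpChar A p] [Algebra R A] [Module A N]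
    [IsScalarTower R A N] : IsScalarTower R A (FrobeniusPushforward p e N) where
  smul_assoc r a x := by
    obtain ⟨x, rfl⟩ := (of p e N).surjective x
    rw [smul_of, smul_of, smul_of, Algebra.smul_def, mul_pow, ← map_pow, ← Algebra.smul_def,
      smul_assoc]

/-- Frobenius pushforward commutes with localization. -/
instance isLocalizedModule (S : Submonoid R) (l : N →ₗ[R] N') [IsLocalizedModule S l] :
    IsLocalizedModule S (map p e l) where
  map_units s := by
    have h := IsLocalizedModule.map_units l (s ^ p ^ e)
    rw [Module.End.isUnit_iff] at h ⊢
    exact h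
  surj y := by
    obtain ⟨⟨x, s⟩, hxs⟩ := IsLocalizedModule.surj S l ((of p e N').symm y)
    -- In the pushforward, s acts on y as s^{p^e}, and s^{p^e} y = s^{p^e − 1} (s y) = l(s^{p^e − 1}
    -- x).
    refine ⟨⟨of p e N (s ^ (p ^ e - 1) • x), s⟩, ?_⟩
    change (s : R) ^ p ^ e • (of p e N').symm y = l (s ^ (p ^ e - 1) • x)
    dsimp only at hxs
    rw [LinearMap.map_smul_of_tower, ← hxs, ← mul_smul, ← pow_succ, Nat.sub_add_cancel
      (Nat.one_le_pow e p (expChar_pos R p))]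
    rfl
  exists_of_eq {x y} h := by
    obtain ⟨c, hc⟩ := IsLocalizedModule.exists_of_eq (S := S) (f := l) h
    refine ⟨c, ?_⟩
    change (c : R) ^ p ^ e • (of p e N).symm x = (c : R) ^ p ^ e • (of p e N).symm y
    have hc' : (c : R) • (of p e N).symm x = (c : R) • (of p e N).symm y := hc
    rw [← Nat.sub_add_cancel (Nat.one_le_pow e p (expChar_pos R p)), pow_succ, mul_smul, mul_smul,
      hc']

end FrobeniusPushforward

/-! ### Permanence of F-finiteness. -/

section FFinite

variable {p : ℕ} {R : Type u} [CommRing R] [ExpChar R p]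

theorem isFFinite_iff : IsFFinite p R ↔ Module.Finite R (FrobeniusPushforward p 1 R) := by
  have h : (Module.compHom R (iterateFrobenius R p 1) : Module R R) =
      (frobenius R p).toAlgebra.toModule := by
    refine Module.ext' _ _ fun r x => ?_
    change iterateFrobenius R p 1 r * x = frobenius R p r * x
    rw [iterateFrobenius_one_apply, frobenius_def]
  change @Module.Finite R R _ _ (frobenius R p).toAlgebra.toModule ↔
    @Module.Finite R R _ _ (Module.compHom R (iterateFrobenius R p 1))
  rw [h]

theorem IsFFinite.finite_pushforward (hF : IsFFinite p R) (e : ℕ) (N : Type v) [AddCommGroup N]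
    [Module R N] [Module.Finite R N] : Module.Finite R (FrobeniusPushforward p e N) := by
  have h1 : ∀ (N : Type v) [AddCommGroup N] [Module R N] [Module.Finite R N],
      Module.Finite R (FrobeniusPushforward p 1 N) := by
    intro N _ _ _
    have := isFFinite_iff.1 hF
    obtain ⟨n, f, hf⟩ := Module.Finite.exists_fin' R N
    exact Module.Finite.of_surjective
      (FrobeniusPushforward.map p 1 f ∘ₗ
        (FrobeniusPushforward.piEquiv R p 1 (Fin n) R).symm.toLinearMap)
      ((FrobeniusPushforward.map_surjective hf).comp
        (FrobeniusPushforward.piEquiv R p 1 (Fin n) R).symm.surjective)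
  induction e with
  | zero =>
    refine Module.Finite.equiv (M := N) { FrobeniusPushforward.of p 0 N with
      map_smul' := fun r x => ?_ }
    change r • x = r ^ p ^ 0 • x
    simp
  | succ e ih =>
    have := h1 (FrobeniusPushforward p e N)
    rw [add_comm e 1]
    exact Module.Finite.equiv (FrobeniusPushforward.compEquiv R p 1 e N)

/-- The Frobenius of A is integral, each x being a root of T^p − F(x). It is of finite type because
precomposing it with R → A gives the Frobenius of R followed by R → A. -/
theorem isFFinite_of_finiteType {A : Type v} [CommRing A] [ExpChar A p] [Algebra R A]
    [Algebra.FiniteType R A] (hF : IsFFinite p R) : IsFFinite p A := by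
  refine RingHom.finite_iff_isIntegral_and_finiteType.2 ⟨fun x => ?_, ?_⟩
  · refine ⟨Polynomial.X ^ p - Polynomial.C x, Polynomial.monic_X_pow_sub_C x
      (expChar_pos A p).ne', ?_⟩
    simp [frobenius_def]
  · have h : (algebraMap R A).comp (frobenius R p) = (frobenius A p).comp (algebraMap R A) := by
      ext x
      simp [frobenius_def]
    have h1 : ((algebraMap R A).comp (frobenius R p)).FiniteType :=
      (RingHom.FiniteType.comp (RingHom.finiteType_algebraMap.2 ‹_›)
        hF.finiteType)
    rw [h] at h1
    exact h1.of_comp_finiteType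

theorem isFFinite_of_isLocalization {A : Type v} [CommRing A] [ExpChar A p] [Algebra R A]
    (S : Submonoid R) [IsLocalization S A] (hF : IsFFinite p R) : IsFFinite p A := by
  rw [isFFinite_iff] at hF ⊢
  exact Module.Finite.of_isLocalizedModule S
    (FrobeniusPushforward.map p 1 (Algebra.linearMap R A))

theorem charP_of_algebra (p : ℕ) [Fact p.Prime] (R : Type*) [CommRing R] [CharP R p] (A : Type*)
    [CommRing A] [Nontrivial A] [Algebra R A] : CharP A p :=
  (CharP.charP_iff_prime_eq_zero Fact.out).2 <| by
    rw [← map_natCast (algebraMap R A), CharP.cast_eq_zero, map_zero]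

end FFinite

/-! ### The degree [K : K^p]. -/

section Field

variable (p : ℕ) [Fact p.Prime] (K : Type u) [Field K] [CharP K p]

theorem closure_range_pow : (Subfield.closure (Set.range fun x : K => x ^ p)) =
    (frobenius K p).fieldRange := by
  apply le_antisymm
  · rw [Subfield.closure_le]
    rintro _ ⟨x, rfl⟩
    exact ⟨x, rfl⟩
  · rintro _ ⟨x, rfl⟩
    exact Subfield.subset_closure ⟨x, rfl⟩

theorem finrank_pushforward_eq :
    Module.finrank K (FrobeniusPushforward p 1 K) = frobeniusDegree p K := by
  rw [frobeniusDegree, closure_range_pow]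
  let i : K ≃+* (frobenius K p).fieldRange :=
    RingEquiv.ofBijective (frobenius K p).rangeRestrictField
      (frobenius K p).rangeRestrictField_bijective
  refine congrArg Cardinal.toNat (rank_eq_of_equiv_equiv i
    (FrobeniusPushforward.of p 1 K).symm i.bijective fun r m => ?_)
  obtain ⟨m, rfl⟩ := (FrobeniusPushforward.of p 1 K).surjective m
  rw [FrobeniusPushforward.smul_of, AddEquiv.symm_apply_apply, AddEquiv.symm_apply_apply, pow_one]
  rfl

variable {K} in
-- The extension K / K^p is finite and purely inseparable. Hence no information is lost when `alpha`
-- applies `Nat.log`.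
theorem frobeniusDegree_eq_pow (hF : IsFFinite p K) :
    ∃ n, frobeniusDegree p K = p ^ n := by
  have h1 : Module.finrank K (FrobeniusPushforward p 1 K) ≠ 0 := by
    have := isFFinite_iff.1 hF
    have : Nontrivial (FrobeniusPushforward p 1 K) := inferInstanceAs (Nontrivial K)
    exact Module.finrank_pos.ne'
  rw [finrank_pushforward_eq] at h1
  rw [frobeniusDegree] at h1 ⊢
  have : FiniteDimensional (Subfield.closure (Set.range fun x : K => x ^ p)) K :=
    Module.finite_of_finrank_pos (Nat.pos_of_ne_zero h1)
  have : IsPurelyInseparable (Subfield.closure (Set.range fun x : K => x ^ p)) K := by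
    rw [isPurelyInseparable_iff_pow_mem _ p]
    intro x
    exact ⟨1, ⟨x ^ p, Subfield.subset_closure ⟨x, rfl⟩⟩, by rw [pow_one]; rfl⟩
  exact IsPurelyInseparable.finrank_eq_pow _ _ p

variable {K} in
theorem frobeniusDegree_congr {L : Type u} [Field L] [CharP L p] (f : K ≃+* L) :
    frobeniusDegree p K = frobeniusDegree p L := by
  rw [← finrank_pushforward_eq, ← finrank_pushforward_eq]
  refine congrArg Cardinal.toNat (rank_eq_of_equiv_equiv f
    (((FrobeniusPushforward.of p 1 K).symm.trans f.toAddEquiv).trans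
      (FrobeniusPushforward.of p 1 L)) f.bijective fun r m => ?_)
  obtain ⟨m, rfl⟩ := (FrobeniusPushforward.of p 1 K).surjective m
  simp [FrobeniusPushforward.smul_of]

end Field

end GradedFrobenius

namespace GradedFrobenius

/-! ### Generic bases and length computations in dimension one. -/

section GenericBasis

/-- A finite module over a domain contains a free module of full rank. -/
theorem exists_generic_basis {D K N V : Type*} [CommRing D] [IsDomain D] [Field K] [Algebra D K]
    [IsFractionRing D K] [AddCommGroup N] [Module D N] [Module.Finite D N] [AddCommGroup V]
    [Module D V] [Module K V] [IsScalarTower D K V] (l : N →ₗ[D] V)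
    [IsLocalizedModule (nonZeroDivisors D) l] :
    ∃ g : (Fin (Module.finrank K V) → D) →ₗ[D] N, Function.Injective g ∧
      ∀ y, ∃ d : D, d ≠ 0 ∧ d • y ∈ LinearMap.range g := by
  have : Module.Finite K V := Module.Finite.of_isLocalizedModule (nonZeroDivisors D) l
  let b := Module.finBasis K V
  choose xs hxs using fun i => IsLocalizedModule.surj (nonZeroDivisors D) l (b i)
  have hu : ∀ i, IsUnit (algebraMap D K (xs i).2) := fun i =>
    IsLocalization.map_units K (xs i).2
  let b' := b.isUnitSMul hu
  have hb' : ∀ i, b' i = l (xs i).1 := fun i => by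
    rw [Module.Basis.isUnitSMul_apply, ← hxs i, algebraMap_smul]
    rfl
  let g := Fintype.linearCombination D (fun i => (xs i).1)
  have hg : ∀ c, l (g c) = ∑ i, algebraMap D K (c i) • b' i := fun c => by
    simp only [g, Fintype.linearCombination_apply, map_sum, map_smul, hb', algebraMap_smul]
  refine ⟨g, ?_, fun y => ?_⟩
  · rw [← LinearMap.ker_eq_bot, LinearMap.ker_eq_bot']
    intro c hc
    have h := hg c
    rw [hc, map_zero] at h
    have h2 := Fintype.linearIndependent_iff.1 b'.linearIndependent _ h.symm
    ext i
    exact (IsFractionRing.injective D K) (by rw [h2 i, Pi.zero_apply, map_zero])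
  · obtain ⟨d, hd⟩ := IsLocalization.exist_integer_multiples_of_finite (nonZeroDivisors D)
      (fun i => b'.repr (l y) i)
    choose a ha using hd
    have h : l ((d : D) • y) = l (g a) := by
      rw [hg, map_smul]
      conv_lhs => rw [← b'.sum_repr (l y)]
      rw [Finset.smul_sum]
      refine Finset.sum_congr rfl fun i _ => ?_
      rw [ha i, smul_assoc]
    obtain ⟨c, hc⟩ := IsLocalizedModule.exists_of_eq (S := nonZeroDivisors D) (f := l) h
    refine ⟨c * d, mul_ne_zero (nonZeroDivisors.ne_zero c.2) (nonZeroDivisors.ne_zero d.2),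
      (c : D) • a, ?_⟩
    rw [map_smul, mul_smul]
    exact hc.symm

end GenericBasis

section Length

variable {A : Type*} [CommRing A]

theorem length_quotient_map {X Y : Type*} [AddCommGroup X] [Module A X] [AddCommGroup Y]
    [Module A Y] (f : X →ₗ[A] Y) (hf : Function.Injective f) (Z : Submodule A X) :
    Module.length A (Y ⧸ Z.map f) =
      Module.length A (X ⧸ Z) + Module.length A (Y ⧸ LinearMap.range f) := by
  refine Module.length_eq_add_of_exact (Submodule.mapQ Z (Z.map f) f (Submodule.le_comap_map f Z))
    (Submodule.factor (LinearMap.map_le_range : Z.map f ≤ LinearMap.range f)) ?_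
    (Submodule.factor_surjective _) ?_
  · rw [← LinearMap.ker_eq_bot, LinearMap.ker_eq_bot']
    intro x hx
    obtain ⟨x, rfl⟩ := Submodule.mkQ_surjective _ x
    rw [Submodule.mkQ_apply, Submodule.mapQ_apply, Submodule.Quotient.mk_eq_zero] at hx
    obtain ⟨z, hz, hzx⟩ := hx
    rw [Submodule.mkQ_apply, Submodule.Quotient.mk_eq_zero, ← hf hzx]
    exact hz
  · intro y
    obtain ⟨y, rfl⟩ := Submodule.mkQ_surjective _ y
    rw [Submodule.factor_mk, Submodule.mkQ_apply, Submodule.mkQ_apply,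
      Submodule.Quotient.mk_eq_zero]
    constructor
    · rintro ⟨x, rfl⟩
      exact ⟨Submodule.Quotient.mk x, rfl⟩
    · rintro ⟨x, hx⟩
      obtain ⟨x, rfl⟩ := Submodule.mkQ_surjective _ x
      rw [Submodule.mkQ_apply, Submodule.mapQ_apply, Submodule.Quotient.eq] at hx
      obtain ⟨z, -, hz⟩ := hx
      refine ⟨x - z, ?_⟩
      rw [map_sub, hz]
      abel

/-- For a submodule of finite colength, the length of the quotient by a regular element does not
change. -/
theorem length_quotient_smul_eq {X Y : Type*} [AddCommGroup X] [Module A X] [AddCommGroup Y]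
    [Module A Y] (f : X →ₗ[A] Y) (hf : Function.Injective f)
    (hfin : Module.length A (Y ⧸ LinearMap.range f) ≠ ⊤) (x : A)
    (hx : Function.Injective (LinearMap.lsmul A Y x)) :
    Module.length A (Y ⧸ LinearMap.range (LinearMap.lsmul A Y x)) =
      Module.length A (X ⧸ LinearMap.range (LinearMap.lsmul A X x)) := by
  -- Since f(xX) = x f(X), its colength in Y can be computed both through f(X) and through xY. The
  -- finite colength of f(X) occurs in both expressions and cancels.
  have h1 := length_quotient_map f hf (LinearMap.range (LinearMap.lsmul A X x))
  have h2 := length_quotient_map (LinearMap.lsmul A Y x) hx (LinearMap.range f)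
  have h3 : (LinearMap.range (LinearMap.lsmul A X x)).map f =
      (LinearMap.range f).map (LinearMap.lsmul A Y x) := by
    rw [← LinearMap.range_comp, ← LinearMap.range_comp]
    congr 1
    ext y
    simp
  rw [h3, h2, add_comm] at h1
  exact WithTop.add_right_cancel hfin h1

theorem length_range_lsmul_pi (n : ℕ) (x : A) :
    Module.length A ((Fin n → A) ⧸ LinearMap.range (LinearMap.lsmul A (Fin n → A) x)) =
      n * Ring.ord A x := by
  let f : (Fin n → A) →ₗ[A] (Fin n → A ⧸ Ideal.span {x}) :=
    LinearMap.pi fun i => (Ideal.span {x}).mkQ ∘ₗ LinearMap.proj i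
  have hf : Function.Surjective f := by
    intro y
    choose z hz using fun i => Submodule.mkQ_surjective _ (y i)
    exact ⟨z, funext hz⟩
  have hk : LinearMap.ker f = LinearMap.range (LinearMap.lsmul A (Fin n → A) x) := by
    ext y
    rw [LinearMap.mem_ker]
    constructor
    · intro h
      have h' : ∀ i, ∃ z, z * x = y i := fun i =>
        Ideal.mem_span_singleton'.1 ((Submodule.Quotient.mk_eq_zero _).1 (congrFun h i))
      choose z hz using h'
      exact ⟨z, funext fun i => by simp [← hz i, mul_comm]⟩
    · rintro ⟨z, rfl⟩
      funext i
      refine (Submodule.Quotient.mk_eq_zero _).2 (Ideal.mem_span_singleton'.2 ⟨z i, ?_⟩)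
      simp [mul_comm]
  rw [← hk, (f.quotKerEquivOfSurjective hf).length_eq, Module.length_pi_of_fintype]
  simp [Ring.ord]

/-- A finite torsion module is killed by a single d ≠ 0, so it is a quotient of some (A/d)^n, and
A/d has finite length in dimension at most one. -/
theorem length_ne_top_of_torsion [IsDomain A] [IsNoetherianRing A] [Ring.KrullDimLE 1 A]
    (X : Type*) [AddCommGroup X] [Module A X] [Module.Finite A X]
    (h : ∀ y : X, ∃ d : A, d ≠ 0 ∧ d • y = 0) : Module.length A X ≠ ⊤ := by
  obtain ⟨n, f, hf⟩ := Module.Finite.exists_fin' A X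
  choose d hd hdy using fun i => h (f (Pi.single i 1))
  have h0 : ∏ i, d i ≠ 0 := Finset.prod_ne_zero_iff.2 fun i _ => hd i
  have hk : LinearMap.range (LinearMap.lsmul A (Fin n → A) (∏ i, d i)) ≤ LinearMap.ker f := by
    rintro _ ⟨z, rfl⟩
    rw [LinearMap.mem_ker, LinearMap.lsmul_apply, map_smul]
    have hz : z = ∑ i, z i • Pi.single i (1 : A) := by
      exact pi_eq_sum_univ' z
    rw [hz, map_sum, Finset.smul_sum]
    refine Finset.sum_eq_zero fun i _ => ?_
    rw [← Finset.prod_erase_mul _ _ (Finset.mem_univ i), map_smul, smul_comm, mul_smul, hdy,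
      smul_zero, smul_zero]
  have hle := Module.length_le_of_surjective (Submodule.liftQ _ f hk)
    (by rw [← LinearMap.range_eq_top, Submodule.range_liftQ, LinearMap.range_eq_top.2 hf])
  rw [length_range_lsmul_pi] at hle
  refine ne_top_of_le_ne_top (WithTop.mul_ne_top (ENat.natCast_ne_top n) ?_) hle
  exact Ring.ord_ne_top (mem_nonZeroDivisors_of_ne_zero h0)

variable {p : ℕ} [Fact p.Prime] [CharP A p]

theorem length_pushforward_quotient_lsmul (x : A) :
    Module.length A (FrobeniusPushforward p 1 A ⧸
      LinearMap.range (LinearMap.lsmul A (FrobeniusPushforward p 1 A) x)) =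
      Module.length A (FrobeniusPushforward p 1 (A ⧸ Ideal.span {x ^ p})) := by
  let f := FrobeniusPushforward.map p 1 (Ideal.span {x ^ p}).mkQ
  have hf : Function.Surjective f :=
    FrobeniusPushforward.map_surjective (Submodule.mkQ_surjective _)
  have hk : LinearMap.ker f =
      LinearMap.range (LinearMap.lsmul A (FrobeniusPushforward p 1 A) x) := by
    ext y
    obtain ⟨y, rfl⟩ := (FrobeniusPushforward.of p 1 A).surjective y
    rw [LinearMap.mem_ker, FrobeniusPushforward.map_apply, AddEquiv.map_eq_zero_iff,
      Submodule.mkQ_apply, Submodule.Quotient.mk_eq_zero, Ideal.mem_span_singleton']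
    constructor
    · rintro ⟨a, rfl⟩
      refine ⟨FrobeniusPushforward.of p 1 A a, ?_⟩
      rw [LinearMap.lsmul_apply, FrobeniusPushforward.smul_of, pow_one, smul_eq_mul, mul_comm]
    · rintro ⟨a, ha⟩
      obtain ⟨a, rfl⟩ := (FrobeniusPushforward.of p 1 A).surjective a
      rw [LinearMap.lsmul_apply, FrobeniusPushforward.smul_of, pow_one, smul_eq_mul, mul_comm] at ha
      exact ⟨a, (FrobeniusPushforward.of p 1 A).injective ha⟩
  rw [← hk, (f.quotKerEquivOfSurjective hf).length_eq]

end Length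

section LocalLength

variable {p : ℕ} [Fact p.Prime] {A : Type u} [CommRing A] [IsLocalRing A] [CharP A p]

theorem isFFinite_residueField (hF : IsFFinite p A) :
    haveI := charP_of_algebra p A (ResidueField A)
    IsFFinite p (ResidueField A) := by
  have := charP_of_algebra p A (ResidueField A)
  have : Module.Finite A (ResidueField A) :=
    Module.Finite.of_surjective (Algebra.linearMap A (ResidueField A)) residue_surjective
  exact isFFinite_of_finiteType hF

/-- F_* is exact, so induction on a composition series reduces to W = k, where the length is [k :
k^p]. -/
theorem length_pushforward_one (hF : IsFFinite p A) (W : Type u) [AddCommGroup W] [Module A W]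
    (hW : IsFiniteLength A W) :
    Module.length A (FrobeniusPushforward p 1 W) =
      frobeniusDegree p (ResidueField A) * Module.length A W := by
  have := charP_of_algebra p A (ResidueField A)
  have hk : Module.length A (FrobeniusPushforward p 1 (ResidueField A)) =
      frobeniusDegree p (ResidueField A) := by
    have := isFFinite_iff.1 (isFFinite_residueField hF)
    rw [Module.length_eq_of_surjective (R := ResidueField A) (S := A)
      IsLocalRing.residue_surjective, Module.length_eq_finrank, finrank_pushforward_eq]
  induction hW with
  | of_subsingleton => simp [Module.length_eq_zero]
  | @of_simple_quotient M _ _ N hs hN ih =>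
    obtain ⟨I, hI, ⟨e⟩⟩ := isSimpleModule_iff_quot_maximal.1 hs
    obtain rfl := IsLocalRing.eq_maximalIdeal hI
    have h1 := Module.length_eq_add_of_exact (R := A)
      (FrobeniusPushforward.map p 1 N.subtype) (FrobeniusPushforward.map p 1 N.mkQ)
      (FrobeniusPushforward.map_injective N.subtype_injective)
      (FrobeniusPushforward.map_surjective N.mkQ_surjective)
      (FrobeniusPushforward.map_exact (LinearMap.exact_subtype_mkQ N))
    have h2 := Module.length_eq_add_of_exact (R := A) N.subtype N.mkQ N.subtype_injective
      N.mkQ_surjective (LinearMap.exact_subtype_mkQ N)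
    have h3 : Module.length A (FrobeniusPushforward p 1 (M ⧸ N)) =
        Module.length A (FrobeniusPushforward p 1 (ResidueField A)) :=
      (FrobeniusPushforward.mapEquiv p 1 e).length_eq
    rw [h1, h2, h3, hk, ih, Module.length_eq_one A (M ⧸ N)]
    ring

theorem length_pushforward (hF : IsFFinite p A) (e : ℕ) (W : Type u) [AddCommGroup W]
    [Module A W] (hW : IsFiniteLength A W) :
    Module.length A (FrobeniusPushforward p e W) =
      (frobeniusDegree p (ResidueField A) : ℕ∞) ^ e * Module.length A W := by
  induction e with
  | zero =>
    rw [pow_zero, one_mul]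
    refine LinearEquiv.length_eq (LinearEquiv.symm { FrobeniusPushforward.of p 0 W with
      map_smul' := fun r x => ?_ })
    change r • x = r ^ p ^ 0 • x
    simp
  | succ e ih =>
    rw [add_comm e 1, ← (FrobeniusPushforward.compEquiv A p 1 e W).length_eq,
      length_pushforward_one hF, ih, pow_add, pow_one, mul_assoc]
    rw [← Module.length_ne_top_iff] at hW ⊢
    rw [ih]
    exact WithTop.mul_ne_top (WithTop.pow_ne_top (ENat.natCast_ne_top _)) hW

/-- Compute λ(F_*A / x F_*A) twice for a nonzero nonunit x. A free submodule of rank [K : K^p] and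
finite colength gives [K : K^p] λ(A/x). Since x acts on F_*A as x^p, the quotient is also
F_*(A/x^p), of length [k : k^p] · p · λ(A/x). Now cancel λ(A/x), which is finite and nonzero. -/
theorem frobeniusDegree_fractionField (hF : IsFFinite p A) [IsDomain A] [IsNoetherianRing A]
    [Ring.KrullDimLE 1 A] (hA : ¬ IsField A) (K : Type u) [Field K] [Algebra A K]
    [IsFractionRing A K] [CharP K p] :
    frobeniusDegree p K = p * frobeniusDegree p (ResidueField A) := by
  obtain ⟨x, hx, hx0⟩ := (Submodule.ne_bot_iff _).1
    (mt (IsLocalRing.isField_iff_maximalIdeal_eq).2 hA)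
  have hxn : x ∈ nonZeroDivisors A := mem_nonZeroDivisors_of_ne_zero hx0
  have := isFFinite_iff.1 hF
  obtain ⟨g, hg, hg'⟩ := exists_generic_basis (K := K)
    (FrobeniusPushforward.map p 1 (Algebra.linearMap A K))
  have hfin : Module.length A (FrobeniusPushforward p 1 A ⧸ LinearMap.range g) ≠ ⊤ := by
    refine length_ne_top_of_torsion _ fun y => ?_
    obtain ⟨y, rfl⟩ := Submodule.mkQ_surjective _ y
    obtain ⟨d, hd, hdy⟩ := hg' y
    refine ⟨d, hd, ?_⟩
    rw [← map_smul]
    exact (Submodule.Quotient.mk_eq_zero _).2 hdy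
  have h1 := length_quotient_smul_eq g hg hfin x (by
    intro y z hyz
    obtain ⟨y, rfl⟩ := (FrobeniusPushforward.of p 1 A).surjective y
    obtain ⟨z, rfl⟩ := (FrobeniusPushforward.of p 1 A).surjective z
    have hyz' : x ^ p ^ 1 * y = x ^ p ^ 1 * z := (FrobeniusPushforward.of p 1 A).injective hyz
    rw [mul_left_cancel₀ (pow_ne_zero _ hx0) hyz'])
  have hord := Ring.ord_ne_top (pow_mem hxn p)
  rw [length_range_lsmul_pi, length_pushforward_quotient_lsmul,
    length_pushforward_one hF _ (Module.length_ne_top_iff.1 hord), finrank_pushforward_eq] at h1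
  change _ * Ring.ord A (x ^ p) = _ at h1
  rw [Ring.ord_pow hxn, nsmul_eq_mul] at h1
  have hpos : Ring.ord A x ≠ 0 := by
    rw [Ring.ord, Ne, Module.length_eq_zero_iff, Submodule.Quotient.subsingleton_iff]
    intro htop
    exact (IsLocalRing.maximalIdeal.isMaximal A).ne_top (top_le_iff.1 (htop.symm.trans_le
      ((Ideal.span_singleton_le_iff_mem _).2 hx)))
  have hne := Ring.ord_ne_top hxn
  lift Ring.ord A x to ℕ using hne with n
  norm_cast at h1 hpos
  have h2 := Nat.eq_of_mul_eq_mul_right (Nat.pos_of_ne_zero hpos)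
    (show frobeniusDegree p K * n = (p * frobeniusDegree p (ResidueField A)) * n by
      rw [← h1]; ring)
  exact h2

end LocalLength

end GradedFrobenius

namespace GradedFrobenius

/-! ### Kunz's formula and the function α on the spectrum. -/

section Alpha

variable {p : ℕ} [Fact p.Prime] {R : Type u} [CommRing R] [CharP R p]

theorem charP_residueField (P : Ideal R) [P.IsPrime] : CharP P.ResidueField p :=
  charP_of_algebra p R P.ResidueField

theorem isFFinite_quotient (hF : IsFFinite p R) (I : Ideal R) [CharP (R ⧸ I) p] :
    IsFFinite p (R ⧸ I) := isFFinite_of_finiteType hF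

theorem pow_alpha (hF : IsFFinite p R) (P : PrimeSpectrum R) :
    p ^ alpha p P = frobeniusDegree p P.asIdeal.ResidueField := by
  have := charP_residueField (p := p) P.asIdeal
  have := charP_of_algebra p R (R ⧸ P.asIdeal)
  have h : IsFFinite p P.asIdeal.ResidueField :=
    isFFinite_of_isLocalization (nonZeroDivisors (R ⧸ P.asIdeal))
      (isFFinite_quotient hF P.asIdeal)
  obtain ⟨n, hn⟩ := frobeniusDegree_eq_pow p h
  rw [alpha, hn, Nat.log_pow (Fact.out : p.Prime).one_lt]

theorem alpha_comap {S : Type u} [CommRing S] [CharP S p] (f : R →+* S)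
    (hf : Function.Surjective f) (P : PrimeSpectrum S) :
    alpha p (PrimeSpectrum.comap f P) = alpha p P := by
  have := charP_residueField (p := p) P.asIdeal
  have := charP_residueField (p := p) (PrimeSpectrum.comap f P).asIdeal
  let g : (R ⧸ (PrimeSpectrum.comap f P).asIdeal) ≃+* (S ⧸ P.asIdeal) :=
    RingEquiv.ofBijective (Ideal.quotientMap P.asIdeal f le_rfl)
      ⟨Ideal.quotientMap_injective, Ideal.quotientMap_surjective hf⟩
  rw [alpha, alpha, frobeniusDegree_congr p (IsFractionRing.ringEquivOfRingEquiv
    (K := (PrimeSpectrum.comap f P).asIdeal.ResidueField) (L := P.asIdeal.ResidueField) g)]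

variable [IsNoetherianRing R]

/-- The localization of R/P at Q is a one-dimensional local domain with fraction field κ(P) and
residue field κ(Q), so `frobeniusDegree_fractionField` applies. -/
theorem alpha_of_covBy (hF : IsFFinite p R) {P Q : PrimeSpectrum R} (h : P ⋖ Q) :
    alpha p P = alpha p Q + 1 := by
  have := charP_of_algebra p R (R ⧸ P.asIdeal)
  have := charP_residueField (p := p) P.asIdeal
  let f := Ideal.Quotient.mk P.asIdeal
  have hf : Function.Surjective f := Ideal.Quotient.mk_surjective
  have hker : RingHom.ker f ≤ Q.asIdeal := by
    rw [Ideal.mk_ker]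
    exact h.le
  have hQ' : (Q.asIdeal.map f).IsPrime := Ideal.map_isPrime_of_surjective hf hker
  let Q' : PrimeSpectrum (R ⧸ P.asIdeal) := ⟨Q.asIdeal.map f, hQ'⟩
  have hQ : PrimeSpectrum.comap f Q' = Q := by
    ext1
    exact (Ideal.comap_map_of_surjective' f hf Q.asIdeal).trans (sup_eq_left.2 hker)
  let A := Localization.AtPrime Q'.asIdeal
  have hle : Q'.asIdeal.primeCompl ≤ nonZeroDivisors (R ⧸ P.asIdeal) :=
    Q'.asIdeal.primeCompl_le_nonZeroDivisors
  have : IsDomain A := IsLocalization.isDomain_of_le_nonZeroDivisors A hle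
  have hinj : Function.Injective (algebraMap (R ⧸ P.asIdeal) A) :=
    IsLocalization.injective A hle
  have : IsNoetherianRing A := IsLocalization.isNoetherianRing Q'.asIdeal.primeCompl A inferInstance
  let _ := IsLocalization.localizationAlgebraOfSubmonoidLe A P.asIdeal.ResidueField
    Q'.asIdeal.primeCompl (nonZeroDivisors (R ⧸ P.asIdeal)) hle
  have := IsLocalization.localization_isScalarTower_of_submonoid_le A P.asIdeal.ResidueField
    Q'.asIdeal.primeCompl (nonZeroDivisors (R ⧸ P.asIdeal)) hle
  have : IsFractionRing A P.asIdeal.ResidueField :=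
    IsFractionRing.isFractionRing_of_isDomain_of_isLocalization Q'.asIdeal.primeCompl A
      P.asIdeal.ResidueField
  have hFA : IsFFinite p A := isFFinite_of_isLocalization Q'.asIdeal.primeCompl
    (isFFinite_quotient hF P.asIdeal)
  have hunder : (maximalIdeal A).comap (algebraMap (R ⧸ P.asIdeal) A) = Q'.asIdeal :=
    Localization.AtPrime.under_maximalIdeal
  have hfield : ¬ IsField A := by
    intro hA
    rw [IsLocalRing.isField_iff_maximalIdeal_eq] at hA
    rw [hA, ← RingHom.ker_eq_comap_bot, (RingHom.injective_iff_ker_eq_bot _).1 hinj] at hunder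
    have : P = Q := by
      rw [← hQ]
      ext1
      change P.asIdeal = Q'.asIdeal.comap f
      rw [← hunder, ← RingHom.ker_eq_comap_bot, Ideal.mk_ker]
    exact h.ne this
  -- A prime of A contracts to a prime between P and Q, hence to one of the two: it is either zero
  -- or maximal.
  have : Ring.KrullDimLE 1 A := by
    refine Ring.KrullDimLE.mk₁' fun I hI hIp => ?_
    have hmap := IsLocalization.map_under Q'.asIdeal.primeCompl A I
    let J : PrimeSpectrum (R ⧸ P.asIdeal) := PrimeSpectrum.comap (algebraMap _ A) ⟨I, hIp⟩
    have hJ : J ≤ Q' := by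
      change I.comap _ ≤ Q'.asIdeal
      exact (Ideal.comap_mono (IsLocalRing.le_maximalIdeal hIp.ne_top)).trans hunder.le
    have h1 : P ≤ PrimeSpectrum.comap f J := by
      change P.asIdeal ≤ J.asIdeal.comap f
      intro x hx
      rw [Ideal.mem_comap, Ideal.Quotient.eq_zero_iff_mem.2 hx]
      exact zero_mem _
    have h2 : PrimeSpectrum.comap f J ≤ Q := by
      rw [← hQ]
      exact Ideal.comap_mono hJ
    rcases h.eq_or_eq h1 h2 with h3 | h3
    · exfalso
      apply hI
      rw [← hmap]
      have : J.asIdeal = ⊥ := by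
        rw [← Ideal.map_comap_of_surjective f hf J.asIdeal]
        have h4 : J.asIdeal.comap f = P.asIdeal := congrArg PrimeSpectrum.asIdeal h3
        rw [h4, Ideal.map_quotient_self]
      change J.asIdeal.map _ = ⊥
      rw [this, Ideal.map_bot]
    · have h5 : J = Q' := PrimeSpectrum.comap_injective_of_surjective f hf (h3.trans hQ.symm)
      have h6 : I = maximalIdeal A := by
        rw [← hmap, ← IsLocalization.map_under Q'.asIdeal.primeCompl A (maximalIdeal A)]
        exact congrArg (Ideal.map _) ((congrArg PrimeSpectrum.asIdeal h5).trans hunder.symm)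
      rw [h6]
      infer_instance
  have key := frobeniusDegree_fractionField hFA hfield P.asIdeal.ResidueField
  have e1 : alpha p Q = alpha p Q' := by rw [← alpha_comap f hf Q', hQ]
  rw [← pow_alpha hF P] at key
  have key' : p ^ alpha p P = p * p ^ alpha p Q' := by
    rw [key, pow_alpha (isFFinite_quotient hF P.asIdeal) Q']
  rw [e1, ← Nat.pow_right_injective (Fact.out : p.Prime).two_le (key'.trans (pow_succ' p _).symm)]

theorem exists_le_covBy {P Q : PrimeSpectrum R} (h : P < Q) : ∃ Q', P ≤ Q' ∧ Q' ⋖ Q := by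
  have : WellFoundedGT (PrimeSpectrum R) := by
    let f : PrimeSpectrum R ↪o Ideal R :=
      ⟨⟨PrimeSpectrum.asIdeal, fun _ _ h => PrimeSpectrum.ext h⟩, Iff.rfl⟩
    exact f.wellFoundedGT
  exact exists_le_covBy_of_lt h

/-- Strict inclusion of primes is well-founded because every prime of a Noetherian ring has finite
height. -/
theorem primeSpectrum_induction {motive : PrimeSpectrum R → Prop}
    (h : ∀ Q, (∀ Q' < Q, motive Q') → motive Q) (Q : PrimeSpectrum R) : motive Q := by
  have hfin : ∀ Q : PrimeSpectrum R, Order.height Q < ⊤ := fun Q => by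
    rw [← PrimeSpectrum.height_eq_orderHeight]
    exact Ideal.height_lt_top_of_isPrime
  have hwf : WellFounded fun Q Q' : PrimeSpectrum R => Q < Q' :=
    Subrelation.wf (r := InvImage (· < ·) Order.height)
      (fun {Q Q'} hQ => Order.height_strictMono hQ (hfin Q))
      (InvImage.wf _ wellFounded_lt)
  exact hwf.induction Q h

theorem alpha_le_of_le (hF : IsFFinite p R) {P Q : PrimeSpectrum R} (h : P ≤ Q) :
    alpha p Q ≤ alpha p P := by
  induction Q using primeSpectrum_induction with
  | h Q ih =>
    rcases h.eq_or_lt with rfl | h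
    · rfl
    · obtain ⟨Q', h1, h2⟩ := exists_le_covBy h
      have := alpha_of_covBy hF h2
      have := ih Q' h2.lt h1
      omega

theorem alpha_lt_of_lt (hF : IsFFinite p R) {P Q : PrimeSpectrum R} (h : P < Q) :
    alpha p Q < alpha p P := by
  obtain ⟨Q', h1, h2⟩ := exists_le_covBy h
  have := alpha_of_covBy hF h2
  have := alpha_le_of_le hF h1
  omega

theorem alpha_le_add_height (hF : IsFFinite p R) {P Q : PrimeSpectrum R} (h : P ≤ Q) :
    (alpha p P : ℕ∞) ≤ alpha p Q + Order.height Q := by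
  induction Q using primeSpectrum_induction with
  | h Q ih =>
    rcases h.eq_or_lt with rfl | h
    · exact le_self_add
    · obtain ⟨Q', h1, h2⟩ := exists_le_covBy h
      have h3 := alpha_of_covBy hF h2
      have h4 := ih Q' h2.lt h1
      have h5 := Order.height_add_one_le h2.lt
      calc (alpha p P : ℕ∞) ≤ alpha p Q' + Order.height Q' := h4
        _ = alpha p Q + (Order.height Q' + 1) := by rw [h3]; push_cast; ring
        _ ≤ _ := by gcongr

/-- Descending from Q, each step of a chain of primes raises α by at least one, and α never exceeds
B. -/
theorem height_le_sub_alpha (hF : IsFFinite p R) {B : ℕ} (hB : ∀ P : PrimeSpectrum R, alpha p P ≤ B)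
    (Q : PrimeSpectrum R) : Order.height Q ≤ (B - alpha p Q : ℕ) := by
  induction Q using primeSpectrum_induction with
  | h Q ih =>
    rw [Order.height_le_coe_iff]
    intro Q' hQ'
    refine (ih Q' hQ').trans_lt ?_
    have := alpha_lt_of_lt hF hQ'
    have := hB Q'
    exact_mod_cast (by omega)

/-- By monotonicity α is bounded by its values at the finitely many minimal primes. Boundedness
matters because the supremum of an unbounded set of naturals is 0 by convention. -/
theorem bddAbove_alpha (hF : IsFFinite p R) :
    BddAbove (Set.range fun P : PrimeSpectrum R => alpha p P) := by
  have hfin := minimalPrimes.finite_of_isNoetherianRing R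
  have hfin' : {P : PrimeSpectrum R | P.asIdeal ∈ minimalPrimes R}.Finite :=
    hfin.preimage (fun _ _ _ _ h => PrimeSpectrum.ext h)
  obtain ⟨B, hB⟩ := (hfin'.image fun P => alpha p P).bddAbove
  refine ⟨B, ?_⟩
  rintro _ ⟨P, rfl⟩
  obtain ⟨Q, hQ, hQP⟩ := Ideal.exists_minimalPrimes_le (bot_le : (⊥ : Ideal R) ≤ P.asIdeal)
  have h1 : Q.IsPrime := hQ.1.1
  exact (alpha_le_of_le hF (P := ⟨Q, h1⟩) hQP).trans (hB ⟨⟨Q, h1⟩, hQ, rfl⟩)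

theorem alpha_le_gammaRing (hF : IsFFinite p R) (P : PrimeSpectrum R) :
    alpha p P ≤ gammaRing p R := le_ciSup (bddAbove_alpha hF) P

theorem alpha_le_gammaModule (hF : IsFFinite p R) (M : Type v) [AddCommGroup M] [Module R M]
    {P : PrimeSpectrum R} (hP : P ∈ Module.support R M) : alpha p P ≤ gammaModule p R M := by
  have hle := Module.annihilator_le_of_mem_support hP
  have hne : Nontrivial (R ⧸ Module.annihilator R M) :=
    Ideal.Quotient.nontrivial_iff.2 (fun h => P.2.ne_top (top_le_iff.1 (h ▸ hle)))
  have := charP_of_algebra p R (R ⧸ Module.annihilator R M)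
  let f := Ideal.Quotient.mk (Module.annihilator R M)
  have hf : Function.Surjective f := Ideal.Quotient.mk_surjective
  have hker : RingHom.ker f ≤ P.asIdeal := by rwa [Ideal.mk_ker]
  let P' : PrimeSpectrum (R ⧸ Module.annihilator R M) :=
    ⟨P.asIdeal.map f, Ideal.map_isPrime_of_surjective hf hker⟩
  have hP' : PrimeSpectrum.comap f P' = P := by
    ext1
    exact (Ideal.comap_map_of_surjective' f hf P.asIdeal).trans (sup_eq_left.2 hker)
  rw [← hP', alpha_comap f hf]
  exact alpha_le_gammaRing (isFFinite_quotient hF _) P'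

end Alpha

end GradedFrobenius

namespace GradedFrobenius

open TensorProduct

/-! ### Generic freeness along a prime. -/

section GenericFreeness

variable {R : Type u} [CommRing R]

/-- A free R/P-submodule of full rank has torsion cokernel, so P itself is not in the support of the
cokernel. -/
theorem exists_generic_free (P : PrimeSpectrum R) (N : Type u) [AddCommGroup N] [Module R N]
    [Module (R ⧸ P.asIdeal) N] [IsScalarTower R (R ⧸ P.asIdeal) N]
    [Module.Finite (R ⧸ P.asIdeal) N] (V : Type u) [AddCommGroup V] [Module (R ⧸ P.asIdeal) V]
    [Module P.asIdeal.ResidueField V] [IsScalarTower (R ⧸ P.asIdeal) P.asIdeal.ResidueField V]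
    (l : N →ₗ[R ⧸ P.asIdeal] V) [IsLocalizedModule (nonZeroDivisors (R ⧸ P.asIdeal)) l] :
    ∃ f : (Fin (Module.finrank P.asIdeal.ResidueField V) → R ⧸ P.asIdeal) →ₗ[R] N,
      Function.Injective f ∧ ∀ Q ∈ Module.support R (N ⧸ LinearMap.range f), P < Q := by
  obtain ⟨g, hg, hg'⟩ := exists_generic_basis (K := P.asIdeal.ResidueField) l
  refine ⟨g.restrictScalars R, hg, fun Q hQ => lt_of_le_of_ne ?_ ?_⟩
  · have h1 := Module.annihilator_le_of_mem_support hQ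
    refine (show P.asIdeal ≤ _ from fun r hr => Module.mem_annihilator.2 fun y => ?_).trans h1
    obtain ⟨y, rfl⟩ := Submodule.mkQ_surjective _ y
    rw [← map_smul, ← algebraMap_smul (R ⧸ P.asIdeal) r y, Ideal.Quotient.algebraMap_eq,
      Ideal.Quotient.eq_zero_iff_mem.2 hr, zero_smul, map_zero]
  · rintro rfl
    refine (Module.notMem_support_iff'.2 fun y => ?_) hQ
    obtain ⟨y, rfl⟩ := Submodule.mkQ_surjective _ y
    obtain ⟨d, hd, z, hz⟩ := hg' y
    obtain ⟨r, rfl⟩ := Ideal.Quotient.mk_surjective d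
    refine ⟨r, fun hr => hd (Ideal.Quotient.eq_zero_iff_mem.2 hr), ?_⟩
    rw [← map_smul, Submodule.mkQ_apply, Submodule.Quotient.mk_eq_zero]
    refine ⟨z, ?_⟩
    rw [LinearMap.restrictScalars_apply, hz, ← algebraMap_smul (R ⧸ P.asIdeal) r y]
    rfl

theorem exists_generic_free_of_annihilated (P : PrimeSpectrum R) (N : Type u) [AddCommGroup N]
    [Module R N] [Module.Finite R N] (hN : ∀ r ∈ P.asIdeal, ∀ x : N, r • x = 0) :
    ∃ (n : ℕ) (f : (Fin n → R ⧸ P.asIdeal) →ₗ[R] N),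
      Function.Injective f ∧ ∀ Q ∈ Module.support R (N ⧸ LinearMap.range f), P < Q := by
  have ht : Module.IsTorsionBySet R N P.asIdeal := fun x r => hN r.1 r.2 x
  let _ := ht.module
  have : IsScalarTower R (R ⧸ P.asIdeal) N := ht.isScalarTower
  have : Module.Finite (R ⧸ P.asIdeal) N := Module.Finite.of_restrictScalars_finite R _ _
  have : IsLocalizedModule (nonZeroDivisors (R ⧸ P.asIdeal))
      (TensorProduct.mk (R ⧸ P.asIdeal) P.asIdeal.ResidueField N 1) :=
    (isLocalizedModule_iff_isBaseChange _ P.asIdeal.ResidueField _).2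
      (TensorProduct.isBaseChange _ _ _)
  obtain ⟨f, hf⟩ := exists_generic_free P N (P.asIdeal.ResidueField ⊗[R ⧸ P.asIdeal] N)
    (TensorProduct.mk (R ⧸ P.asIdeal) P.asIdeal.ResidueField N 1)
  exact ⟨_, f, hf⟩

theorem exists_generic_free_pushforward {p : ℕ} [Fact p.Prime] [CharP R p] (hF : IsFFinite p R)
    (P : PrimeSpectrum R) :
    ∃ f : (Fin (p ^ alpha p P) → R ⧸ P.asIdeal) →ₗ[R] FrobeniusPushforward p 1 (R ⧸ P.asIdeal),
      Function.Injective f ∧ ∀ Q ∈ Module.support R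
        (FrobeniusPushforward p 1 (R ⧸ P.asIdeal) ⧸ LinearMap.range f), P < Q := by
  have := charP_of_algebra p R (R ⧸ P.asIdeal)
  have := charP_residueField (p := p) P.asIdeal
  have := isFFinite_iff.1 (isFFinite_quotient hF P.asIdeal)
  have h := exists_generic_free P (FrobeniusPushforward p 1 (R ⧸ P.asIdeal))
    (FrobeniusPushforward p 1 P.asIdeal.ResidueField)
    (FrobeniusPushforward.map p 1 (Algebra.linearMap (R ⧸ P.asIdeal) P.asIdeal.ResidueField))
  rw [finrank_pushforward_eq, ← pow_alpha hF] at h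
  exact h

end GenericFreeness

/-! ### Growth of Euler characteristics under Frobenius. -/

section Growth

theorem le_geometric_of_le {a : ℕ → ℝ} {r C : ℝ} {b : ℝ} (hr : 0 < r) (hb : 2 ≤ b) (hC : 0 ≤ C)
    (h : ∀ e, a (e + 1) ≤ r * a e + C * (r / b) ^ e) (e : ℕ) :
    a e ≤ (a 0 + 2 * C / r) * r ^ e := by
  -- After division by r^{e+1} the increments are at most (C/r) 2^{-e}; the factor 1 − (1/2)^e
  -- records the partial sums of this geometric series and makes the induction close.
  have key : ∀ e, a e ≤ (a 0 + 2 * C / r * (1 - (1 / 2) ^ e)) * r ^ e := by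
    intro e
    induction e with
    | zero => simp
    | succ e ih =>
      have h1 : (r / b) ^ e ≤ (1 / 2) ^ e * r ^ e := by
        rw [← mul_pow]
        refine pow_le_pow_left₀ (by positivity) ?_ e
        rw [div_le_iff₀ (by linarith)]
        nlinarith
      calc a (e + 1) ≤ r * a e + C * (r / b) ^ e := h e
        _ ≤ r * ((a 0 + 2 * C / r * (1 - (1 / 2) ^ e)) * r ^ e) + C * ((1 / 2) ^ e * r ^ e) := by
          gcongr
        _ = _ := by
          rw [pow_succ, pow_succ]
          field_simp
          ring
  refine (key e).trans ?_
  have h2 : 2 * C / r * (1 - (1 / 2) ^ e) ≤ 2 * C / r := by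
    have : (0 : ℝ) ≤ (1 / 2) ^ e := by positivity
    have : 0 ≤ 2 * C / r := by positivity
    nlinarith
  gcongr

variable (p : ℕ) [Fact p.Prime] (R : Type u) [CommRing R] [CharP R p]
  (κ : Type u) [Field κ] [Algebra R κ]

/-- The Euler characteristic of `F^e_* N`. -/
noncomputable def frobChi (i e : ℕ) (N : Type u) [AddCommGroup N] [Module R N] : ℤ :=
  chi R κ i (FrobeniusPushforward p e N)

variable {p R}
  {N N' N'' : Type u} [AddCommGroup N] [Module R N] [AddCommGroup N'] [Module R N']
  [AddCommGroup N''] [Module R N''] [Module.Finite R N]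

theorem frobChi_zero_le (hF : IsFFinite p R) [Module.Finite R N'']
    (e : ℕ) (g : N →ₗ[R] N'') (hg : Function.Surjective g) :
    frobChi p R κ 0 e N'' ≤ frobChi p R κ 0 e N := by
  have := hF.finite_pushforward e N
  have := hF.finite_pushforward e N''
  exact Nat.cast_le.2 (fiberRank_le_of_surjective κ (FrobeniusPushforward.map p e g)
    (FrobeniusPushforward.map_surjective hg))

variable [IsNoetherianRing R]

theorem frobChi_congr (hF : IsFFinite p R) (i e : ℕ) (f : N ≃ₗ[R] N') :
    frobChi p R κ i e N = frobChi p R κ i e N' := by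
  have := hF.finite_pushforward e N
  exact chi_congr κ i (FrobeniusPushforward.mapEquiv p e f)

theorem frobChi_pushforward (hF : IsFFinite p R) (i e e' : ℕ) :
    frobChi p R κ i e (FrobeniusPushforward p e' N) = frobChi p R κ i (e + e') N := by
  have := hF.finite_pushforward e' N
  have := hF.finite_pushforward e (FrobeniusPushforward p e' N)
  exact chi_congr κ i (FrobeniusPushforward.compEquiv R p e e' N)

theorem frobChi_pi (hF : IsFFinite p R) (i e n : ℕ) :
    frobChi p R κ i e (Fin n → N) = n * frobChi p R κ i e N := by
  have := hF.finite_pushforward e N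
  have := hF.finite_pushforward e (Fin n → N)
  rw [frobChi, chi_congr κ i (FrobeniusPushforward.piEquiv R p e (Fin n) N), chi_pi_const]
  rfl

/-- Upper bounds in all degrees suffice: χ_{i+1} ≥ −χ_i supplies the lower bound, and χ_0 is
nonnegative. -/
theorem abs_frobChi_le_of_le (hF : IsFFinite p R) {ρ : ℝ} (hρ : 0 ≤ ρ)
    (h : ∀ i, ∃ C : ℝ, ∀ e, (frobChi p R κ i e N : ℝ) ≤ C * ρ ^ e)
    (i : ℕ) : ∃ C : ℝ, ∀ e, |(frobChi p R κ i e N : ℝ)| ≤ C * ρ ^ e := by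
  cases i with
  | zero =>
    obtain ⟨C, hC⟩ := h 0
    refine ⟨C, fun e => ?_⟩
    rw [abs_of_nonneg]
    · exact hC e
    · have : 0 ≤ frobChi p R κ 0 e N := Nat.cast_nonneg _
      exact_mod_cast this
  | succ i =>
    obtain ⟨C, hC⟩ := h i
    obtain ⟨C', hC'⟩ := h (i + 1)
    refine ⟨max C C', fun e => ?_⟩
    have := hF.finite_pushforward e N
    have h0 : 0 ≤ frobChi p R κ (i + 1) e N + frobChi p R κ i e N := chi_succ_add_chi_nonneg κ i
    have h1 : (0 : ℝ) ≤ frobChi p R κ (i + 1) e N + frobChi p R κ i e N := by exact_mod_cast h0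
    rw [abs_le]
    have h3 : C * ρ ^ e ≤ max C C' * ρ ^ e := by gcongr; exact le_max_left _ _
    have h4 : C' * ρ ^ e ≤ max C C' * ρ ^ e := by gcongr; exact le_max_right _ _
    constructor
    · linarith [hC e]
    · exact (hC' e).trans h4

variable [Module.Finite R N']

theorem frobChi_prod (hF : IsFFinite p R) (i e : ℕ) :
    frobChi p R κ i e (N × N') = frobChi p R κ i e N + frobChi p R κ i e N' := by
  have := hF.finite_pushforward e N
  have := hF.finite_pushforward e N'
  have := hF.finite_pushforward e (N × N')
  rw [frobChi, chi_congr κ i (FrobeniusPushforward.prodEquiv R p e N N'), chi_prod]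
  rfl

variable [Module.Finite R N'']

theorem frobChi_le_add (hF : IsFFinite p R) (i e : ℕ) (f : N' →ₗ[R] N) (g : N →ₗ[R] N'')
    (hf : Function.Injective f)
    (hg : Function.Surjective g) (h : Function.Exact f g) :
    frobChi p R κ i e N ≤ frobChi p R κ i e N' + frobChi p R κ i e N'' := by
  have := hF.finite_pushforward e N
  have := hF.finite_pushforward e N'
  have := hF.finite_pushforward e N''
  exact chi_le_add_of_exact κ i (FrobeniusPushforward.map p e f) (FrobeniusPushforward.map p e g)
    (FrobeniusPushforward.map_injective hf) (FrobeniusPushforward.map_surjective hg)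
    (FrobeniusPushforward.map_exact h)

theorem frobChi_left_le (hF : IsFFinite p R) (i e : ℕ) (f : N' →ₗ[R] N) (g : N →ₗ[R] N'')
    (hf : Function.Injective f) (hg : Function.Surjective g) (h : Function.Exact f g) :
    frobChi p R κ i e N' ≤ frobChi p R κ i e N + frobChi p R κ (i + 1) e N'' := by
  have := hF.finite_pushforward e N
  have := hF.finite_pushforward e N'
  have := hF.finite_pushforward e N''
  exact chi_left_le_of_exact κ i (FrobeniusPushforward.map p e f)
    (FrobeniusPushforward.map p e g) (FrobeniusPushforward.map_injective hf)
    (FrobeniusPushforward.map_surjective hg) (FrobeniusPushforward.map_exact h)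

theorem frobChi_right_le (hF : IsFFinite p R) (i e : ℕ) (f : N' →ₗ[R] N) (g : N →ₗ[R] N'')
    (hf : Function.Injective f) (hg : Function.Surjective g) (h : Function.Exact f g) :
    frobChi p R κ (i + 1) e N'' ≤ frobChi p R κ (i + 1) e N + frobChi p R κ i e N' := by
  have := hF.finite_pushforward e N
  have := hF.finite_pushforward e N'
  have := hF.finite_pushforward e N''
  exact chi_right_le_of_exact κ i (FrobeniusPushforward.map p e f)
    (FrobeniusPushforward.map p e g) (FrobeniusPushforward.map_injective hf)
    (FrobeniusPushforward.map_surjective hg) (FrobeniusPushforward.map_exact h)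

end Growth

end GradedFrobenius

namespace GradedFrobenius

/-! ### Convergence of the normalized Euler characteristics. -/

section Limit

theorem mem_support_quotient_prime {R : Type u} [CommRing R] {P Q : PrimeSpectrum R}
    (h : Q ∈ Module.support R (R ⧸ P.asIdeal)) : P ≤ Q := by
  have h1 := Module.annihilator_le_of_mem_support h
  rwa [Ideal.annihilator_quotient] at h1

theorem self_mem_support_quotient {R : Type u} [CommRing R] (P : PrimeSpectrum R) :
    P ∈ Module.support R (R ⧸ P.asIdeal) := by
  rw [Module.mem_support_iff_of_finite, Ideal.annihilator_quotient]

theorem tendsto_div_of_abs_le {p : ℕ} [Fact p.Prime] {a : ℕ → ℝ} {C : ℝ} {γ : ℕ}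
    (h : ∀ e, |a e| ≤ C * ((p : ℝ) ^ γ / p) ^ e) :
    Tendsto (fun e : ℕ => a e / (p : ℝ) ^ (e * γ)) atTop (𝓝 0) := by
  have hp : (1 : ℝ) < p := by exact_mod_cast (Fact.out : p.Prime).one_lt
  have hlim : Tendsto (fun e : ℕ => C * (1 / (p : ℝ)) ^ e) atTop (𝓝 0) := by
    simpa using (tendsto_pow_atTop_nhds_zero_of_lt_one (r := 1 / (p : ℝ)) (by positivity)
      (by rw [div_lt_one (by linarith)]; exact hp)).const_mul C
  refine squeeze_zero_norm (fun e => ?_) hlim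
  have h0 : (0 : ℝ) < (p : ℝ) ^ (e * γ) := by positivity
  rw [Real.norm_eq_abs, abs_div, abs_of_pos h0, div_le_iff₀ h0]
  refine (h e).trans_eq ?_
  rw [div_pow, one_div, inv_pow, ← pow_mul, mul_comm γ e]
  ring

variable {p : ℕ} [Fact p.Prime] {R : Type u} [CommRing R] [CharP R p]
  (κ : Type u) [Field κ] [Algebra R κ]

/-- The sequence `χ_i(F^e_* N) / p^{eγ}` converges. -/
def FrobChiConverges (p : ℕ) [Fact p.Prime] (R : Type u) [CommRing R] [CharP R p]
    (κ : Type u) [Field κ] [Algebra R κ] (γ i : ℕ) (N : Type u) [AddCommGroup N] [Module R N] :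
    Prop :=
  ∃ c : ℝ, Tendsto (fun e : ℕ => (frobChi p R κ i e N : ℝ) / (p : ℝ) ^ (e * γ)) atTop (𝓝 c)

theorem FrobChiConverges.of_close {γ i : ℕ} {N N' : Type u} [AddCommGroup N] [Module R N]
    [AddCommGroup N'] [Module R N'] (h' : FrobChiConverges p R κ γ i N') {C : ℝ}
    (h : ∀ e, |(frobChi p R κ i e N : ℝ) - frobChi p R κ i e N'| ≤ C * ((p : ℝ) ^ γ / p) ^ e) :
    FrobChiConverges p R κ γ i N := by
  obtain ⟨c, hc⟩ := h'
  refine ⟨c, ?_⟩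
  have := (tendsto_div_of_abs_le h).add hc
  rw [zero_add] at this
  refine this.congr fun e => ?_
  ring

theorem FrobChiConverges.of_abs_le {γ i : ℕ} {N : Type u} [AddCommGroup N] [Module R N] {C : ℝ}
    (h : ∀ e, |(frobChi p R κ i e N : ℝ)| ≤ C * ((p : ℝ) ^ γ / p) ^ e) :
    FrobChiConverges p R κ γ i N := ⟨0, tendsto_div_of_abs_le h⟩

variable [IsNoetherianRing R]

/-- Factor f through its image. The errors in degree i come from the kernel in degrees i and i − 1
and from the cokernel in degrees i and i + 1, which is why the bounds are assumed in all degrees. -/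
theorem frobChi_compare (hF : IsFFinite p R) {N N' : Type u} [AddCommGroup N] [Module R N]
    [AddCommGroup N'] [Module R N'] [Module.Finite R N] [Module.Finite R N'] (f : N →ₗ[R] N')
    {ρ : ℝ} (hρ : 0 ≤ ρ)
    (hK : ∀ i, ∃ C : ℝ, ∀ e, |(frobChi p R κ i e (LinearMap.ker f) : ℝ)| ≤ C * ρ ^ e)
    (hC : ∀ i, ∃ C : ℝ, ∀ e, |(frobChi p R κ i e (N' ⧸ LinearMap.range f) : ℝ)| ≤ C * ρ ^ e)
    (i : ℕ) :
    ∃ C : ℝ, ∀ e, |(frobChi p R κ i e N : ℝ) - frobChi p R κ i e N'| ≤ C * ρ ^ e := by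
  have hsurj := f.surjective_rangeRestrict
  have hex1 : Function.Exact (LinearMap.ker f).subtype f.rangeRestrict := by
    rw [LinearMap.exact_iff, Submodule.range_subtype, LinearMap.ker_rangeRestrict]
  have hex2 := LinearMap.exact_subtype_mkQ (LinearMap.range f)
  obtain ⟨K0, hK0⟩ := hK i
  obtain ⟨C0, hC0⟩ := hC i
  obtain ⟨C1, hC1⟩ := hC (i + 1)
  have hlow : ∃ C : ℝ, ∀ e, (frobChi p R κ i e (LinearMap.range f) : ℝ) ≤
      frobChi p R κ i e N + C * ρ ^ e := by
    cases i with
    | zero =>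
      refine ⟨0, fun e => ?_⟩
      rw [zero_mul, add_zero]
      exact_mod_cast frobChi_zero_le κ hF e f.rangeRestrict hsurj
    | succ i =>
      obtain ⟨K1, hK1⟩ := hK i
      refine ⟨K1, fun e => ?_⟩
      have h : (frobChi p R κ (i + 1) e (LinearMap.range f) : ℝ) ≤
          frobChi p R κ (i + 1) e N + frobChi p R κ i e (LinearMap.ker f) := by
        exact_mod_cast frobChi_right_le κ hF i e _ _ (Submodule.subtype_injective _) hsurj hex1
      linarith [(abs_le.1 (hK1 e)).2]
  obtain ⟨K1, hK1⟩ := hlow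
  refine ⟨max (K0 + C1) (C0 + K1), fun e => ?_⟩
  have h1 : (frobChi p R κ i e N : ℝ) ≤
      frobChi p R κ i e (LinearMap.ker f) + frobChi p R κ i e (LinearMap.range f) := by
    exact_mod_cast frobChi_le_add κ hF i e _ _ (Submodule.subtype_injective _) hsurj hex1
  have h2 : (frobChi p R κ i e (LinearMap.range f) : ℝ) ≤
      frobChi p R κ i e N' + frobChi p R κ (i + 1) e (N' ⧸ LinearMap.range f) := by
    exact_mod_cast frobChi_left_le κ hF i e _ _ (Submodule.subtype_injective _)
      (Submodule.mkQ_surjective _) hex2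
  have h3 : (frobChi p R κ i e N' : ℝ) ≤
      frobChi p R κ i e (LinearMap.range f) + frobChi p R κ i e (N' ⧸ LinearMap.range f) := by
    exact_mod_cast frobChi_le_add κ hF i e _ _ (Submodule.subtype_injective _)
      (Submodule.mkQ_surjective _) hex2
  have h4 : (K0 + C1) * ρ ^ e ≤ max (K0 + C1) (C0 + K1) * ρ ^ e := by
    gcongr; exact le_max_left _ _
  have h5 : (C0 + K1) * ρ ^ e ≤ max (K0 + C1) (C0 + K1) * ρ ^ e := by
    gcongr; exact le_max_right _ _
  rw [abs_le]
  constructor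
  · linarith [hK1 e, (abs_le.1 (hC0 e)).2]
  · linarith [(abs_le.1 (hK0 e)).2, (abs_le.1 (hC1 e)).2]

/-- Induction on g. Subadditivity and a prime filtration reduce to R/P. If α(P) is the largest
permitted value, the generically free submodule of F_*(R/P) gives a linear recursion with factor
p^{α(P)}, whose error is smaller by a factor p^e by induction. The form p^g / p avoids subtraction
in the exponent; for g = 0 the module is zero. -/
theorem abs_frobChi_le (hF : IsFFinite p R) (g : ℕ) (N : Type u) [AddCommGroup N] [Module R N]
    [Module.Finite R N] (hN : ∀ P ∈ Module.support R N, alpha p P < g) (i : ℕ) :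
    ∃ C : ℝ, ∀ e, |(frobChi p R κ i e N : ℝ)| ≤ C * ((p : ℝ) ^ g / p) ^ e := by
  have hp : (2 : ℝ) ≤ p := by exact_mod_cast (Fact.out : p.Prime).two_le
  have hp0 : (0 : ℝ) < p := by linarith
  induction g generalizing N i with
  | zero =>
    have : Subsingleton N := by
      rw [← Module.support_eq_empty_iff (R := R)]
      exact Set.eq_empty_of_forall_notMem fun P hP => Nat.not_lt_zero _ (hN P hP)
    refine ⟨0, fun e => ?_⟩
    rw [frobChi, chi_of_subsingleton]
    simp
  | succ g ih =>
    refine abs_frobChi_le_of_le κ hF (by positivity) ?_ i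
    have hρ : (p : ℝ) ^ (g + 1) / p = (p : ℝ) ^ g := by
      rw [pow_succ]; field_simp
    rw [hρ]
    clear i
    induction ‹Module.Finite R N› using
      IsNoetherianRing.induction_on_isQuotientEquivQuotientPrime R with
    | subsingleton N =>
      refine fun i => ⟨0, fun e => ?_⟩
      rw [frobChi, chi_of_subsingleton]
      simp
    | quotient N P f =>
      intro i
      have hP : alpha p P ≤ g := by
        refine Nat.lt_succ_iff.1 (hN P ?_)
        rw [f.support_eq]
        exact self_mem_support_quotient P
      simp only [fun e => frobChi_congr κ hF i e f]
      rcases hP.lt_or_eq with hlt | rfl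
      · obtain ⟨C, hC⟩ := ih (R ⧸ P.asIdeal) (fun Q hQ =>
          (alpha_le_of_le hF (mem_support_quotient_prime hQ)).trans_lt hlt) i
        have hC0 : 0 ≤ C := by simpa using (abs_nonneg _).trans (hC 0)
        refine ⟨C, fun e => (le_abs_self _).trans ((hC e).trans ?_)⟩
        gcongr
        exact div_le_self (by positivity) (by linarith)
      · obtain ⟨f, hf, hf'⟩ := exists_generic_free_pushforward hF P
        have := hF.finite_pushforward 1 (R ⧸ P.asIdeal)
        obtain ⟨C, hC⟩ := ih _ (fun Q hQ => alpha_lt_of_lt hF (hf' Q hQ)) i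
        have hC0 : 0 ≤ C := by simpa using (abs_nonneg _).trans (hC 0)
        refine ⟨_, le_geometric_of_le (a := fun e => (frobChi p R κ i e (R ⧸ P.asIdeal) : ℝ))
          (by positivity) hp hC0 fun e => ?_⟩
        have h1 := frobChi_le_add κ hF i e f (LinearMap.range f).mkQ hf
          (Submodule.mkQ_surjective _) (LinearMap.exact_map_mkQ_range f)
        rw [frobChi_pushforward κ hF, frobChi_pi κ hF] at h1
        have h2 : (frobChi p R κ i (e + 1) (R ⧸ P.asIdeal) : ℝ) ≤
            (p : ℝ) ^ alpha p P * frobChi p R κ i e (R ⧸ P.asIdeal) +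
              frobChi p R κ i e (FrobeniusPushforward p 1 (R ⧸ P.asIdeal) ⧸ LinearMap.range f) := by
          exact_mod_cast h1
        linarith [(abs_le.1 (hC e)).2]
    | exact N₁ N₂ N₃ f g' hf hg hfg h₁ h₃ =>
      intro i
      obtain ⟨C₁, hC₁⟩ := h₁ (fun P hP => hN P (Module.support_subset_of_injective f hf hP)) i
      obtain ⟨C₃, hC₃⟩ := h₃ (fun P hP => hN P (Module.support_subset_of_surjective g' hg hP)) i
      refine ⟨C₁ + C₃, fun e => ?_⟩
      have h : (frobChi p R κ i e N₂ : ℝ) ≤ frobChi p R κ i e N₁ + frobChi p R κ i e N₃ := by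
        exact_mod_cast frobChi_le_add κ hF i e f g' hf hg hfg
      linarith [hC₁ e, hC₃ e]

theorem abs_frobChi_sub_le (hF : IsFFinite p R) (g : ℕ) {N N' : Type u} [AddCommGroup N]
    [Module R N] [AddCommGroup N'] [Module R N'] [Module.Finite R N] [Module.Finite R N']
    (f : N →ₗ[R] N') (hK : ∀ P ∈ Module.support R (LinearMap.ker f), alpha p P < g)
    (hC : ∀ P ∈ Module.support R (N' ⧸ LinearMap.range f), alpha p P < g) (i : ℕ) :
    ∃ C : ℝ, ∀ e, |(frobChi p R κ i e N : ℝ) - frobChi p R κ i e N'| ≤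
      C * ((p : ℝ) ^ g / p) ^ e :=
  frobChi_compare κ hF f (by positivity) (abs_frobChi_le κ hF g _ hK)
    (abs_frobChi_le κ hF g _ hC) i

/-- If α(P) < γ the limit is 0. If α(P) = γ, comparing F_*(R/P) with (R/P)^{p^γ} bounds consecutive
differences of the normalized sequence by a geometric series. -/
theorem frobChiConverges_quotient_prime (hF : IsFFinite p R) (P : PrimeSpectrum R) {γ : ℕ}
    (hP : alpha p P ≤ γ) (i : ℕ) : FrobChiConverges p R κ γ i (R ⧸ P.asIdeal) := by
  have hp : (2 : ℝ) ≤ p := by exact_mod_cast (Fact.out : p.Prime).two_le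
  have hp0 : (0 : ℝ) < p := by linarith
  rcases hP.lt_or_eq with hlt | rfl
  · obtain ⟨C, hC⟩ := abs_frobChi_le κ hF γ (R ⧸ P.asIdeal) (fun Q hQ =>
      (alpha_le_of_le hF (mem_support_quotient_prime hQ)).trans_lt hlt) i
    exact .of_abs_le κ hC
  · obtain ⟨f, hf, hf'⟩ := exists_generic_free_pushforward hF P
    have := hF.finite_pushforward 1 (R ⧸ P.asIdeal)
    have : Subsingleton (LinearMap.ker f) := by
      rw [LinearMap.ker_eq_bot.2 hf]
      infer_instance
    obtain ⟨C, hC⟩ := abs_frobChi_sub_le κ hF (alpha p P) f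
      (fun Q hQ => by simp [Module.support_eq_empty] at hQ)
      (fun Q hQ => alpha_lt_of_lt hF (hf' Q hQ)) i
    have hC0 : 0 ≤ C := by simpa using (abs_nonneg _).trans (hC 0)
    refine cauchySeq_tendsto_of_complete
      (cauchySeq_of_le_geometric (1 / 2) (C / (p : ℝ) ^ alpha p P) (by norm_num) fun e => ?_)
    have h1 := hC e
    rw [frobChi_pushforward κ hF, frobChi_pi κ hF] at h1
    push_cast at h1
    have hr : (0 : ℝ) < (p : ℝ) ^ alpha p P := by positivity
    have hre : (0 : ℝ) < (p : ℝ) ^ (e * alpha p P) := by positivity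
    rw [Real.dist_eq]
    have h2 : (frobChi p R κ i e (R ⧸ P.asIdeal) : ℝ) / (p : ℝ) ^ (e * alpha p P) -
        frobChi p R κ i (e + 1) (R ⧸ P.asIdeal) / (p : ℝ) ^ ((e + 1) * alpha p P) =
        ((p : ℝ) ^ alpha p P * frobChi p R κ i e (R ⧸ P.asIdeal) -
          frobChi p R κ i (e + 1) (R ⧸ P.asIdeal)) / (p : ℝ) ^ ((e + 1) * alpha p P) := by
      rw [add_mul, one_mul, pow_add]
      field_simp
    rw [h2, abs_div, abs_of_pos (by positivity : (0 : ℝ) < (p : ℝ) ^ ((e + 1) * alpha p P)),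
      div_le_iff₀ (by positivity)]
    refine h1.trans ?_
    have h3 : ((p : ℝ) ^ alpha p P / p) ^ e ≤ (1 / 2) ^ e * (p : ℝ) ^ (e * alpha p P) := by
      rw [mul_comm e, pow_mul, ← mul_pow]
      refine pow_le_pow_left₀ (by positivity) ?_ e
      rw [div_le_iff₀ hp0]
      nlinarith
    calc C * ((p : ℝ) ^ alpha p P / p) ^ e ≤ C * ((1 / 2) ^ e * (p : ℝ) ^ (e * alpha p P)) := by
          gcongr
      _ = _ := by
        rw [add_mul, one_mul, pow_add]
        field_simp

theorem frobChiConverges_of_annihilated (hF : IsFFinite p R) (P : PrimeSpectrum R) {γ : ℕ}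
    (hP : alpha p P ≤ γ) (N : Type u) [AddCommGroup N] [Module R N] [Module.Finite R N]
    (hN : ∀ r ∈ P.asIdeal, ∀ x : N, r • x = 0) (i : ℕ) : FrobChiConverges p R κ γ i N := by
  obtain ⟨n, f, hf, hf'⟩ := exists_generic_free_of_annihilated P N hN
  have : Subsingleton (LinearMap.ker f) := by
    rw [LinearMap.ker_eq_bot.2 hf]
    infer_instance
  obtain ⟨C, hC⟩ := abs_frobChi_sub_le κ hF γ f
    (fun Q hQ => by simp [Module.support_eq_empty] at hQ)
    (fun Q hQ => (alpha_lt_of_lt hF (hf' Q hQ)).trans_le hP) i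
  refine FrobChiConverges.of_close κ (N' := Fin n → R ⧸ P.asIdeal) ?_
    (fun e => by rw [abs_sub_comm]; exact hC e)
  obtain ⟨c, hc⟩ := frobChiConverges_quotient_prime κ hF P hP i
  refine ⟨n * c, (hc.const_mul (n : ℝ)).congr fun e => ?_⟩
  rw [frobChi_pi κ hF]
  push_cast
  ring

/-- With I = P and J the product of the remaining primes, IJ kills N, and N → N/IN × N/JN has kernel
and cokernel killed by I + J. A prime containing I + J contains two distinct members of s, so it
strictly contains one of them and has α < γ. The kernel and cokernel are therefore negligible. -/
theorem frobChiConverges_of_prod_annihilated (hF : IsFFinite p R) (s : Finset (PrimeSpectrum R))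
    {γ : ℕ} (hs : ∀ P ∈ s, alpha p P ≤ γ) (N : Type u) [AddCommGroup N] [Module R N]
    [Module.Finite R N] (hN : ∀ r ∈ ∏ P ∈ s, P.asIdeal, ∀ x : N, r • x = 0) (i : ℕ) :
    FrobChiConverges p R κ γ i N := by
  classical
  induction s using Finset.induction_on generalizing N with
  | empty =>
    have : Subsingleton N := ⟨fun x y => by
      rw [← one_smul R x, ← one_smul R y, hN 1 (by simp), hN 1 (by simp)]⟩
    refine .of_abs_le κ (C := 0) fun e => ?_
    rw [frobChi, chi_of_subsingleton]
    simp
  | insert P s hPs ih =>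
    rw [Finset.prod_insert hPs] at hN
    let I := P.asIdeal
    let J := ∏ P ∈ s, P.asIdeal
    have hkill : ∀ r ∈ J, ∀ x ∈ I • (⊤ : Submodule R N), r • x = 0 := by
      intro r hr x hx
      refine Submodule.smul_induction_on hx (fun a ha y _ => ?_) (fun a b ha hb => ?_)
      · rw [smul_smul, mul_comm]
        exact hN _ (Ideal.mul_mem_mul ha hr) y
      · rw [smul_add, ha, hb, add_zero]
    have hkill' : ∀ r ∈ I, ∀ x ∈ J • (⊤ : Submodule R N), r • x = 0 := by
      intro r hr x hx
      refine Submodule.smul_induction_on hx (fun a ha y _ => ?_) (fun a b ha hb => ?_)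
      · rw [smul_smul]
        exact hN _ (Ideal.mul_mem_mul hr ha) y
      · rw [smul_add, ha, hb, add_zero]
    have hquot : ∀ (T : Ideal R) (r : R), r ∈ T →
        ∀ x : N ⧸ (T • (⊤ : Submodule R N)), r • x = 0 := by
      intro T r hr x
      obtain ⟨x, rfl⟩ := Submodule.mkQ_surjective _ x
      rw [← map_smul, Submodule.mkQ_apply, Submodule.Quotient.mk_eq_zero]
      exact Submodule.smul_mem_smul hr trivial
    let f : N →ₗ[R] (N ⧸ (I • (⊤ : Submodule R N))) × (N ⧸ (J • (⊤ : Submodule R N))) :=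
      LinearMap.prod (Submodule.mkQ _) (Submodule.mkQ _)
    have hfker : ∀ x, x ∈ LinearMap.ker f ↔
        x ∈ I • (⊤ : Submodule R N) ∧ x ∈ J • (⊤ : Submodule R N) := by
      intro x
      rw [LinearMap.ker_prod, Submodule.mem_inf, Submodule.ker_mkQ, Submodule.ker_mkQ]
    have hker : ∀ r ∈ I ⊔ J, ∀ x : LinearMap.ker f, r • x = 0 := by
      intro r hr x
      obtain ⟨a, ha, b, hb, rfl⟩ := Submodule.mem_sup.1 hr
      obtain ⟨h1, h2⟩ := (hfker x).1 x.2
      ext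
      simp [add_smul, hkill' a ha x h2, hkill b hb x h1]
    have hcoker : ∀ r ∈ I ⊔ J, ∀ x : _ ⧸ LinearMap.range f, r • x = 0 := by
      intro r hr x
      obtain ⟨x, rfl⟩ := Submodule.mkQ_surjective _ x
      rw [← map_smul, Submodule.mkQ_apply, Submodule.Quotient.mk_eq_zero]
      obtain ⟨a, ha, b, hb, rfl⟩ := Submodule.mem_sup.1 hr
      obtain ⟨x, y⟩ := x
      obtain ⟨x, rfl⟩ := Submodule.mkQ_surjective _ x
      obtain ⟨y, rfl⟩ := Submodule.mkQ_surjective _ y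
      -- Modulo IN both a y + b x and (a + b) x reduce to b x; modulo JN both a y + b x and (a + b)
      -- y reduce to a y.
      refine ⟨a • y + b • x, ?_⟩
      have e1 := hquot I a ha (Submodule.mkQ _ y)
      have e2 := hquot J b hb (Submodule.mkQ _ x)
      have e3 := hquot I a ha (Submodule.mkQ _ x)
      have e4 := hquot J b hb (Submodule.mkQ _ y)
      refine Prod.ext ?_ ?_
      · change Submodule.mkQ _ (a • y + b • x) = (a + b) • Submodule.mkQ _ x
        rw [map_add, map_smul, map_smul, e1, add_smul, e3]
      · change Submodule.mkQ _ (a • y + b • x) = (a + b) • Submodule.mkQ _ y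
        rw [map_add, map_smul, map_smul, e2, add_smul, e4, add_zero]
    have hsupp : ∀ Q : PrimeSpectrum R, I ⊔ J ≤ Q.asIdeal → alpha p Q < γ := by
      intro Q hQ
      obtain ⟨P', hP', hP'Q⟩ := (Ideal.IsPrime.prod_le Q.2).1 (le_sup_right.trans hQ)
      have hPQ : P ≤ Q := le_sup_left.trans hQ
      rcases hPQ.lt_or_eq with h | rfl
      · exact (alpha_lt_of_lt hF h).trans_le (hs P (Finset.mem_insert_self _ _))
      · have h : P' < P := lt_of_le_of_ne hP'Q (fun h => hPs (h ▸ hP'))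
        exact (alpha_lt_of_lt hF h).trans_le (hs P' (Finset.mem_insert_of_mem hP'))
    obtain ⟨C, hC⟩ := abs_frobChi_sub_le κ hF γ f
      (fun Q hQ => hsupp Q ((show I ⊔ J ≤ _ from fun r hr =>
        Module.mem_annihilator.2 (hker r hr)).trans (Module.annihilator_le_of_mem_support hQ)))
      (fun Q hQ => hsupp Q ((show I ⊔ J ≤ _ from fun r hr =>
        Module.mem_annihilator.2 (hcoker r hr)).trans (Module.annihilator_le_of_mem_support hQ))) i
    refine FrobChiConverges.of_close κ ?_ hC
    obtain ⟨c, hc⟩ := frobChiConverges_of_annihilated κ hF P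
      (hs P (Finset.mem_insert_self _ _)) (N ⧸ (I • (⊤ : Submodule R N))) (hquot I) i
    obtain ⟨c', hc'⟩ := ih (fun P' hP' => hs P' (Finset.mem_insert_of_mem hP'))
      (N ⧸ (J • (⊤ : Submodule R N))) (hquot J)
    refine ⟨c + c', (hc.add hc').congr fun e => ?_⟩
    rw [frobChi_prod κ hF]
    push_cast
    ring

/-- Replacing N by F^n_* N only shifts the sequence. For n large the radical of the annihilator
kills F^n_* N, since r acts there as r^{p^n}; the product of the minimal primes lies in that
radical. -/
theorem frobChiConverges (hF : IsFFinite p R) (N : Type u) [AddCommGroup N] [Module R N]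
    [Module.Finite R N] {γ : ℕ} (hγ : ∀ P ∈ Module.support R N, alpha p P ≤ γ) (i : ℕ) :
    FrobChiConverges p R κ γ i N := by
  classical
  have hp : 1 < p := (Fact.out : p.Prime).one_lt
  let I := Module.annihilator R N
  have hfin : {P : PrimeSpectrum R | P.asIdeal ∈ I.minimalPrimes}.Finite :=
    (I.finite_minimalPrimes_of_isNoetherianRing R).preimage
      (fun _ _ _ _ h => PrimeSpectrum.ext h)
  let s := hfin.toFinset
  have hs : ∏ P ∈ s, P.asIdeal ≤ I.radical := by
    rw [← Ideal.sInf_minimalPrimes]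
    refine le_sInf fun J hJ => ?_
    exact Ideal.prod_le_inf.trans (Finset.inf_le
      (f := fun P : PrimeSpectrum R => P.asIdeal) (b := ⟨J, hJ.1.1⟩) (by simpa [s] using hJ))
  obtain ⟨n, hn⟩ := I.exists_radical_pow_le_of_fg (IsNoetherian.noetherian _)
  have hn' : n ≤ p ^ n := (Nat.lt_pow_self hp).le
  have := hF.finite_pushforward n N
  obtain ⟨c, hc⟩ := frobChiConverges_of_prod_annihilated κ hF s (γ := γ) (fun P hP => hγ P (by
      rw [Module.mem_support_iff_of_finite]
      have : P.asIdeal ∈ I.minimalPrimes := by simpa [s] using hP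
      exact this.1.2)) (FrobeniusPushforward p n N) (fun r hr x => by
      obtain ⟨x, rfl⟩ := (FrobeniusPushforward.of p n N).surjective x
      rw [FrobeniusPushforward.smul_of]
      have h1 : r ^ p ^ n ∈ I :=
        hn (Ideal.pow_le_pow_right hn' (Ideal.pow_mem_pow (hs hr) _))
      rw [Module.mem_annihilator.1 h1, map_zero]) i
  refine ⟨c / (p : ℝ) ^ (n * γ), (tendsto_add_atTop_iff_nat n).1 ?_⟩
  refine (hc.div_const ((p : ℝ) ^ (n * γ))).congr fun e => ?_
  rw [frobChi_pushforward κ hF, div_div, ← pow_add, ← add_mul]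

end Limit

end GradedFrobenius

namespace GradedFrobenius

open TensorProduct

/-! ### The Forster–Swan bound. -/

section ForsterSwan

variable {R : Type u} [CommRing R]

theorem fiberRank_residueField_eq_zero_iff (N : Type u) [AddCommGroup N] [Module R N]
    [Module.Finite R N] (P : PrimeSpectrum R) :
    fiberRank R P.asIdeal.ResidueField N = 0 ↔ P ∉ Module.support R N := by
  rw [Module.mem_support_iff_nontrivial_residueField_tensorProduct, not_nontrivial_iff_subsingleton,
    fiberRank, Module.finrank_zero_iff]

theorem span_range_tmul_one (κ : Type u) [Field κ] [Algebra R κ] (N : Type u) [AddCommGroup N]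
    [Module R N] : Submodule.span κ (Set.range (TensorProduct.mk R κ N 1)) = ⊤ := by
  have := Submodule.baseChange_span κ (Set.univ : Set N) (R := R)
  rw [Submodule.span_univ, Submodule.baseChange_top, Set.image_univ] at this
  exact this.symm

/-- Nakayama's lemma at Q: a basis of the fibre is chosen among the images of S. The freedom in S is
used later to take homogeneous generators. -/
theorem exists_notMem_support_quotient_span (N : Type u) [AddCommGroup N] [Module R N]
    [Module.Finite R N] (Q : PrimeSpectrum R) {S : Set N} (hS : Submodule.span R S = ⊤) :
    ∃ x : Fin (fiberRank R Q.asIdeal.ResidueField N) → N, (∀ i, x i ∈ S) ∧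
      Q ∉ Module.support R (N ⧸ Submodule.span R (Set.range x)) := by
  let κ := Q.asIdeal.ResidueField
  have hspan : Submodule.span κ (TensorProduct.mk R κ N 1 '' S) = ⊤ := by
    rw [← Submodule.baseChange_span, hS, Submodule.baseChange_top]
  have hcard : Module.finrank κ (Submodule.span κ (TensorProduct.mk R κ N 1 '' S)) =
      fiberRank R Q.asIdeal.ResidueField N := by
    rw [hspan, finrank_top]
    rfl
  rw [← hcard]
  obtain ⟨f, hf, hfs, -⟩ := Submodule.exists_fun_fin_finrank_span_eq κ
    (TensorProduct.mk R κ N 1 '' S)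
  replace hfs := hfs.trans hspan
  choose x hxS hx using hf
  refine ⟨x, hxS, ?_⟩
  rw [← fiberRank_residueField_eq_zero_iff, fiberRank, Module.finrank_zero_iff,
    ← not_nontrivial_iff_subsingleton]
  intro h
  let g := (Submodule.mkQ (Submodule.span R (Set.range x))).baseChange κ
  have hg : Function.Surjective g := LinearMap.lTensor_surjective κ (Submodule.mkQ_surjective _)
  have hle : (⊤ : Submodule κ (κ ⊗[R] N)) ≤ LinearMap.ker g := by
    rw [← hfs, Submodule.span_le]
    rintro _ ⟨i, rfl⟩
    rw [← hx i, SetLike.mem_coe, LinearMap.mem_ker]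
    change g ((1 : κ) ⊗ₜ x i) = 0
    rw [LinearMap.baseChange_tmul, Submodule.mkQ_apply, (Submodule.Quotient.mk_eq_zero _).2
      (Submodule.subset_span (Set.mem_range_self i)), TensorProduct.tmul_zero]
  obtain ⟨y, hy⟩ := exists_ne (0 : κ ⊗[R] (N ⧸ Submodule.span R (Set.range x)))
  obtain ⟨z, rfl⟩ := hg y
  exact hy (hle Submodule.mem_top)

/-- The fibre dimension is upper semicontinuous. -/
theorem exists_fiberRank_le (N : Type u) [AddCommGroup N] [Module R N] [Module.Finite R N]
    (Q : PrimeSpectrum R) : ∃ s ∉ Q.asIdeal, ∀ P : PrimeSpectrum R, s ∉ P.asIdeal →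
      fiberRank R P.asIdeal.ResidueField N ≤ fiberRank R Q.asIdeal.ResidueField N := by
  obtain ⟨x, -, hQ⟩ := exists_notMem_support_quotient_span N Q (Submodule.span_univ (R := R))
  let N' := N ⧸ Submodule.span R (Set.range x)
  rw [Module.support_eq_zeroLocus, PrimeSpectrum.mem_zeroLocus, Set.not_subset] at hQ
  obtain ⟨s, hs, hsQ⟩ := hQ
  have := (algebraMap R Q.asIdeal.ResidueField).domain_nontrivial
  refine ⟨s, hsQ, fun P hsP => ?_⟩
  have hP : P ∉ Module.support R N' := by
    rw [Module.support_eq_zeroLocus, PrimeSpectrum.mem_zeroLocus]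
    exact fun h => hsP (h hs)
  have hex : Function.Exact (Fintype.linearCombination R x)
      (Submodule.mkQ (Submodule.span R (Set.range x))) := by
    rw [LinearMap.exact_iff, Submodule.ker_mkQ, Fintype.range_linearCombination]
  have h1 := fiberRank_le_add_of_exact P.asIdeal.ResidueField _ _ (Submodule.mkQ_surjective _) hex
  rw [(fiberRank_residueField_eq_zero_iff N' P).2 hP, fiberRank_free _ (Fin _ → R),
    Module.finrank_fin_fun] at h1
  exact h1

/-- By semicontinuity the locus is closed, and a closed subset of a Noetherian spectrum has finitely
many minimal points. -/
theorem finite_setOf_minimal_fiberRank [IsNoetherianRing R] (N : Type u) [AddCommGroup N]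
    [Module R N] [Module.Finite R N] (j : ℕ) :
    {P : PrimeSpectrum R | Minimal (fun Q : PrimeSpectrum R =>
      j ≤ fiberRank R Q.asIdeal.ResidueField N) P}.Finite := by
  have hclosed : IsClosed {P : PrimeSpectrum R | j ≤ fiberRank R P.asIdeal.ResidueField N} := by
    rw [← isOpen_compl_iff, isOpen_iff_forall_mem_open]
    intro Q hQ
    obtain ⟨s, hsQ, hs⟩ := exists_fiberRank_le N Q
    exact ⟨PrimeSpectrum.basicOpen s, fun P hP => fun hj => hQ (hj.trans (hs P hP)),
      PrimeSpectrum.isOpen_basicOpen, hsQ⟩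
  obtain ⟨I, hI⟩ := (PrimeSpectrum.isClosed_iff_zeroLocus_ideal _).1 hclosed
  refine Set.Finite.of_finite_image (f := PrimeSpectrum.asIdeal)
    ((Ideal.finite_minimalPrimes_of_isNoetherianRing R I).subset ?_)
    (fun _ _ _ _ h => PrimeSpectrum.ext h)
  have key : ∀ P : PrimeSpectrum R, j ≤ fiberRank R P.asIdeal.ResidueField N ↔ I ≤ P.asIdeal :=
    fun P => Set.ext_iff.1 hI P
  rintro _ ⟨P, hP, rfl⟩
  refine ⟨⟨P.2, (key P).1 hP.1⟩, fun J hJ hJP => ?_⟩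
  exact hP.2 ((key ⟨J, hJ.1⟩).2 hJ.2) hJP

/-- Prime avoidance for modules: remove a minimal member P of B and choose x for the others. If x
vanishes in the fibre at P, add a y with a in all the other primes but not in P; such an a exists
because P is minimal. -/
theorem exists_tmul_ne_zero (N : Type u) [AddCommGroup N] [Module R N]
    [Module.Finite R N] (B : Finset (PrimeSpectrum R)) :
    (∀ P ∈ B, P ∈ Module.support R N) →
      ∃ x : N, ∀ P ∈ B, (1 : P.asIdeal.ResidueField) ⊗ₜ[R] x ≠ 0 := by
  classical
  induction B using Finset.strongInduction with
  | H B ih =>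
    intro hB
    rcases B.eq_empty_or_nonempty with rfl | hne
    · exact ⟨0, by simp⟩
    obtain ⟨P, hP⟩ := B.exists_minimal hne
    obtain ⟨x, hx⟩ := ih (B.erase P) (Finset.erase_ssubset hP.1)
      fun Q hQ => hB Q (Finset.mem_of_mem_erase hQ)
    by_cases hxP : (1 : P.asIdeal.ResidueField) ⊗ₜ[R] x = 0
    · obtain ⟨y, hy⟩ : ∃ y : N, (1 : P.asIdeal.ResidueField) ⊗ₜ[R] y ≠ 0 := by
        by_contra! h
        have := (Module.mem_support_iff_nontrivial_residueField_tensorProduct P).1 (hB P hP.1)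
        refine bot_ne_top (α := Submodule P.asIdeal.ResidueField (P.asIdeal.ResidueField ⊗[R] N)) ?_
        rw [← span_range_tmul_one, eq_comm, Submodule.span_eq_bot]
        rintro _ ⟨y, rfl⟩
        exact h y
      obtain ⟨a, ha, haP⟩ : ∃ a ∈ ∏ Q ∈ B.erase P, Q.asIdeal, a ∉ P.asIdeal := by
        by_contra! h
        obtain ⟨Q, hQ, hQP⟩ := (Ideal.IsPrime.prod_le P.2).1 h
        exact (Finset.mem_erase.1 hQ).1
          (le_antisymm hQP (hP.2 (Finset.mem_of_mem_erase hQ) hQP))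
      refine ⟨x + a • y, fun Q hQ => ?_⟩
      have key : (1 : Q.asIdeal.ResidueField) ⊗ₜ[R] (a • y) =
          algebraMap R Q.asIdeal.ResidueField a • (1 : Q.asIdeal.ResidueField) ⊗ₜ[R] y := by
        rw [TensorProduct.tmul_smul, algebraMap_smul]
      rw [TensorProduct.tmul_add, key]
      by_cases hQP : Q = P
      · subst hQP
        rw [hxP, zero_add]
        exact smul_ne_zero (by rwa [ne_eq, Ideal.algebraMap_residueField_eq_zero]) hy
      · have hQ' : Q ∈ B.erase P := Finset.mem_erase.2 ⟨hQP, hQ⟩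
        have : a ∈ Q.asIdeal := Ideal.le_of_dvd (Finset.dvd_prod_of_mem _ hQ') ha
        rw [Ideal.algebraMap_residueField_eq_zero.2 this, zero_smul, add_zero]
        exact hx Q hQ'
    · refine ⟨x, fun Q hQ => ?_⟩
      by_cases hQP : Q = P
      · subst hQP
        exact hxP
      · exact hx Q (Finset.mem_erase.2 ⟨hQP, hQ⟩)

theorem fiberRank_quotient_span_singleton_lt (κ : Type u) [Field κ] [Algebra R κ] {N : Type u}
    [AddCommGroup N] [Module R N] [Module.Finite R N] {x : N} (hx : (1 : κ) ⊗ₜ[R] x ≠ 0) :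
    fiberRank R κ (N ⧸ Submodule.span R {x}) < fiberRank R κ N := by
  let g := (Submodule.mkQ (Submodule.span R {x})).baseChange κ
  have hg : Function.Surjective g := LinearMap.lTensor_surjective κ (Submodule.mkQ_surjective _)
  have h1 := g.finrank_range_add_finrank_ker
  rw [LinearMap.range_eq_top.2 hg, finrank_top] at h1
  have hmem : (1 : κ) ⊗ₜ[R] x ∈ LinearMap.ker g := by
    rw [LinearMap.mem_ker, LinearMap.baseChange_tmul, Submodule.mkQ_apply,
      (Submodule.Quotient.mk_eq_zero _).2 (Submodule.mem_span_singleton_self x),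
      TensorProduct.tmul_zero]
  have : Module.finrank κ (LinearMap.ker g) ≠ 0 := fun h0 =>
    hx ((Submodule.mem_bot κ).1 (Submodule.finrank_eq_zero.1 h0 ▸ hmem))
  unfold fiberRank
  omega

/-- A form of the Forster–Swan theorem: `h` plays the role of the dimension of `R ⧸ P`. -/
theorem exists_span_of_fiberRank_add_le [IsNoetherianRing R] {h : PrimeSpectrum R → ℕ}
    (hh : StrictAnti h) (n : ℕ) (N : Type u) [AddCommGroup N] [Module R N] [Module.Finite R N]
    (hN : ∀ P ∈ Module.support R N, fiberRank R P.asIdeal.ResidueField N + h P ≤ n) :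
    ∃ x : Fin n → N, Submodule.span R (Set.range x) = ⊤ := by
  induction n generalizing N with
  | zero =>
    have : Subsingleton N := by
      rw [← Module.support_eq_empty_iff (R := R), Set.eq_empty_iff_forall_notMem]
      intro P hP
      have := hN P hP
      exact (fiberRank_residueField_eq_zero_iff N P).1 (by omega) hP
    exact ⟨fun _ => 0, Subsingleton.elim _ _⟩
  | succ n ih =>
    -- Primes attaining the bound are minimal in a locus of constant lower bound on the fibre
    -- dimension: a strictly smaller prime of that locus has larger h and would exceed n + 1. Hence
    -- they are finite in number, and one element nonzero in all their fibres can be divided out.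
    have hfin : {P ∈ Module.support R N |
        fiberRank R P.asIdeal.ResidueField N + h P = n + 1}.Finite := by
      refine (Set.Finite.biUnion (Set.finite_Iic (n + 1))
        fun j _ => finite_setOf_minimal_fiberRank N j).subset ?_
      rintro P ⟨hP, hPn⟩
      simp only [Set.mem_iUnion]
      refine ⟨_, Set.mem_Iic.2 (by omega : fiberRank R P.asIdeal.ResidueField N ≤ n + 1), le_rfl,
        fun Q hQ hQP => ?_⟩
      by_contra hPQ
      have hlt := hh (lt_of_le_not_ge hQP hPQ)
      have hQN : Q ∈ Module.support R N := by
        by_contra hQN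
        rw [← fiberRank_residueField_eq_zero_iff] at hQN
        refine (fiberRank_residueField_eq_zero_iff N P).1 (by omega) hP
      have := hN Q hQN
      omega
    obtain ⟨x, hx⟩ := exists_tmul_ne_zero N hfin.toFinset fun P hP => (hfin.mem_toFinset.1 hP).1
    obtain ⟨y, hy⟩ := ih (N ⧸ Submodule.span R {x}) fun P hP => by
      have hPN := Module.support_subset_of_surjective _
        (Submodule.mkQ_surjective (Submodule.span R {x})) hP
      by_cases hPn : fiberRank R P.asIdeal.ResidueField N + h P = n + 1
      · have := fiberRank_quotient_span_singleton_lt _ (hx P (hfin.mem_toFinset.2 ⟨hPN, hPn⟩))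
        omega
      · have := fiberRank_le_of_surjective P.asIdeal.ResidueField _
          (Submodule.mkQ_surjective (Submodule.span R {x}))
        have := hN P hPN
        omega
    choose z hz using fun i => Submodule.mkQ_surjective (Submodule.span R {x}) (y i)
    refine ⟨Fin.cons x z, ?_⟩
    have hmap :
        (Submodule.span R (Set.range z)).map (Submodule.mkQ (Submodule.span R {x})) = ⊤ := by
      rw [Submodule.map_span, ← Set.range_comp, ← hy]
      congr 2
      exact funext hz
    rw [Fin.range_cons, Submodule.span_insert]
    exact (Submodule.map_mkQ_eq_top _ _).1 hmap

theorem mu_le_of_fiberRank_add_le [IsNoetherianRing R] {h : PrimeSpectrum R → ℕ}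
    (hh : StrictAnti h) {n : ℕ} (N : Type u) [AddCommGroup N] [Module R N] [Module.Finite R N]
    (hN : ∀ P, fiberRank R P.asIdeal.ResidueField N + h P ≤ n) : mu R N ≤ n := by
  obtain ⟨x, hx⟩ := exists_span_of_fiberRank_add_le hh n N fun P _ => hN P
  exact mu_le_of_span x hx

end ForsterSwan

end GradedFrobenius

namespace GradedFrobenius

open TensorProduct

/-! ### Graded modules, graded syzygies and the comparison of fibres. -/

section Grading

variable {R : Type u} [CommRing R]

/-- The additive endomorphisms `π k` are the projections of a `ℤ`-grading of the module `N`
compatible with the grading of `R` whose projections are `ρ k`. -/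
structure IsGrading (ρ : ℤ → R →+ R) {N : Type*} [AddCommGroup N] [Module R N]
    (π : ℤ → N →+ N) : Prop where
  exists_sum : ∀ x, ∃ s : Finset ℤ, ∑ k ∈ s, π k x = x
  proj_proj : ∀ {j k} x, j ≠ k → π j (π k x) = 0
  proj_smul : ∀ j k r x, π (j + k) (ρ j r • x) = ρ j r • π k x

namespace IsGrading

variable {ρ : ℤ → R →+ R} {N : Type*} [AddCommGroup N] [Module R N] {π : ℤ → N →+ N}

theorem proj_self (h : IsGrading ρ π) (k : ℤ) (x : N) : π k (π k x) = π k x := by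
  obtain ⟨s, hs⟩ := h.exists_sum x
  conv_rhs => rw [← hs, map_sum]
  by_cases hk : k ∈ s
  · rw [Finset.sum_eq_single_of_mem k hk fun j _ hj => h.proj_proj x hj.symm]
  · rw [Finset.sum_eq_zero fun j hj => h.proj_proj x (by rintro rfl; exact hk hj)]
    rw [← hs, map_sum, map_sum]
    refine Finset.sum_eq_zero fun j hj => ?_
    rw [h.proj_proj x (by rintro rfl; exact hk hj), map_zero]

theorem exists_sum_of_subset (h : IsGrading ρ π) (x : N) :
    ∃ s : Finset ℤ, ∀ t, s ⊆ t → ∑ k ∈ t, π k x = x := by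
  obtain ⟨s, hs⟩ := h.exists_sum x
  refine ⟨s, fun t ht => ?_⟩
  rw [← Finset.sum_subset ht, hs]
  intro k _ hk
  rw [← hs, map_sum]
  exact Finset.sum_eq_zero fun j hj => h.proj_proj x (by rintro rfl; exact hk hj)

theorem proj_smul_of_proj_eq (hρ : IsGrading ρ ρ) (h : IsGrading ρ π) {d : ℤ} {x : N}
    (hx : π d x = x) (k : ℤ) (r : R) : π k (r • x) = ρ (k - d) r • x := by
  obtain ⟨s, hs⟩ := hρ.exists_sum_of_subset r
  have hs := hs (insert (k - d) s) (Finset.subset_insert _ _)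
  conv_lhs => rw [← hs, Finset.sum_smul, map_sum]
  rw [Finset.sum_eq_single_of_mem (k - d) (Finset.mem_insert_self _ _)]
  · have := h.proj_smul (k - d) d r x
    rwa [sub_add_cancel, hx] at this
  · intro j _ hj
    have : k = j + (k - j) := by ring
    rw [this, h.proj_smul, ← hx, h.proj_proj _ (by omega), smul_zero]

theorem span_range_proj (h : IsGrading ρ π) :
    Submodule.span R {x : N | ∃ d, π d x = x} = ⊤ := by
  rw [eq_top_iff]
  intro x _
  obtain ⟨s, hs⟩ := h.exists_sum x
  rw [← hs]
  exact Submodule.sum_mem _ fun k _ => Submodule.subset_span ⟨k, h.proj_self k x⟩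

section Cover

variable {b : ℕ} {x : Fin b → N} {d : Fin b → ℤ}

theorem proj_linearCombination (hρ : IsGrading ρ ρ) (h : IsGrading ρ π)
    (hx : ∀ i, π (d i) (x i) = x i) (k : ℤ) (v : Fin b → R) :
    π k (Fintype.linearCombination R x v) =
      Fintype.linearCombination R x fun i => ρ (k - d i) (v i) := by
  simp only [Fintype.linearCombination_apply, map_sum]
  exact Finset.sum_congr rfl fun i _ => proj_smul_of_proj_eq hρ h (hx i) k (v i)

/-- The kernel of a homogeneous map from a graded free module is graded. -/
theorem exists_ker_linearCombination (hρ : IsGrading ρ ρ) (h : IsGrading ρ π)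
    (hx : ∀ i, π (d i) (x i) = x i) :
    ∃ π' : ℤ → LinearMap.ker (Fintype.linearCombination R x) →+
      LinearMap.ker (Fintype.linearCombination R x), IsGrading ρ π' := by
  refine ⟨fun k =>
    { toFun := fun v => ⟨fun i => ρ (k - d i) (v.1 i), ?_⟩
      map_zero' := ?_
      map_add' := ?_ }, ?_, ?_, ?_⟩
  · rw [LinearMap.mem_ker, ← proj_linearCombination hρ h hx, LinearMap.mem_ker.1 v.2, map_zero]
  · exact Subtype.ext (funext fun i => map_zero _)
  · exact fun v w => Subtype.ext (funext fun i => map_add _ _ _)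
  · intro v
    choose s hs using fun i => hρ.exists_sum_of_subset (v.1 i)
    refine ⟨Finset.univ.biUnion fun i => (s i).map (addRightEmbedding (d i)),
      Subtype.ext (funext fun i => ?_)⟩
    rw [AddSubmonoidClass.coe_finsetSum, Finset.sum_apply]
    change ∑ k ∈ _, ρ (k - d i) (v.1 i) = v.1 i
    conv_rhs => rw [← hs i ((Finset.univ.biUnion fun i =>
      (s i).map (addRightEmbedding (d i))).map (addRightEmbedding (- d i))) (by
        intro n hn
        rw [Finset.mem_map]
        refine ⟨n + d i, Finset.mem_biUnion.2 ⟨i, Finset.mem_univ _,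
          Finset.mem_map.2 ⟨n, hn, rfl⟩⟩, ?_⟩
        simp)]
    rw [Finset.sum_map]
    rfl
  · intro j k v hjk
    exact Subtype.ext (funext fun i => hρ.proj_proj _ (by omega))
  · intro j k r v
    refine Subtype.ext (funext fun i => ?_)
    change ρ (j + k - d i) (ρ j r * v.1 i) = ρ j r * ρ (k - d i) (v.1 i)
    rw [add_sub_assoc]
    exact hρ.proj_smul _ _ _ _

end Cover

/-- A version of Nakayama's lemma: a graded module generated by homogeneous elements at the prime
`P` is generated by these elements. -/
theorem exists_homogeneous_span {N : Type u} [AddCommGroup N] [Module R N] {π : ℤ → N →+ N}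
    [Module.Finite R N] (hρ : IsGrading ρ ρ) (h : IsGrading ρ π)
    (P : PrimeSpectrum R) (hP : ∀ r ∉ P.asIdeal, IsUnit (ρ 0 r)) :
    ∃ (d : Fin (fiberRank R P.asIdeal.ResidueField N) → ℤ)
      (x : Fin (fiberRank R P.asIdeal.ResidueField N) → N),
      (∀ i, π (d i) (x i) = x i) ∧ Submodule.span R (Set.range x) = ⊤ := by
  obtain ⟨x, hx, hsupp⟩ := exists_notMem_support_quotient_span N P h.span_range_proj
  choose d hd using hx
  refine ⟨d, x, hd, ?_⟩
  rw [Module.support_eq_zeroLocus, PrimeSpectrum.mem_zeroLocus, Set.not_subset] at hsupp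
  obtain ⟨r, hr, hrP⟩ := hsupp
  have hmem : ∀ y : N, r • y ∈ Submodule.span R (Set.range x) := by
    intro y
    rw [← Submodule.Quotient.mk_eq_zero, Submodule.Quotient.mk_smul]
    exact Module.mem_annihilator.1 hr _
  rw [eq_top_iff, ← h.span_range_proj, Submodule.span_le]
  rintro y ⟨k, hy⟩
  have h1 := hmem y
  rw [← Fintype.range_linearCombination, LinearMap.mem_range] at h1
  obtain ⟨v, hv⟩ := h1
  -- The degree k part of r y is ρ_0(r) y, and ρ_0(r) is a unit. Taking that part of a relation r y
  -- ∈ span x shows that y itself lies in the span.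
  have h2 := proj_smul_of_proj_eq hρ h hy k r
  rw [← hv, proj_linearCombination hρ h hd, sub_self] at h2
  have h3 : ρ 0 r • y ∈ Submodule.span R (Set.range x) := by
    rw [← h2, ← Fintype.range_linearCombination]
    exact ⟨_, rfl⟩
  exact (Submodule.smul_mem_iff_of_isUnit _ (hP r hrP)).1 h3

theorem mu_eq_fiberRank {N : Type u} [AddCommGroup N] [Module R N] {π : ℤ → N →+ N}
    [Module.Finite R N] (hρ : IsGrading ρ ρ) (h : IsGrading ρ π)
    (P : PrimeSpectrum R) (hP : ∀ r ∉ P.asIdeal, IsUnit (ρ 0 r)) :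
    mu R N = fiberRank R P.asIdeal.ResidueField N := by
  obtain ⟨d, x, -, hx⟩ := exists_homogeneous_span hρ h P hP
  exact le_antisymm (mu_le_of_span x hx) (fiberRank_le_mu _ N)

/-- A homogeneous free cover has a graded kernel, and passing to it shifts both sides by the same
rank. In degree zero, the fibre dimension at P equals μ(N), which bounds every fibre dimension. -/
theorem chi_le [IsNoetherianRing R] {N : Type u} [AddCommGroup N] [Module R N] {π : ℤ → N →+ N}
    [Module.Finite R N] (hρ : IsGrading ρ ρ) (h : IsGrading ρ π)
    (P : PrimeSpectrum R) (hP : ∀ r ∉ P.asIdeal, IsUnit (ρ 0 r)) (κ : Type u) [Field κ]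
    [Algebra R κ] (i : ℕ) : chi R κ i N ≤ chi R P.asIdeal.ResidueField i N := by
  induction i generalizing N with
  | zero =>
    rw [chi_zero, chi_zero, ← mu_eq_fiberRank hρ h P hP]
    exact_mod_cast fiberRank_le_mu κ N
  | succ i ih =>
    obtain ⟨d, x, hd, hx⟩ := exists_homogeneous_span hρ h P hP
    have hf : Function.Surjective (Fintype.linearCombination R x) := by
      rw [← LinearMap.range_eq_top, Fintype.range_linearCombination, hx]
    obtain ⟨π', hπ'⟩ := exists_ker_linearCombination hρ h hd
    rw [chi_succ κ i _ hf, chi_succ _ i _ hf]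
    have := ih hπ'
    linarith

end IsGrading

end Grading

end GradedFrobenius

namespace GradedFrobenius

/-! ### Rescaled gradings of R and the grading of F^e_* M. -/

section Twist

variable {R : Type u} [CommRing R] (𝒜 : ℕ → AddSubgroup R) [GradedRing 𝒜]

/-- The projections of the `ℤ`-grading of `R` obtained from an `ℕ`-grading by multiplying all
degrees by `q`. -/
noncomputable def twistedProj (q : ℕ) (k : ℤ) : R →+ R :=
  open Classical in if h : ∃ n : ℕ, (q : ℤ) * n = k then GradedRing.proj 𝒜 h.choose else 0

variable {q : ℕ}

theorem twistedProj_mul (hq : 0 < q) (n : ℕ) :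
    twistedProj 𝒜 q (q * n) = GradedRing.proj 𝒜 n := by
  have h : ∃ m : ℕ, (q : ℤ) * m = q * n := ⟨n, rfl⟩
  have : h.choose = n := by
    have := mul_left_cancel₀ (by positivity) h.choose_spec
    exact_mod_cast this
  rw [twistedProj, dif_pos h, this]

theorem twistedProj_eq_zero {k : ℤ} (h : ¬ ∃ n : ℕ, (q : ℤ) * n = k) : twistedProj 𝒜 q k = 0 :=
  dif_neg h

theorem isGrading_twistedProj_of (hq : 0 < q) {N : Type*} [AddCommGroup N] [Module R N]
    {π : ℤ → N →+ N} (h1 : ∀ x, ∃ s : Finset ℤ, ∑ k ∈ s, π k x = x)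
    (h2 : ∀ j k x, j ≠ k → π j (π k x) = 0)
    (h3 : ∀ (n : ℕ) (k : ℤ) (r : R) (x : N), r ∈ 𝒜 n → π (q * n + k) (r • x) = r • π k x) :
    IsGrading (twistedProj 𝒜 q) π where
  exists_sum := h1
  proj_proj x hjk := h2 _ _ x hjk
  proj_smul j k r x := by
    by_cases hj : ∃ n : ℕ, (q : ℤ) * n = j
    · obtain ⟨n, rfl⟩ := hj
      rw [twistedProj_mul 𝒜 hq]
      exact h3 n k _ x (SetLike.coe_mem _)
    · simp [twistedProj_eq_zero 𝒜 hj]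

theorem isGrading_twistedProj (hq : 0 < q) :
    IsGrading (twistedProj 𝒜 q) (twistedProj 𝒜 q) := by
  classical
  refine isGrading_twistedProj_of 𝒜 hq ?_ ?_ ?_
  · intro x
    refine ⟨(DirectSum.decompose 𝒜 x).support.map
      ⟨fun n : ℕ => (q : ℤ) * n, fun a b h => ?_⟩, ?_⟩
    · have := mul_left_cancel₀ (by positivity) h
      exact_mod_cast this
    · rw [Finset.sum_map]
      conv_rhs => rw [← DirectSum.sum_support_decompose 𝒜 x]
      refine Finset.sum_congr rfl fun n _ => ?_
      exact DFunLike.congr_fun (twistedProj_mul 𝒜 hq n) x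
  · intro j k x hjk
    by_cases hj : ∃ n : ℕ, (q : ℤ) * n = j
    · by_cases hk : ∃ n : ℕ, (q : ℤ) * n = k
      · obtain ⟨n, rfl⟩ := hj
        obtain ⟨m, rfl⟩ := hk
        rw [twistedProj_mul 𝒜 hq, twistedProj_mul 𝒜 hq]
        exact DirectSum.decompose_of_mem_ne 𝒜 (SetLike.coe_mem _) (by rintro rfl; exact hjk rfl)
      · simp [twistedProj_eq_zero 𝒜 hk]
    · simp [twistedProj_eq_zero 𝒜 hj]
  · intro n k r x hr
    by_cases hk : ∃ m : ℕ, (q : ℤ) * m = k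
    · obtain ⟨m, rfl⟩ := hk
      rw [← mul_add, ← Nat.cast_add, twistedProj_mul 𝒜 hq, twistedProj_mul 𝒜 hq]
      exact DirectSum.coe_decompose_mul_add_of_left_mem 𝒜 hr
    · rw [twistedProj_eq_zero 𝒜 hk, AddMonoidHom.zero_apply, smul_zero]
      by_cases hl : ∃ l : ℕ, (q : ℤ) * l = q * n + k
      · obtain ⟨l, hl⟩ := hl
        rw [← hl, twistedProj_mul 𝒜 hq]
        refine DirectSum.coe_decompose_mul_of_left_mem_of_not_le 𝒜 hr fun hnl => hk ⟨l - n, ?_⟩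
        rw [Nat.cast_sub hnl, mul_sub, hl, add_sub_cancel_left]
      · rw [twistedProj_eq_zero 𝒜 hl, AddMonoidHom.zero_apply]

theorem isUnit_twistedProj_zero [IsLocalRing (𝒜 0)] (hq : 0 < q) {r : R}
    (hr : r ∉ irrelevantMaximal 𝒜) : IsUnit (twistedProj 𝒜 q 0 r) := by
  rw [irrelevantMaximal_eq_comap, Ideal.mem_comap, mem_maximalIdeal, mem_nonunits_iff,
    not_not] at hr
  have h := twistedProj_mul 𝒜 hq 0
  rw [Nat.cast_zero, mul_zero] at h
  rw [h]
  exact hr.map (algebraMap (𝒜 0) R)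

/-- The grading of a graded module, regarded as a grading of its Frobenius pushforwards. -/
theorem exists_isGrading_pushforward (p : ℕ) [Fact p.Prime] [CharP R p] {M : Type u}
    [AddCommGroup M] [Module R M] (ℳ : ℤ → AddSubgroup M) [DirectSum.Decomposition ℳ]
    (hℳ : ∀ (n : ℕ) (k : ℤ) (r : R) (x : M), r ∈ 𝒜 n → x ∈ ℳ k → r • x ∈ ℳ (n + k)) (e : ℕ) :
    ∃ π : ℤ → FrobeniusPushforward p e M →+ FrobeniusPushforward p e M,
      IsGrading (twistedProj 𝒜 (p ^ e)) π := by
  classical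
  let π : ℤ → M →+ M := fun k =>
    { toFun := fun x => DirectSum.decompose ℳ x k
      map_zero' := by simp
      map_add' := by simp }
  have hsum : ∀ x, ∑ k ∈ (DirectSum.decompose ℳ x).support, π k x = x :=
    DirectSum.sum_support_decompose ℳ
  have hsmul : ∀ (m : ℕ) (k : ℤ) (a : R) (x : M), a ∈ 𝒜 m → π (m + k) (a • x) = a • π k x := by
    intro m k a x ha
    have hne : ∀ j, j ≠ k → π (m + k) (a • π j x) = 0 := fun j hj =>
      DirectSum.decompose_of_mem_ne ℳ (hℳ m j a _ ha (SetLike.coe_mem _)) (by omega)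
    have heq : π (m + k) (a • π k x) = a • π k x :=
      DirectSum.decompose_of_mem_same ℳ (hℳ m k a _ ha (SetLike.coe_mem _))
    conv_lhs => rw [← hsum x, Finset.smul_sum, map_sum]
    by_cases hk : k ∈ (DirectSum.decompose ℳ x).support
    · rw [Finset.sum_eq_single_of_mem k hk fun j _ hj => hne j hj, heq]
    · rw [Finset.sum_eq_zero fun j hj => hne j (by rintro rfl; exact hk hj)]
      have : π k x = 0 := by
        change ((DirectSum.decompose ℳ x k : ℳ k) : M) = 0
        rw [DFinsupp.notMem_support_iff.1 hk, ZeroMemClass.coe_zero]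
      rw [this, smul_zero]
  refine ⟨π, isGrading_twistedProj_of 𝒜 (pow_pos (Fact.out : p.Prime).pos e)
    (fun x => ⟨_, hsum x⟩)
    (fun j k x hjk => DirectSum.decompose_of_mem_ne ℳ (SetLike.coe_mem _) hjk.symm) ?_⟩
  intro n k r x hr
  -- An element r of degree n acts on F^e_* M as r^{p^e}, of degree p^e n. The module keeps its
  -- degrees and those of R are rescaled.
  have := hsmul (p ^ e * n) k (r ^ p ^ e) x (by simpa using SetLike.pow_mem_graded (p ^ e) hr)
  rw [Nat.cast_mul] at this
  exact this

end Twist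

end GradedFrobenius

namespace GradedFrobenius

open TensorProduct

/-! ### Global invariants compared with χ_i. -/

section Global

variable {p : ℕ} [Fact p.Prime] {R : Type u} [CommRing R]

namespace FreeResolution

variable {N : Type u} [AddCommGroup N] [Module R N] (G : FreeResolution R N)

theorem fiberSyzygy_le_muSyzygy (κ : Type u) [Field κ] [Algebra R κ] (i : ℕ) :
    G.fiberSyzygy κ i ≤ G.muSyzygy i := by
  cases i <;> exact fiberRank_le_mu _ _

theorem muSyzygy_le [IsNoetherianRing R] {h : PrimeSpectrum R → ℕ} (hh : StrictAnti h) {n : ℕ}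
    (i : ℕ) (hn : ∀ P, G.fiberSyzygy P.asIdeal.ResidueField i + h P ≤ n) : G.muSyzygy i ≤ n := by
  cases i <;> exact mu_le_of_fiberRank_add_le hh _ hn

/-- The ranks cancel, leaving μ(Ω_i) − dim κ ⊗ Ω_i. By assumption every fibre dimension of Ω_i is at
most the one at κ, so Forster–Swan bounds the difference by the maximum of h, whatever the
resolution. -/
theorem abs_euler_sub_chi_le [IsNoetherianRing R] {h : PrimeSpectrum R → ℕ} (hh : StrictAnti h)
    {B : ℕ} (hB : ∀ P, h P ≤ B) (κ : Type u) [Field κ] [Algebra R κ] {i : ℕ}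
    (hκ : ∀ P : PrimeSpectrum R, chi R P.asIdeal.ResidueField i N ≤ chi R κ i N) :
    |(G.euler i : ℝ) - chi R κ i N| ≤ B := by
  have h1 : G.muSyzygy i ≤ G.fiberSyzygy κ i + B := by
    refine G.muSyzygy_le hh i fun P => ?_
    have := hκ P
    rw [G.chi_eq P.asIdeal.ResidueField, G.chi_eq κ] at this
    have := hB P
    omega
  have h2 := G.fiberSyzygy_le_muSyzygy κ i
  have h3 : |G.euler i - chi R κ i N| ≤ B := by
    rw [G.chi_eq κ, euler, abs_le]
    constructor <;> omega
  exact_mod_cast h3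

theorem IsMinimal.muSyzygy_succ {G : FreeResolution R N} (hG : G.IsMinimal) (i : ℕ) :
    (G.muSyzygy (i + 1) : ℤ) = G.euler (i + 1) + G.euler i := by
  rw [euler, euler, G.sum_ranks_succ, ← hG i]
  ring

end FreeResolution

variable [CharP R p]

/-- A bounding function for the Forster–Swan theorem which does not contribute to limits. -/
theorem exists_strictAnti [IsNoetherianRing R] (hF : IsFFinite p R) {γ : ℕ}
    (hγ : min 1 (ringKrullDim R) ≤ (γ : WithBot ℕ∞)) :
    ∃ (h : PrimeSpectrum R → ℕ) (B : ℕ), StrictAnti h ∧ (∀ P, h P ≤ B) ∧ (γ = 0 → B = 0) := by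
  -- For γ = 0 a nonzero bounded error would survive in the limit, but then dim R ≤ 0, there are no
  -- strict inclusions of primes, and h = 0 is admissible. For γ > 0 any bounded error vanishes and
  -- h = α works.
  rcases Nat.eq_zero_or_pos γ with rfl | hpos
  · have hdim : ringKrullDim R ≤ 0 := by
      rcases min_le_iff.1 hγ with h | h
      · exact absurd h (by norm_num)
      · exact_mod_cast h
    refine ⟨fun _ => 0, 0, fun P Q hPQ => ?_, fun _ => le_rfl, fun _ => rfl⟩
    have : Ring.KrullDimLE 0 R := by
      rw [Ring.krullDimLE_iff]
      exact_mod_cast hdim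
    have hmax : P.asIdeal.IsMaximal := P.2.isMaximal'
    exact absurd (hmax.eq_of_le Q.2.ne_top hPQ.le) (fun h => hPQ.ne (PrimeSpectrum.ext h))
  · exact ⟨fun P => alpha p P, gammaRing p R, fun _ _ h => alpha_lt_of_lt hF h,
      alpha_le_gammaRing hF, fun h => by omega⟩

theorem tendsto_div_of_abs_sub_le {a b : ℕ → ℝ} {B γ : ℕ} {c : ℝ} (hB : γ = 0 → B = 0)
    (hab : ∀ e, |a e - b e| ≤ B)
    (hb : Tendsto (fun e : ℕ => b e / (p : ℝ) ^ (e * γ)) atTop (𝓝 c)) :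
    Tendsto (fun e : ℕ => a e / (p : ℝ) ^ (e * γ)) atTop (𝓝 c) := by
  have hp : (1 : ℝ) < p := by exact_mod_cast (Fact.out : p.Prime).one_lt
  have h : Tendsto (fun e : ℕ => (a e - b e) / (p : ℝ) ^ (e * γ)) atTop (𝓝 0) := by
    refine tendsto_div_of_abs_le (C := B) fun e => (hab e).trans ?_
    rcases Nat.eq_zero_or_pos γ with h0 | hpos
    · simp [hB h0]
    · refine le_mul_of_one_le_right (by positivity) (one_le_pow₀ ?_)
      rw [one_le_div (by linarith)]
      exact le_self_pow₀ hp.le hpos.ne'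
  have := h.add hb
  rw [zero_add] at this
  refine this.congr fun e => ?_
  ring

variable [IsNoetherianRing R] {M : Type u} [AddCommGroup M] [Module R M] [Module.Finite R M]

theorem hasGlobalChi (hF : IsFFinite p R) {γ i : ℕ}
    (hγ : min 1 (ringKrullDim R) ≤ (γ : WithBot ℕ∞)) (κ : Type u) [Field κ] [Algebra R κ]
    (hκ : ∀ e (P : PrimeSpectrum R),
      frobChi p R P.asIdeal.ResidueField i e M ≤ frobChi p R κ i e M) {c : ℝ}
    (hc : Tendsto (fun e : ℕ => (frobChi p R κ i e M : ℝ) / (p : ℝ) ^ (e * γ)) atTop (𝓝 c)) :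
    HasGlobalChi p R M γ i c := by
  obtain ⟨h, B, hh, hB, hB0⟩ := exists_strictAnti hF hγ
  refine ⟨fun e => ?_, fun G => ?_⟩
  · have := hF.finite_pushforward e M
    exact ⟨(FreeResolution.exists_isMinimal (R := R) _).choose⟩
  · exact tendsto_div_of_abs_sub_le hB0
      (fun e => (G e).abs_euler_sub_chi_le hh hB κ (hκ e)) hc

theorem HasGlobalChi.hasGlobalBetti_zero (hF : IsFFinite p R) {γ : ℕ} {c : ℝ}
    (h : HasGlobalChi p R M γ 0 c) : HasGlobalBetti p R M γ 0 c := by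
  refine ⟨fun e => ?_, fun G _ => (h.2 G).congr fun e => ?_⟩
  · have := hF.finite_pushforward e M
    exact FreeResolution.exists_isMinimal _
  · simp [FreeResolution.euler]

theorem HasGlobalChi.hasGlobalBetti_succ (hF : IsFFinite p R) {γ i : ℕ} {c c' : ℝ}
    (h : HasGlobalChi p R M γ (i + 1) c) (h' : HasGlobalChi p R M γ i c') :
    HasGlobalBetti p R M γ (i + 1) (c + c') := by
  refine ⟨fun e => ?_, fun G hG => ((h.2 G).add (h'.2 G)).congr fun e => ?_⟩
  · have := hF.finite_pushforward e M
    exact FreeResolution.exists_isMinimal _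
  · rw [← add_div, ← Int.cast_add, ← (hG e).muSyzygy_succ, Int.cast_natCast]

end Global

/-! ### Local invariants compared with χ_i. -/

section Local

variable {p : ℕ}

theorem localChi_zero_eq (A : Type u) [CommRing A] [IsLocalRing A] [ExpChar A p] (N : Type u)
    [AddCommGroup N] [Module A N] (e : ℕ) : localChi p A N 0 e = localBetti p A N 0 e := by
  simp [localChi]

theorem localChi_succ (A : Type u) [CommRing A] [IsLocalRing A] [ExpChar A p] (N : Type u)
    [AddCommGroup N] [Module A N] (i e : ℕ) :
    localChi p A N (i + 1) e = localBetti p A N (i + 1) e - localChi p A N i e := by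
  rw [localChi, Finset.sum_range_succ, localChi, Nat.sub_self, pow_zero, one_mul, add_comm,
    sub_eq_add_neg, ← Finset.sum_neg_distrib]
  congr 1
  refine Finset.sum_congr rfl fun j hj => ?_
  rw [Nat.sub_add_comm (Nat.lt_succ_iff.1 (Finset.mem_range.1 hj)), pow_succ]
  ring

variable [Fact p.Prime] {A : Type u} [CommRing A] [IsLocalRing A] [CharP A p]
  (N : Type u) [AddCommGroup N] [Module A N] [Module.Finite A N]

theorem localBetti_zero [IsNoetherianRing A] (hF : IsFFinite p A) (e : ℕ) :
    (localBetti p A N 0 e : ℤ) = frobChi p A (ResidueField A) 0 e N := by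
  have := hF.finite_pushforward e N
  exact length_tor_residueField_zero _

theorem localBetti_succ [IsNoetherianRing A] (hF : IsFFinite p A) (i e : ℕ) :
    (localBetti p A N (i + 1) e : ℤ) =
      frobChi p A (ResidueField A) (i + 1) e N + frobChi p A (ResidueField A) i e N := by
  have := hF.finite_pushforward e N
  exact length_tor_residueField_succ _ i

theorem localChi_eq [IsNoetherianRing A] (hF : IsFFinite p A) (i e : ℕ) :
    localChi p A N i e = frobChi p A (ResidueField A) i e N := by
  induction i with
  | zero => rw [localChi_zero_eq, localBetti_zero N hF]
  | succ i ih => rw [localChi_succ, localBetti_succ N hF, ih, add_sub_cancel_right]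

/-- F^e_* commutes with localization, and localization is a flat base change that does not alter the
fibre at P. -/
theorem frobChi_localization {R : Type u} [CommRing R] [CharP R p] [IsNoetherianRing R]
    (hF : IsFFinite p R) (P : Ideal R) [P.IsPrime] (M : Type u) [AddCommGroup M] [Module R M]
    [Module.Finite R M] (i e : ℕ) :
    frobChi p (Localization.AtPrime P) (ResidueField (Localization.AtPrime P)) i e
      (LocalizedModule.AtPrime P M) = frobChi p R P.ResidueField i e M := by
  have := hF.finite_pushforward e M
  have hb : IsBaseChange (Localization.AtPrime P)
      (FrobeniusPushforward.map p e (LocalizedModule.mkLinearMap P.primeCompl M)) :=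
    IsLocalizedModule.isBaseChange P.primeCompl _ _
  rw [frobChi, frobChi, ← chi_congr _ i hb.equiv]
  exact chi_baseChange _ _ _ i

/-- Every submodule of W remains one for the Frobenius action. This gives finiteness of
λ(N/𝔪^{[p^e]} N) before the exact length formula, which requires it. -/
theorem length_le_length_pushforward {A : Type*} [CommRing A] [CharP A p] (e : ℕ) (W : Type*)
    [AddCommGroup W] [Module A W] :
    Module.length A W ≤ Module.length A (FrobeniusPushforward p e W) := by
  rw [← WithBot.coe_le_coe, Module.coe_length, Module.coe_length]
  let φ : Submodule A W → Submodule A (FrobeniusPushforward p e W) := fun W' =>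
    { carrier := {x | (FrobeniusPushforward.of p e W).symm x ∈ W'}
      add_mem' := fun hx hy => W'.add_mem hx hy
      zero_mem' := W'.zero_mem
      smul_mem' := fun a _ hx => W'.smul_mem (a ^ p ^ e) hx }
  have hφ : ∀ W' W'' : Submodule A W, φ W' ≤ φ W'' ↔ W' ≤ W'' := fun _ _ => Iff.rfl
  exact Order.krullDim_le_of_strictMono φ fun W' W'' h =>
    lt_of_le_not_ge ((hφ _ _).2 h.le) fun h' => h.not_ge ((hφ _ _).1 h')

theorem ker_map_mkQ {A : Type*} [CommRing A] [CharP A p] (I : Ideal A) (e : ℕ) (N : Type*)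
    [AddCommGroup N] [Module A N] :
    LinearMap.ker (FrobeniusPushforward.map p e
      ((I.map (iterateFrobenius A p e)) • (⊤ : Submodule A N)).mkQ) =
        I • (⊤ : Submodule A (FrobeniusPushforward p e N)) := by
  apply le_antisymm
  · intro x hx
    obtain ⟨x, rfl⟩ := (FrobeniusPushforward.of p e N).surjective x
    rw [LinearMap.mem_ker, FrobeniusPushforward.map_apply, AddEquiv.map_eq_zero_iff,
      Submodule.mkQ_apply, Submodule.Quotient.mk_eq_zero] at hx
    refine Submodule.smul_induction_on hx (fun j hj n _ => ?_) (fun y z hy hz => ?_)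
    · induction hj using Submodule.span_induction generalizing n with
      | mem j hj =>
        obtain ⟨r, hr, rfl⟩ := hj
        rw [iterateFrobenius_def, ← FrobeniusPushforward.smul_of]
        exact Submodule.smul_mem_smul hr Submodule.mem_top
      | zero => rw [zero_smul, map_zero]; exact Submodule.zero_mem _
      | add j k _ _ hj hk =>
        rw [add_smul, map_add]
        exact Submodule.add_mem _ (hj n Submodule.mem_top) (hk n Submodule.mem_top)
      | smul a j _ hj =>
        rw [smul_eq_mul, mul_comm, mul_smul]
        exact hj _ Submodule.mem_top
    · rw [map_add]
      exact Submodule.add_mem _ hy hz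
  · rw [Submodule.smul_le]
    intro r hr x _
    obtain ⟨x, rfl⟩ := (FrobeniusPushforward.of p e N).surjective x
    rw [LinearMap.mem_ker, FrobeniusPushforward.smul_of, FrobeniusPushforward.map_apply,
      AddEquiv.map_eq_zero_iff, Submodule.mkQ_apply, Submodule.Quotient.mk_eq_zero,
      ← iterateFrobenius_def]
    exact Submodule.smul_mem_smul (Ideal.mem_map_of_mem _ hr) Submodule.mem_top

/-- Passing from `F^e_* N ⧸ 𝔪 F^e_* N` to `N ⧸ 𝔪^{[p^e]} N`. -/
theorem frobChi_zero_eq_length (hF : IsFFinite p A) (e : ℕ) :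
    frobChi p A (ResidueField A) 0 e N = (frobeniusDegree p (ResidueField A) : ℤ) ^ e *
      (Module.length A (N ⧸ (((maximalIdeal A).map (iterateFrobenius A p e)) •
        (⊤ : Submodule A N)))).toNat := by
  have := hF.finite_pushforward e N
  let J := (maximalIdeal A).map (iterateFrobenius A p e)
  let f := FrobeniusPushforward.map p e (J • (⊤ : Submodule A N)).mkQ
  have hf : Function.Surjective f :=
    FrobeniusPushforward.map_surjective (Submodule.mkQ_surjective _)
  have hlen : Module.length A (FrobeniusPushforward p e (N ⧸ J • (⊤ : Submodule A N))) =
      fiberRank A (ResidueField A) (FrobeniusPushforward p e N) := by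
    rw [← length_residueField_tensor, ← (f.quotKerEquivOfSurjective hf).length_eq, ker_map_mkQ]
    exact (TensorProduct.quotTensorEquivQuotSMul _ (maximalIdeal A)).symm.length_eq
  have hfin : IsFiniteLength A (N ⧸ J • (⊤ : Submodule A N)) := by
    rw [← Module.length_ne_top_iff]
    refine ne_top_of_le_ne_top ?_ (length_le_length_pushforward (p := p) e _)
    rw [hlen]
    exact ENat.natCast_ne_top _
  rw [length_pushforward hF e _ hfin] at hlen
  have htop := Module.length_ne_top_iff.2 hfin
  change _ = _ * ((Module.length A (N ⧸ J • (⊤ : Submodule A N))).toNat : ℤ)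
  lift Module.length A (N ⧸ J • (⊤ : Submodule A N)) to ℕ using htop with l
  rw [ENat.toNat_natCast, frobChi, chi_zero]
  exact_mod_cast hlen.symm

end Local

/-! ### The equality γ(R) = α(𝔪) + dim R_𝔪. -/

section Dimension

/-- The homogeneous core P* of a prime P is a prime contained in both P and 𝔪, so α(P) ≤ α(P*) ≤
α(𝔪) + ht 𝔪. Conversely, α strictly increases down a chain below 𝔪, so ht 𝔪 ≤ γ(R) − α(𝔪). -/
theorem gammaRing_eq {p : ℕ} [Fact p.Prime] {R : Type u} [CommRing R] [CharP R p]
    [IsNoetherianRing R] (hF : IsFFinite p R) (𝒜 : ℕ → AddSubgroup R) [GradedRing 𝒜]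
    [IsLocalRing (𝒜 0)] :
    gammaRing p R = alpha p (⟨irrelevantMaximal 𝒜, inferInstance⟩ : PrimeSpectrum R) +
      ((ringKrullDim (Localization.AtPrime (irrelevantMaximal 𝒜))).unbotD 0).toNat := by
  set m : PrimeSpectrum R := ⟨irrelevantMaximal 𝒜, inferInstance⟩ with hm
  have hdim : (ringKrullDim (Localization.AtPrime (irrelevantMaximal 𝒜))).unbotD 0 =
      Order.height m := by
    rw [IsLocalization.AtPrime.ringKrullDim_eq_height (irrelevantMaximal 𝒜), WithBot.unbotD_coe,
      ← PrimeSpectrum.height_eq_orderHeight]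
  rw [hdim]
  have h1 := height_le_sub_alpha hF (alpha_le_gammaRing hF) m
  have h2 : ∀ P : PrimeSpectrum R, (alpha p P : ℕ∞) ≤ alpha p m + Order.height m := by
    intro P
    let Q : PrimeSpectrum R := ⟨_, P.2.homogeneousCore (𝒜 := 𝒜)⟩
    have hQm : Q ≤ m := by
      intro x hx
      change x ∈ irrelevantMaximal 𝒜
      rw [irrelevantMaximal_eq_comap, Ideal.mem_comap, mem_maximalIdeal, mem_nonunits_iff]
      intro hu
      have hx0 := (P.asIdeal.homogeneousCore 𝒜).isHomogeneous 0 hx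
      exact Q.2.ne_top (Ideal.eq_top_of_isUnit_mem _ hx0 (hu.map (algebraMap (𝒜 0) R)))
    have h3 : alpha p P ≤ alpha p Q :=
      alpha_le_of_le hF (Ideal.toIdeal_homogeneousCore_le 𝒜 P.asIdeal)
    exact (by exact_mod_cast h3 : (alpha p P : ℕ∞) ≤ alpha p Q).trans (alpha_le_add_height hF hQm)
  have h4 := alpha_le_gammaRing hF m
  generalize Order.height m = H at h1 h2
  lift H to ℕ using by rintro rfl; simp at h1
  rw [ENat.toNat_natCast]
  have : Nonempty (PrimeSpectrum R) := ⟨m⟩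
  apply le_antisymm
  · exact ciSup_le fun P => by exact_mod_cast h2 P
  · norm_cast at h1
    omega

end Dimension

end GradedFrobenius

/-! ### Assembly of the main theorem. -/

open GradedFrobenius in
theorem mainTheorem10 (p : ℕ) [Fact p.Prime]
    {R : Type u} [CommRing R] [CharP R p]
    (𝒜 : ℕ → AddSubgroup R) [GradedRing 𝒜]
    [IsLocalRing (𝒜 0)] [IsNoetherianRing (𝒜 0)] (hF : IsFFinite p (𝒜 0))
    [Algebra.FiniteType (𝒜 0) R]
    {M : Type u} [AddCommGroup M] [Module R M] [Module.Finite R M]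
    (ℳ : ℤ → AddSubgroup M) [DirectSum.Decomposition ℳ]
    (hℳ : ∀ (n : ℕ) (k : ℤ) (r : R) (x : M), r ∈ 𝒜 n → x ∈ ℳ k → r • x ∈ ℳ (n + k)) :
    (∀ γ : ℕ, gammaModule p R M ≤ γ → min 1 (ringKrullDim R) ≤ (γ : WithBot ℕ∞) → ∀ i : ℕ,
      (∃ β : ℝ, HasGlobalBetti p R M γ i β ∧
        HasLocalBetti p (Localization.AtPrime (irrelevantMaximal 𝒜))
          (LocalizedModule.AtPrime (irrelevantMaximal 𝒜) M) γ i β) ∧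
      (∃ χ : ℝ, HasGlobalChi p R M γ i χ ∧
        HasLocalChi p (Localization.AtPrime (irrelevantMaximal 𝒜))
          (LocalizedModule.AtPrime (irrelevantMaximal 𝒜) M) γ i χ)) ∧
    (∃ h : ℝ, HasGlobalHilbertKunz p R M h ∧
      HasLocalHilbertKunz p (Localization.AtPrime (irrelevantMaximal 𝒜))
        (LocalizedModule.AtPrime (irrelevantMaximal 𝒜) M) h) := by
  have : IsNoetherianRing R := Algebra.FiniteType.isNoetherianRing (𝒜 0) R
  have hFR : IsFFinite p R := isFFinite_of_finiteType hF
  let m : PrimeSpectrum R := ⟨irrelevantMaximal 𝒜, inferInstance⟩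
  let κ := (irrelevantMaximal 𝒜).ResidueField
  let A := Localization.AtPrime (irrelevantMaximal 𝒜)
  let MA := LocalizedModule.AtPrime (irrelevantMaximal 𝒜) M
  have hFA : IsFFinite p A := isFFinite_of_isLocalization (irrelevantMaximal 𝒜).primeCompl hFR
  have hpos : ∀ e, 0 < p ^ e := fun e => pow_pos (Fact.out : p.Prime).pos e
  have hfin : ∀ e, Module.Finite R (FrobeniusPushforward p e M) :=
    fun e => hFR.finite_pushforward e M
  have hloc : ∀ i e, frobChi p A (ResidueField A) i e MA = frobChi p R κ i e M :=
    fun i e => frobChi_localization hFR _ M i e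
  constructor
  · intro γ hγ hdim
    have hκ : ∀ i e (P : PrimeSpectrum R),
        frobChi p R P.asIdeal.ResidueField i e M ≤ frobChi p R κ i e M := by
      intro i e P
      obtain ⟨π, hπ⟩ := exists_isGrading_pushforward 𝒜 p ℳ hℳ e
      exact (isGrading_twistedProj 𝒜 (hpos e)).chi_le hπ m
        (fun r hr => isUnit_twistedProj_zero 𝒜 (hpos e) hr) _ i
    choose c hc using fun i => frobChiConverges κ hFR M
      (fun P hP => (alpha_le_gammaModule hFR M hP).trans hγ) i
    have hchi : ∀ i, HasGlobalChi p R M γ i (c i) :=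
      fun i => hasGlobalChi hFR hdim κ (hκ i) (hc i)
    intro i
    refine ⟨?_, c i, hchi i, (hc i).congr fun e => ?_⟩
    · cases i with
      | zero =>
        refine ⟨c 0, (hchi 0).hasGlobalBetti_zero hFR, (hc 0).congr fun e => ?_⟩
        rw [← hloc, ← localBetti_zero MA hFA, Int.cast_natCast]
      | succ i =>
        refine ⟨c (i + 1) + c i, (hchi (i + 1)).hasGlobalBetti_succ hFR (hchi i),
          ((hc (i + 1)).add (hc i)).congr fun e => ?_⟩
        rw [← hloc, ← hloc, ← add_div, ← Int.cast_add, ← localBetti_succ MA hFA, Int.cast_natCast]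
    · rw [localChi_eq _ hFA, hloc]
  · obtain ⟨c, hc⟩ := frobChiConverges κ hFR M (fun P _ => alpha_le_gammaRing hFR P) 0
    refine ⟨c, hc.congr fun e => ?_, hc.congr fun e => ?_⟩
    · obtain ⟨π, hπ⟩ := exists_isGrading_pushforward 𝒜 p ℳ hℳ e
      rw [(isGrading_twistedProj 𝒜 (hpos e)).mu_eq_fiberRank hπ m
        fun r hr => isUnit_twistedProj_zero 𝒜 (hpos e) hr]
      rw [frobChi, chi_zero, Int.cast_natCast]
    · have hp : (p : ℝ) ≠ 0 := by exact_mod_cast (Fact.out : p.Prime).ne_zero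
      -- The factor p^{e α(𝔪)} = [k : k^p]^e of the denominator cancels against the same factor in
      -- the length formula, leaving p^{e dim R_𝔪}.
      rw [← hloc, frobChi_zero_eq_length MA hFA, gammaRing_eq hFR 𝒜, mul_add, pow_add]
      have hdeg : frobeniusDegree p (ResidueField A) = p ^ alpha p m := (pow_alpha hFR m).symm
      rw [hdeg]
      push_cast
      rw [← pow_mul, mul_comm (alpha p _) e, mul_div_mul_left _ _ (pow_ne_zero _ hp)]
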